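/- Let $n\ge 1$ be an integer, $\gamma\in\{1,-1\}$, $0<b<\min\{2,n\}$, let $\alpha_0$ be the positive root of $n\alpha^2+(n-2+2b)\alpha-4+2b=0$, and let $\alpha>\alpha_0$, with $\alpha<\frac{4-2b}{n-2}$ if $n\ge 3$. Put $$r=\frac{n(\alpha+2)}{n-b},\qquad \beta=\frac{4-2b-\alpha(n-2)}{2\alpha(\alpha+2)},$$ and let $r<q\le\infty$. Let $L^{r,q}=L^{r,q}(\mathbb R^n)$ be the Lorentz space with quasi-norm $\|f\|_{L^{r,q}}=\big(\frac qr\int_0^\infty [t^{1/r}f^*(t)]^q\frac{dt}{t}\big)^{1/q}$ for $q<\infty$ and $\|f\|_{L^{r,\infty}}=\sup_{t>0}t^{1/r}f^*(t)$, where $f^*$ is the decreasing rearrangement of $f$. Let $e^{it\Delta}$ be the Schrödinger group on tempered distributions. For $p\in\mathbb C$ with $\mathrm{Re}\,p=\frac{2-b}{\alpha}$ let $\mathcal H_p$ be the set of finite complex linear combinations of functions $P_k(x)|x|^{-p-k}$ on $\mathbb R^n$, where $k\ge 0$ and $P_k$ is a harmonic polynomial, homogeneous of degree $k$, with complex coefficients.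 A (positively global) solution with initial data $\varphi$ is a measurable function $u$ on $\mathbb R^n\times[0,\infty)$ with $u(0)=\varphi$ and $$u(t)=e^{it\Delta}\varphi+i\gamma\int_0^t e^{i(t-\tau)\Delta}\big(|x|^{-b}|u|^\alpha u\big)(\tau)\,d\tau\qquad\text{for all }t>0,$$ in the sense of tempered distributions. Finally let $$K=2|\gamma|(\alpha+1)(4\pi)^{-\frac{n\alpha}{2(\alpha+2)}}\,B\Big(1-\frac{n\alpha+2b}{2(\alpha+2)},\,1-\beta(\alpha+1)\Big),$$ where $B$ is the beta function. **Theorem 1.2 (Self-similar solutions).** (i) If $\mathrm{Re}\,p=\frac{2-b}{\alpha}$ and $\varphi\in\mathcal H_p$, then $\varphi$ defines a tempered distribution, $\|e^{i\Delta}\varphi\|_{L^r}<\infty$, and $$t^\beta\|e^{it\Delta}\varphi\|_{L^r}=\|e^{i\Delta}\varphi\|_{L^r}\qquad\text{for all }t>0.$$ (ii) There are $c>0$ and $M_0>0$, depending only on $n,b,\alpha,\gamma,q$, such that for every $0<M\le M_0$ the number $\rho=cM$ satisfies $\rho+KM^{\alpha+1}\le M$ and the following holds for all $p$ with $\mathrm{Re}\,p=\frac{2-b}{\alpha}$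 and all $\varphi\in\mathcal H_p$ with $\|e^{i\Delta}\varphi\|_{L^r}\le\rho$. One has $\sup_{t>0}t^\beta\|e^{it\Delta}\varphi\|_{L^{r,q}}\le\rho$; there is a unique solution $u$ with initial data $\varphi$ and $$\sup_{t>0}t^\beta\|u(t)\|_{L^{r,q}}\le M;$$ and $u$ is self-similar: for all $\lambda>0$ and $t\ge 0$, $u(x,t)=\lambda^p u(\lambda x,\lambda^2t)$ for almost every $x\in\mathbb R^n$. -/

import Mathlib

open MeasureTheory Set
open scoped ENNReal SchwartzMap

noncomputable section

/-- The Euclidean space `ℝⁿ`. -/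
abbrev Rn (n : ℕ) : Type := EuclideanSpace ℝ (Fin n)

/-! ### Lorentz quasi-norms -/

/-- The decreasing rearrangement `f*(t) = inf {l : |{x : |f x| > l}| ≤ t}`. -/
def decRearrangement {n : ℕ} (f : Rn n → ℂ) (t : ℝ) : ℝ≥0∞ :=
  sInf {l : ℝ≥0∞ | volume {x | l < ‖f x‖ₑ} ≤ ENNReal.ofReal t}

/-- The Lorentz quasi-norm of `L^{p,q}(ℝⁿ)`: it is `((q/p) ∫₀^∞ (t^{1/p} f*(t))^q dt/t)^{1/q}` for
`q < ∞`, and `sup_{t>0} t^{1/p} f*(t)` for `q = ∞`. -/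
def lorentzNorm {n : ℕ} (p : ℝ) (q : ℝ≥0∞) (f : Rn n → ℂ) : ℝ≥0∞ :=
  if q = ∞ then ⨆ t : Ioi (0 : ℝ), ENNReal.ofReal ((t : ℝ) ^ (1 / p)) * decRearrangement f t
  else (ENNReal.ofReal (q.toReal / p) *
    ∫⁻ t in Ioi (0 : ℝ), (ENNReal.ofReal (t ^ (1 / p)) * decRearrangement f t) ^ q.toReal *
      ENNReal.ofReal (1 / t)) ^ (1 / q.toReal)

/-! ### Functions as tempered distributions -/

/-- The tempered distribution `T` is given by integration against the function `f`. -/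
structure Represents {n : ℕ} (f : Rn n → ℂ) (T : 𝓢'(Rn n, ℂ)) : Prop where
  aestronglyMeasurable : AEStronglyMeasurable f volume
  integrable : ∀ ψ : 𝓢(Rn n, ℂ), Integrable (fun x => ψ x * f x) volume
  apply_eq : ∀ ψ : 𝓢(Rn n, ℂ), T ψ = ∫ x, ψ x * f x

/-- The function `f` defines a tempered distribution. -/
def IsTemperedFun {n : ℕ} (f : Rn n → ℂ) : Prop := ∃ T : 𝓢'(Rn n, ℂ), Represents f T

open Classical in
/-- The tempered distribution defined by the function `f`
(with value `0` if `f` does not define one). -/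
def toDistribution {n : ℕ} (f : Rn n → ℂ) : 𝓢'(Rn n, ℂ) :=
  if h : IsTemperedFun f then h.choose else 0

/-- `toDistribution f` is integration against `f` whenever `f` defines a tempered distribution. -/
theorem IsTemperedFun.represents {n : ℕ} {f : Rn n → ℂ} (h : IsTemperedFun f) :
    Represents f (toDistribution f) := by
  unfold toDistribution
  rw [dif_pos h]
  exact h.choose_spec

/-- The `L^r` norm of a tempered distribution; it is `∞` if the distribution is not a function. -/
def distLpNorm {n : ℕ} (r : ℝ≥0∞) (T : 𝓢'(Rn n, ℂ)) : ℝ≥0∞ :=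
  ⨅ (g : Rn n → ℂ) (_ : Represents g T), eLpNorm g r volume

/-- The `L^{r,q}` quasi-norm of a tempered distribution; it is `∞` if the distribution is not a
function. -/
def distLorentzNorm {n : ℕ} (r : ℝ) (q : ℝ≥0∞) (T : 𝓢'(Rn n, ℂ)) : ℝ≥0∞ :=
  ⨅ (g : Rn n → ℂ) (_ : Represents g T), lorentzNorm r q g

/-! ### The Schrödinger group -/

/-- The symbol `exp(-i t |2πξ|²)` of `e^{itΔ}`, for the Fourier transform with kernel
`exp(-2πi x·ξ)`. -/
def schrodingerSymbol (n : ℕ) (t : ℝ) (ξ : Rn n) : ℂ :=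
  Complex.exp (Complex.I * ((-(t * (2 * Real.pi) ^ 2 * ‖ξ‖ ^ 2) : ℝ) : ℂ))

/-- The Schrödinger group `e^{itΔ}` on tempered distributions. -/
def schrodingerGroup (n : ℕ) (t : ℝ) : 𝓢'(Rn n, ℂ) →L[ℂ] 𝓢'(Rn n, ℂ) :=
  TemperedDistribution.fourierMultiplierCLM ℂ (schrodingerSymbol n t)

/-- The symbol has temperate growth, so that the Fourier multiplier is the genuine one. -/
theorem schrodingerSymbol_hasTemperateGrowth (n : ℕ) (t : ℝ) :
    (schrodingerSymbol n t).HasTemperateGrowth := by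
  have hexp : (fun s : ℝ => Complex.exp (Complex.I * (s : ℂ))).HasTemperateGrowth := by
    have hd : ∀ k : ℕ, iteratedDeriv k (fun s : ℝ => Complex.exp (Complex.I * (s : ℂ))) =
        fun s : ℝ => Complex.I ^ k * Complex.exp (Complex.I * (s : ℂ)) := by
      intro k
      induction k with
      | zero => simp
      | succ k ih =>
        rw [iteratedDeriv_succ, ih]
        funext s
        have h1 : HasDerivAt (fun s : ℝ => Complex.I * (s : ℂ)) (Complex.I * 1) s :=
          (Complex.ofRealCLM.hasDerivAt (x := s)).const_mul Complex.I
        have h2 := (h1.cexp).const_mul (Complex.I ^ k)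
        rw [h2.deriv]
        ring
    refine ⟨?_, fun k => ⟨0, 1, fun s => ?_⟩⟩
    · exact Complex.contDiff_exp.comp (contDiff_const.mul Complex.ofRealCLM.contDiff)
    · rw [norm_iteratedFDeriv_eq_norm_iteratedDeriv, hd k]
      simp [mul_comm Complex.I, Complex.norm_exp_ofReal_mul_I]
  have hphase : (fun ξ : Rn n => -(t * (2 * Real.pi) ^ 2 * ‖ξ‖ ^ 2)).HasTemperateGrowth :=
    ((Function.HasTemperateGrowth.const (t * (2 * Real.pi) ^ 2)).mul
      (Function.hasTemperateGrowth_norm_sq (Rn n))).neg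
  exact hexp.comp hphase

/-! ### The inhomogeneous nonlinear Schrödinger equation -/

/-- The nonlinearity `|x|^{-b} |v|^α v`. -/
def inlsNonlinearity {n : ℕ} (b α : ℝ) (v : Rn n → ℂ) (x : Rn n) : ℂ :=
  ((‖x‖ ^ (-b) * ‖v x‖ ^ α : ℝ) : ℂ) * v x

/-- `u` is a positively global solution with initial data `φ` of the integral equation
`u(t) = e^{itΔ}φ + iγ ∫₀ᵗ e^{i(t-τ)Δ} (|x|^{-b} |u|^α u)(τ) dτ`,
where the identity holds for every `t > 0` in the sense of tempered distributions. -/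
structure IsGlobalSolution {n : ℕ} (b α γ : ℝ) (φ : Rn n → ℂ) (u : ℝ → Rn n → ℂ) : Prop where
  aestronglyMeasurable : AEStronglyMeasurable (fun z : ℝ × Rn n => u z.1 z.2)
    ((volume : Measure (ℝ × Rn n)).restrict (Ioi 0 ×ˢ univ))
  initial : u 0 =ᵐ[volume] φ
  tempered_initial : IsTemperedFun φ
  tempered : ∀ t > 0, IsTemperedFun (u t)
  tempered_nonlinearity : ∀ t > 0, IsTemperedFun (inlsNonlinearity b α (u t))
  integrable : ∀ t > 0, ∀ ψ : 𝓢(Rn n, ℂ), IntervalIntegrable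
    (fun τ => schrodingerGroup n (t - τ) (toDistribution (inlsNonlinearity b α (u τ))) ψ)
    volume 0 t
  duhamel : ∀ t > 0, ∀ ψ : 𝓢(Rn n, ℂ),
    toDistribution (u t) ψ = schrodingerGroup n t (toDistribution φ) ψ +
      Complex.I * (γ : ℂ) * ∫ τ in (0 : ℝ)..t,
        schrodingerGroup n (t - τ) (toDistribution (inlsNonlinearity b α (u τ))) ψ

/-- `u(x,t) = λ^p u(λx, λ²t)` for all `λ > 0`, all times `t ≥ 0` and almost all `x`. -/
def IsSelfSimilar {n : ℕ} (p : ℂ) (u : ℝ → Rn n → ℂ) : Prop :=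
  ∀ l : ℝ, 0 < l → ∀ t : ℝ, 0 ≤ t →
    ∀ᵐ x : Rn n, u t x = (l : ℂ) ^ p * u (l ^ 2 * t) (l • x)

/-- The exponent `β = (4 - 2b - α(n-2)) / (2α(α+2))`. -/
def decayExponent (n : ℕ) (b α : ℝ) : ℝ :=
  (4 - 2 * b - α * ((n : ℝ) - 2)) / (2 * α * (α + 2))

/-- The exponent `r = n(α+2)/(n-b)`. -/
def lebesgueExponent (n : ℕ) (b α : ℝ) : ℝ := (n : ℝ) * (α + 2) / ((n : ℝ) - b)

/-- The constant
`K = 2|γ|(α+1)(4π)^{-nα/(2(α+2))} B(1 - (nα+2b)/(2(α+2)), 1 - β(α+1))`. -/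
def wellPosednessConst (n : ℕ) (b α γ : ℝ) : ℝ :=
  2 * |γ| * (α + 1) * (4 * Real.pi) ^ (-((n : ℝ) * α / (2 * (α + 2)))) *
    ProbabilityTheory.beta (1 - ((n : ℝ) * α + 2 * b) / (2 * (α + 2)))
      (1 - decayExponent n b α * (α + 1))

/-! ### Homogeneous initial data -/

/-- `P` is a harmonic polynomial: its formal Laplacian vanishes. -/
def IsHarmonicPoly {n : ℕ} (P : MvPolynomial (Fin n) ℂ) : Prop :=
  ∑ i, MvPolynomial.pderiv i (MvPolynomial.pderiv i P) = 0

/-- The finite linear combinations of the functions `P_k(x) |x|^{-p-k}`, where `P_k` is a harmonic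
polynomial that is homogeneous of degree `k`. -/
def homogeneousData (n : ℕ) (p : ℂ) : Submodule ℂ (Rn n → ℂ) :=
  Submodule.span ℂ {f | ∃ (k : ℕ) (P : MvPolynomial (Fin n) ℂ), P.IsHomogeneous k ∧
    IsHarmonicPoly P ∧
    f = fun x => MvPolynomial.eval (fun i => (x i : ℂ)) P * (‖x‖ : ℂ) ^ (-p - (k : ℂ))}

end

namespace SelfSimilar

open Filter Topology FourierTransform
open scoped RealInnerProductSpace

/-! ### Approximation by Schwartz functions and duality -/

/-! Scaling reduces everything to time one. A datum `φ` homogeneous of degree `-p` evolves into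
`t^{-p/2} g(x/√t)` with `g = e^{iΔ}φ`, so part (i) is a change of variables once `g` is known to lie
in `L^r`. For that, `|x|^{-p-k}` is written as a superposition of Gaussians `e^{-y|x|²}`. By Hecke's
identity (`fourier_polyFun_mul_gaussian`) the flow keeps the form "harmonic polynomial times
Gaussian", and Hölder's inequality leaves an integral in `y` that converges at `0` because `Re p >
n/r` and at infinity because `Re p < n/r'` (`pairing_homogeneous_le`).

For existence the ansatz is `u(t,x) = t^{-p/2} U(x/√t)`. Since `α Re p = 2 - b`, the Duhamel
equation at every time follows from the one at time one, so `U = g + iγ D(U)` is solved by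
contraction in a ball of `L^r(ℝⁿ)`, with no space-time norm (`exists_profile`). The key estimate is
that `e^{iσΔ}|x|^{-b}` maps `L^s` to `L^r`, `s = r/(α+1)`, with norm `C σ^{-a}`, `a = n(1/2 - 1/r)`
(`exists_strong_estimate`). The weight `|x|^{-b}` lies only in a weak Lebesgue space, so Hölder and
the dispersive estimate alone do not give this. It is proved by real interpolation, with a cut into
`L¹` and `L²` parts that varies with the level of the output. The time integral of `τ^{-β(α+1)}
(1-τ)^{-a}` then converges. The embedding of `L^r` in `L^{r,q}` has constant one
(`lorentzNorm_le_of_eLpNorm`), which gives the Lorentz bounds for both the linear evolution and the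
solution.

Uniqueness concerns arbitrary competitors, neither self-similar nor in `L^r`. It is proved in the
larger class of weak `L^r`: a difference of nonlinearities lies in weak `L^{r'}`
(`exists_weak_nonlinearity_sub`), the flow sends this to weak `L^r` (`exists_weak_estimate`), and
for small `M` any bound on the difference of two solutions improves by a factor two
(`exists_weakDecay_half`), hence the difference vanishes.

Distributions are handled by duality throughout: the flow is transposed to Schwartz functions,
bounds are proved for pairings, a functional bounded in `L¹ + L²` is a function
(`exists_function_of_bound`), and norms are recovered from pairings. The constant `K` of the
statement enters only the inequality `ρ + K M^{α+1} ≤ M`; the contractions have their own constants,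
and `c = 1/2`. -/

theorem exists_schwartz_approx {n : ℕ} {ψ : Rn n → ℂ} {C R : ℝ}
    (hψ : AEStronglyMeasurable ψ volume) (hC : ∀ x, ‖ψ x‖ ≤ C) (hR : ∀ x, R < ‖x‖ → ψ x = 0) :
    ∃ φ : ℕ → 𝓢(Rn n, ℂ), (∀ᵐ x, Tendsto (fun k => φ k x) atTop (𝓝 (ψ x))) ∧
      (∀ k x, ‖φ k x‖ ≤ C) ∧ ∀ k x, R + 1 < ‖x‖ → φ k x = 0 := by
  have hr : ∀ k : ℕ, (0 : ℝ) < 1 / (2 * ((k : ℝ) + 1)) := fun k => by positivity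
  -- The outer radius `1/(k+1)` is twice the inner one: a bounded ratio is what gives convergence
  -- almost everywhere for a merely integrable `ψ`. Outer radii at most one keep all supports in the
  -- ball of radius `R + 1`.
  let b : ℕ → ContDiffBump (0 : Rn n) := fun k =>
    ⟨1 / (2 * ((k : ℝ) + 1)), 2 * (1 / (2 * ((k : ℝ) + 1))), hr k, by linarith [hr k]⟩
  have hb_out : ∀ k, (b k).rOut = 1 / ((k : ℝ) + 1) := fun k => by
    change 2 * (1 / (2 * ((k : ℝ) + 1))) = _
    field_simp
  have hb1 : ∀ k, (b k).rOut ≤ 1 := fun k => by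
    rw [hb_out, div_le_one (by positivity)]
    linarith [(Nat.cast_nonneg k : (0 : ℝ) ≤ k)]
  have hC0 : 0 ≤ C := (norm_nonneg _).trans (hC 0)
  have hψc : HasCompactSupport ψ := by
    refine HasCompactSupport.intro (isCompact_closedBall (0 : Rn n) R) fun x hx => hR x ?_
    simpa using hx
  have hψi : Integrable ψ := by
    have h1 : IntegrableOn ψ (Metric.closedBall 0 R) := by
      refine Measure.integrableOn_of_bounded (M := C) (measure_closedBall_lt_top.ne) hψ ?_
      exact Eventually.of_forall fun x => hC x
    refine h1.integrable_of_forall_notMem_eq_zero fun x hx => hR x ?_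
    simpa using hx
  have hψl : LocallyIntegrable ψ volume := hψi.locallyIntegrable
  let f : ℕ → Rn n → ℂ := fun k =>
    convolution ((b k).normed volume) ψ (ContinuousLinearMap.lsmul ℝ ℝ) volume
  have hfs : ∀ k, HasCompactSupport (f k) := fun k =>
    (b k).hasCompactSupport_normed.convolution _ hψc
  have hfd : ∀ k, ContDiff ℝ ((⊤ : ℕ∞) : WithTop ℕ∞) (f k) := fun k =>
    (b k).hasCompactSupport_normed.contDiff_convolution_left _ (b k).contDiff_normed hψl
  refine ⟨fun k => (hfs k).toSchwartzMap (hfd k), ?_, ?_, ?_⟩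
  · refine ContDiffBump.ae_convolution_tendsto_right_of_locallyIntegrable (φ := b) (K := 2) ?_ ?_ hψl
    · simp_rw [hb_out]
      exact tendsto_one_div_add_atTop_nhds_zero_nat
    · exact Eventually.of_forall fun k => le_rfl
  · intro k x
    change ‖f k x‖ ≤ C
    calc ‖f k x‖ ≤ ∫ t, (b k).normed volume t * C := by
          refine norm_integral_le_of_norm_le ?_ (Eventually.of_forall fun t => ?_)
          · exact ((b k).integrable_normed).mul_const C
          · simp only [ContinuousLinearMap.lsmul_apply, norm_smul, Real.norm_eq_abs,
              abs_of_nonneg ((b k).nonneg_normed t)]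
            exact mul_le_mul_of_nonneg_left (hC _) ((b k).nonneg_normed t)
      _ = C := by rw [integral_mul_const, (b k).integral_normed, one_mul]
  · intro k x hx
    change f k x = 0
    refine integral_eq_zero_of_ae (Eventually.of_forall fun t => ?_)
    by_cases ht : ‖t‖ < (b k).rOut
    · have : ψ (x - t) = 0 := by
        refine hR _ ?_
        have h1 := norm_sub_norm_le x t
        have h2 := hb1 k
        linarith
      simp [this]
    · have : (b k).normed volume t = 0 := by
        by_contra hne
        have h1 : t ∈ Function.support ((b k).normed volume) := hne
        rw [(b k).support_normed_eq] at h1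
        exact ht (by simpa using h1)
      simp [this]

/-- On a compact set `f` agrees with its product with a smooth cutoff, and that product is
integrable by hypothesis. -/
theorem _root_.Represents.locallyIntegrable {n : ℕ} {f : Rn n → ℂ} {T : 𝓢'(Rn n, ℂ)}
    (h : Represents f T) : LocallyIntegrable f volume := by
  rw [locallyIntegrable_iff]
  intro K hK
  obtain ⟨R, hR0, hR⟩ := hK.isBounded.subset_closedBall_lt 0 (0 : Rn n)
  let b : ContDiffBump (0 : Rn n) := ⟨R, R + 1, hR0, by linarith⟩
  have hs : HasCompactSupport (fun x => (b x : ℂ)) :=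
    b.hasCompactSupport.comp_left (g := fun r : ℝ => (r : ℂ)) (by simp)
  have hd : ContDiff ℝ ((⊤ : ℕ∞) : WithTop ℕ∞) (fun x => (b x : ℂ)) :=
    Complex.ofRealCLM.contDiff.comp b.contDiff
  have h1 := (h.integrable (hs.toSchwartzMap hd)).integrableOn (s := Metric.closedBall 0 R)
  have h2 : IntegrableOn f (Metric.closedBall 0 R) volume := by
    refine (integrableOn_congr_fun (fun x hx => ?_) measurableSet_closedBall).1 h1
    have : b x = 1 := b.one_of_mem_closedBall hx
    change (b x : ℂ) * f x = f x
    rw [this]; simp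
  exact h2.mono_set hR

/-- Mollification keeps the sup bound and a common compact support, so dominated convergence applies
to both sides. The two factors on the right cover the three bounds used later: by the `L¹` norm, by
the `L^{r'}` norm, and by a product of powers of the `L¹` and `L²` norms. -/
theorem pairing_le_of_schwartz {n : ℕ} {w : Rn n → ℂ} {B a c p : ℝ}
    (hw : LocallyIntegrable w volume) (ha : 0 ≤ a) (hc : 0 ≤ c) (hp : 0 < p)
    (h : ∀ φ : 𝓢(Rn n, ℂ), ‖∫ x, φ x * w x‖ ≤ B * ((∫ x, ‖φ x‖) ^ a * (∫ x, ‖φ x‖ ^ p) ^ c))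
    {ψ : Rn n → ℂ} {C R : ℝ} (hψ : AEStronglyMeasurable ψ volume) (hC : ∀ x, ‖ψ x‖ ≤ C)
    (hR : ∀ x, R < ‖x‖ → ψ x = 0) :
    ‖∫ x, ψ x * w x‖ ≤ B * ((∫ x, ‖ψ x‖) ^ a * (∫ x, ‖ψ x‖ ^ p) ^ c) := by
  obtain ⟨φ, hφ, hφC, hφR⟩ := exists_schwartz_approx hψ hC hR
  have hC0 : 0 ≤ C := (norm_nonneg _).trans (hC 0)
  have hK : IsCompact (Metric.closedBall (0 : Rn n) (R + 1)) := isCompact_closedBall _ _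
  have hind : ∀ c : ℝ, Integrable
      (indicator (Metric.closedBall (0 : Rn n) (R + 1)) (fun _ => c)) volume := fun c =>
    (integrable_indicator_iff measurableSet_closedBall).2
      (integrableOn_const measure_closedBall_lt_top.ne)
  have l1 : Tendsto (fun k => ∫ x, φ k x * w x) atTop (𝓝 (∫ x, ψ x * w x)) := by
    refine tendsto_integral_of_dominated_convergence
      (indicator (Metric.closedBall (0 : Rn n) (R + 1)) (fun x => C * ‖w x‖)) ?_ ?_ ?_ ?_
    · exact fun k => (φ k).continuous.aestronglyMeasurable.mul hw.aestronglyMeasurable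
    · exact (integrable_indicator_iff measurableSet_closedBall).2
        ((hw.integrableOn_isCompact hK).norm.const_mul C)
    · intro k
      refine Eventually.of_forall fun x => ?_
      by_cases hx : x ∈ Metric.closedBall (0 : Rn n) (R + 1)
      · rw [indicator_of_mem hx, norm_mul]
        exact mul_le_mul_of_nonneg_right (hφC k x) (norm_nonneg _)
      · rw [indicator_of_notMem hx, hφR k x (by simpa using hx)]
        simp
    · filter_upwards [hφ] with x hx
      exact hx.mul_const _
  have l2 : ∀ s : ℝ, 0 < s →
      Tendsto (fun k => ∫ x, ‖φ k x‖ ^ s) atTop (𝓝 (∫ x, ‖ψ x‖ ^ s)) := by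
    intro s hs
    refine tendsto_integral_of_dominated_convergence
      (indicator (Metric.closedBall (0 : Rn n) (R + 1)) (fun _ => C ^ s)) ?_ (hind _) ?_ ?_
    · exact fun k => ((φ k).continuous.norm.rpow_const
        fun _ => Or.inr hs.le).aestronglyMeasurable
    · intro k
      refine Eventually.of_forall fun x => ?_
      rw [Real.norm_of_nonneg (by positivity)]
      by_cases hx : x ∈ Metric.closedBall (0 : Rn n) (R + 1)
      · rw [indicator_of_mem hx]
        exact Real.rpow_le_rpow (norm_nonneg _) (hφC k x) hs.le
      · rw [indicator_of_notMem hx, hφR k x (by simpa using hx)]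
        simp [Real.zero_rpow hs.ne']
    · filter_upwards [hφ] with x hx
      exact hx.norm.rpow_const (Or.inr hs.le)
  have l3 : Tendsto (fun k => ∫ x, ‖φ k x‖) atTop (𝓝 (∫ x, ‖ψ x‖)) := by
    simpa using l2 1 one_pos
  exact le_of_tendsto_of_tendsto l1.norm (((l3.rpow_const (Or.inr ha)).mul
    ((l2 p hp).rpow_const (Or.inr hc))).const_mul B) (Eventually.of_forall fun k => h (φ k))

/-! ### Converse Hölder inequalities: norms read off from pairings. -/

theorem norm_conj_sign (z : ℂ) : ‖(starRingEnd ℂ) z / (‖z‖ : ℂ)‖ ≤ 1 := by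
  by_cases hz : z = 0
  · simp [hz]
  · simp [hz]

theorem conj_sign_mul (z : ℂ) : (starRingEnd ℂ) z / (‖z‖ : ℂ) * z = (‖z‖ : ℂ) := by
  by_cases hz : z = 0
  · simp [hz]
  · have : (‖z‖ : ℂ) ≠ 0 := by simpa using hz
    rw [div_mul_eq_mul_div, Complex.conj_mul', sq, mul_div_assoc, div_self this, mul_one]

/-- Bounding the pairing with Schwartz functions bounds the integral over bounded sets. -/
theorem setIntegral_norm_le_of_pairing {n : ℕ} {w : Rn n → ℂ} {B a c p : ℝ}
    (hw : LocallyIntegrable w volume) (hB : 0 ≤ B) (ha : 0 ≤ a) (hc : 0 ≤ c) (hp : 0 < p)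
    (h : ∀ φ : 𝓢(Rn n, ℂ), ‖∫ x, φ x * w x‖ ≤ B * ((∫ x, ‖φ x‖) ^ a * (∫ x, ‖φ x‖ ^ p) ^ c))
    {E : Set (Rn n)} {R : ℝ} (hE : NullMeasurableSet E volume) (hER : E ⊆ Metric.closedBall 0 R) :
    ∫ x in E, ‖w x‖ ≤ B * (volume.real E ^ a * volume.real E ^ c) := by
  -- The extremal test function: the conjugate sign of `w` on `E`, so that the pairing is `∫_E |w|`.
  -- Division by zero makes it vanish where `w` does.
  let ψ : Rn n → ℂ := E.indicator fun x => (starRingEnd ℂ) (w x) / (‖w x‖ : ℂ)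
  have hψm : AEStronglyMeasurable ψ volume := by
    refine AEStronglyMeasurable.indicator₀ ?_ hE
    have h1 := hw.aestronglyMeasurable
    exact ((Complex.continuous_conj.comp_aestronglyMeasurable h1).aemeasurable.div
      (Complex.continuous_ofReal.comp_aestronglyMeasurable h1.norm).aemeasurable).aestronglyMeasurable
  have hψ1 : ∀ x, ‖ψ x‖ ≤ E.indicator (fun _ => (1 : ℝ)) x := by
    intro x
    by_cases hx : x ∈ E
    · simp only [ψ, indicator_of_mem hx]; exact norm_conj_sign _
    · simp [ψ, hx]
  have hfin : volume E ≠ ∞ := ((measure_mono hER).trans_lt measure_closedBall_lt_top).ne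
  have hint : Integrable (E.indicator (fun _ => (1 : ℝ))) volume :=
    (integrableOn_const hfin).integrable_indicator₀ hE
  have key := pairing_le_of_schwartz hw ha hc hp h (ψ := ψ) (C := 1) (R := R) hψm
    (fun x => (hψ1 x).trans (indicator_le_self' (fun _ _ => zero_le_one) x |>.trans le_rfl))
    (fun x hx => indicator_of_notMem (fun hxE => absurd (hER hxE) (by simpa using hx)) _)
  have e1 : ∫ x, ψ x * w x = ((∫ x in E, ‖w x‖ : ℝ) : ℂ) := by
    rw [← integral_indicator₀ hE, ← integral_complex_ofReal]
    congr 1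
    ext x
    by_cases hx : x ∈ E
    · simp only [ψ, indicator_of_mem hx]; exact conj_sign_mul _
    · simp [ψ, hx]
  have e2 : ∀ s : ℝ, 0 < s → ∫ x, ‖ψ x‖ ^ s ≤ volume.real E := by
    intro s hs
    have : volume.real E = ∫ x, E.indicator (fun _ => (1 : ℝ)) x := by
      rw [integral_indicator₀ hE]; simp
    rw [this]
    refine integral_mono_of_nonneg (Eventually.of_forall fun x => by positivity) hint
      (Eventually.of_forall fun x => ?_)
    refine (Real.rpow_le_rpow (norm_nonneg _) (hψ1 x) hs.le).trans (le_of_eq ?_)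
    by_cases hx : x ∈ E
    · simp [hx]
    · simp [hx, Real.zero_rpow hs.ne']
  have e3 : ∫ x, ‖ψ x‖ ≤ volume.real E := by simpa using e2 1 one_pos
  rw [e1, Complex.norm_real, Real.norm_of_nonneg (integral_nonneg fun x => norm_nonneg _)] at key
  refine key.trans (mul_le_mul_of_nonneg_left ?_ hB)
  have hn : 0 ≤ ∫ x, ‖ψ x‖ := integral_nonneg fun x => norm_nonneg _
  have hn2 : 0 ≤ ∫ x, ‖ψ x‖ ^ p := integral_nonneg fun x => by positivity
  have hv : 0 ≤ volume.real E := measureReal_nonneg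
  exact mul_le_mul (Real.rpow_le_rpow hn e3 ha) (Real.rpow_le_rpow hn2 (e2 p hp) hc)
    (by positivity) (by positivity)

theorem measure_le_of_inter_closedBall {n : ℕ} {S : Set (Rn n)} {c : ℝ≥0∞}
    (h : ∀ N : ℕ, volume (S ∩ Metric.closedBall 0 N) ≤ c) : volume S ≤ c := by
  have hm : Monotone fun N : ℕ => S ∩ Metric.closedBall (0 : Rn n) N := fun i j hij =>
    inter_subset_inter_right _ (Metric.closedBall_subset_closedBall (by exact_mod_cast hij))
  have : S = ⋃ N : ℕ, S ∩ Metric.closedBall (0 : Rn n) N := by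
    rw [← inter_iUnion, Metric.iUnion_closedBall_nat, inter_univ]
  rw [this, hm.measure_iUnion]
  exact iSup_le h

theorem nullMeasurableSet_lt_norm {n : ℕ} {w : Rn n → ℂ} (hw : AEStronglyMeasurable w volume)
    (l : ℝ) : NullMeasurableSet {x | l < ‖w x‖} volume :=
  nullMeasurableSet_lt aemeasurable_const hw.norm.aemeasurable

theorem mul_measureReal_le_setIntegral {n : ℕ} {w : Rn n → ℂ} (hw : LocallyIntegrable w volume)
    (l R : ℝ) :
    l * volume.real ({x | l < ‖w x‖} ∩ Metric.closedBall 0 R) ≤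
      ∫ x in {x | l < ‖w x‖} ∩ Metric.closedBall 0 R, ‖w x‖ := by
  have hE : NullMeasurableSet ({x | l < ‖w x‖} ∩ Metric.closedBall 0 R) volume :=
    (nullMeasurableSet_lt_norm hw.aestronglyMeasurable l).inter
      measurableSet_closedBall.nullMeasurableSet
  have hfin : volume ({x | l < ‖w x‖} ∩ Metric.closedBall 0 R) ≠ ∞ :=
    ((measure_mono inter_subset_right).trans_lt measure_closedBall_lt_top).ne
  have h1 : ∫ x in {x | l < ‖w x‖} ∩ Metric.closedBall 0 R, l =
      l * volume.real ({x | l < ‖w x‖} ∩ Metric.closedBall 0 R) := by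
    simp [mul_comm]
  rw [← h1]
  refine setIntegral_mono_on₀ (integrableOn_const hfin)
    (IntegrableOn.mono_set (hw.integrableOn_isCompact (isCompact_closedBall 0 R)).norm
      inter_subset_right)
    hE fun x hx => le_of_lt hx.1

/-- On a superlevel set `E`, `l |E| ≤ ∫_E |w| ≤ B |E|^{a+c} = B |E|^{1-1/r}`, hence `|E|^{1/r} ≤
B/l`. Intersecting with balls makes `|E|` finite, which the division needs. -/
theorem measure_lt_norm_le_of_pairing {n : ℕ} {w : Rn n → ℂ} {B a c p r : ℝ}
    (hw : LocallyIntegrable w volume) (hB : 0 ≤ B) (ha : 0 ≤ a) (hc : 0 ≤ c) (hp : 0 < p)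
    (hr : 0 < r) (hac : a + c = 1 - 1 / r)
    (h : ∀ φ : 𝓢(Rn n, ℂ), ‖∫ x, φ x * w x‖ ≤ B * ((∫ x, ‖φ x‖) ^ a * (∫ x, ‖φ x‖ ^ p) ^ c))
    {l : ℝ} (hl : 0 < l) : volume {x | l < ‖w x‖} ≤ ENNReal.ofReal ((B / l) ^ r) := by
  refine measure_le_of_inter_closedBall fun N => ?_
  set E := {x | l < ‖w x‖} ∩ Metric.closedBall (0 : Rn n) N
  have hE : NullMeasurableSet E volume :=
    (nullMeasurableSet_lt_norm hw.aestronglyMeasurable l).inter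
      measurableSet_closedBall.nullMeasurableSet
  have hfin : volume E ≠ ∞ :=
    ((measure_mono inter_subset_right).trans_lt measure_closedBall_lt_top).ne
  have h1 := (mul_measureReal_le_setIntegral hw l N).trans
    (setIntegral_norm_le_of_pairing hw hB ha hc hp h hE inter_subset_right)
  change l * volume.real E ≤ _ at h1
  rw [← ENNReal.ofReal_toReal hfin]
  refine ENNReal.ofReal_le_ofReal ?_
  change volume.real E ≤ _
  rcases (measureReal_nonneg (μ := volume) (s := E)).eq_or_lt with h0 | h0
  · rw [← h0]; positivity
  rw [← Real.rpow_add h0, hac, Real.rpow_sub h0, Real.rpow_one] at h1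
  have h2 : volume.real E ^ (1 / r) ≤ B / l := by
    have h3 : 0 < volume.real E ^ (1 / r) := Real.rpow_pos_of_pos h0 _
    rw [le_div_iff₀ hl]
    rw [← mul_div_assoc, le_div_iff₀ h3] at h1
    nlinarith
  calc volume.real E = (volume.real E ^ (1 / r)) ^ r := by
        rw [← Real.rpow_mul h0.le, one_div_mul_cancel hr.ne', Real.rpow_one]
    _ ≤ (B / l) ^ r := Real.rpow_le_rpow (by positivity) h2 hr.le

/-- With the `L¹` norm alone, `(B + ε)|E| ≤ B |E|` on the set where `|w| > B + ε`, so this set is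
null. -/
theorem ae_norm_le_of_pairing {n : ℕ} {w : Rn n → ℂ} {B : ℝ}
    (hw : LocallyIntegrable w volume) (hB : 0 ≤ B)
    (h : ∀ φ : 𝓢(Rn n, ℂ), ‖∫ x, φ x * w x‖ ≤ B * ∫ x, ‖φ x‖) : ∀ᵐ x, ‖w x‖ ≤ B := by
  have key : ∀ k : ℕ, volume {x | B + 1 / ((k : ℝ) + 1) < ‖w x‖} = 0 := by
    intro k
    have hk : (0 : ℝ) < 1 / ((k : ℝ) + 1) := by positivity
    refine le_antisymm (measure_le_of_inter_closedBall fun N => ?_) zero_le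
    set l := B + 1 / ((k : ℝ) + 1)
    set E := {x | l < ‖w x‖} ∩ Metric.closedBall (0 : Rn n) N
    have hE : NullMeasurableSet E volume :=
      (nullMeasurableSet_lt_norm hw.aestronglyMeasurable l).inter
        measurableSet_closedBall.nullMeasurableSet
    have hfin : volume E ≠ ∞ :=
      ((measure_mono inter_subset_right).trans_lt measure_closedBall_lt_top).ne
    have h1 := (mul_measureReal_le_setIntegral hw l N).trans
      (setIntegral_norm_le_of_pairing hw hB zero_le_one le_rfl one_pos
        (fun φ => by simpa using h φ) hE inter_subset_right)
    change l * volume.real E ≤ _ at h1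
    rw [Real.rpow_one, Real.rpow_zero, mul_one] at h1
    have h2 : volume.real E = 0 := by
      have := measureReal_nonneg (μ := volume) (s := E)
      simp only [l] at h1
      nlinarith
    exact ((measureReal_eq_zero_iff hfin).1 h2).le
  have h2 := ae_all_iff.2 fun k => (measure_eq_zero_iff_ae_notMem.1 (key k))
  filter_upwards [h2] with x hx
  refine le_of_forall_pos_le_add fun ε hε => ?_
  obtain ⟨k, hk⟩ := exists_nat_one_div_lt hε
  have := hx k
  simp only [not_lt] at this
  linarith

theorem eLpNorm_ofReal_le_iff {n : ℕ} {w : Rn n → ℂ} {r B : ℝ} (hr : 0 < r) (hB : 0 ≤ B) :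
    eLpNorm w (ENNReal.ofReal r) volume ≤ ENNReal.ofReal B ↔
      ∫⁻ x, ENNReal.ofReal (‖w x‖ ^ r) ≤ ENNReal.ofReal (B ^ r) := by
  rw [eLpNorm_eq_lintegral_rpow_enorm_toReal (by simpa using hr) ENNReal.ofReal_ne_top,
    ENNReal.toReal_ofReal hr.le, ← ENNReal.ofReal_rpow_of_nonneg hB hr.le, one_div,
    ENNReal.rpow_inv_le_iff hr]
  simp_rw [← ofReal_norm, ENNReal.ofReal_rpow_of_nonneg (norm_nonneg _) hr.le]

/-- Testing with the conjugate sign of `w` times `|w|^{r-1}` gives `I ≤ B I^{1/p}` for `I = ∫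
|w|^r`. Restricting to `|w| ≤ N`, `|x| ≤ N` makes `I` finite, so that it can be divided out; the
truncations are removed by monotone convergence. -/
theorem eLpNorm_le_of_pairing {n : ℕ} {w : Rn n → ℂ} {B r p : ℝ}
    (hw : LocallyIntegrable w volume) (hB : 0 ≤ B) (hpr : r.HolderConjugate p)
    (h : ∀ φ : 𝓢(Rn n, ℂ), ‖∫ x, φ x * w x‖ ≤ B * (∫ x, ‖φ x‖ ^ p) ^ (1 / p)) :
    eLpNorm w (ENNReal.ofReal r) volume ≤ ENNReal.ofReal B := by
  have hr : 1 < r := hpr.lt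
  have hp : 1 < p := hpr.symm.lt
  rw [eLpNorm_ofReal_le_iff hpr.pos hB]
  let E : ℕ → Set (Rn n) := fun N => {x | ‖w x‖ ≤ N} ∩ Metric.closedBall 0 N
  have hE : ∀ N, NullMeasurableSet (E N) volume := fun N =>
    (nullMeasurableSet_le hw.aestronglyMeasurable.norm.aemeasurable aemeasurable_const).inter
      measurableSet_closedBall.nullMeasurableSet
  have hfin : ∀ N, volume (E N) ≠ ∞ := fun N =>
    ((measure_mono inter_subset_right).trans_lt measure_closedBall_lt_top).ne
  have hmono : Monotone E := fun i j hij => by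
    have hij' : (i : ℝ) ≤ j := by exact_mod_cast hij
    exact inter_subset_inter (fun x hx => le_trans hx hij')
      (Metric.closedBall_subset_closedBall hij')
  have huniv : ⋃ N, E N = univ := by
    refine eq_univ_of_forall fun x => mem_iUnion.2 ?_
    obtain ⟨N, hN⟩ := exists_nat_ge (max ‖w x‖ ‖x‖)
    exact ⟨N, (le_max_left _ _).trans hN, by simpa using (le_max_right _ _).trans hN⟩
  rw [← setLIntegral_univ, ← huniv, setLIntegral_iUnion_of_directed _ hmono.directed_le]
  refine iSup_le fun N => ?_
  let ψ : Rn n → ℂ := (E N).indicator fun x =>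
    (starRingEnd ℂ) (w x) / (‖w x‖ : ℂ) * ((‖w x‖ ^ (r - 1) : ℝ) : ℂ)
  have hwm := hw.aestronglyMeasurable
  have hψm : AEStronglyMeasurable ψ volume := by
    refine AEStronglyMeasurable.indicator₀ ?_ (hE N)
    have h1 : AEMeasurable (fun x => ((‖w x‖ ^ (r - 1) : ℝ) : ℂ)) volume :=
      Complex.measurable_ofReal.comp_aemeasurable (hwm.norm.aemeasurable.pow_const _)
    exact (((Complex.continuous_conj.comp_aestronglyMeasurable hwm).aemeasurable.div
      (Complex.continuous_ofReal.comp_aestronglyMeasurable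
        hwm.norm).aemeasurable).mul h1).aestronglyMeasurable
  have hψ1 : ∀ x ∈ E N, ‖ψ x‖ ≤ ‖w x‖ ^ (r - 1) := by
    intro x hx
    simp only [ψ, indicator_of_mem hx]
    rw [norm_mul, Complex.norm_real, Real.norm_of_nonneg (by positivity)]
    exact mul_le_of_le_one_left (by positivity) (norm_conj_sign _)
  have hψ2 : ∀ x, ‖ψ x‖ ≤ (N : ℝ) ^ (r - 1) := by
    intro x
    by_cases hx : x ∈ E N
    · exact (hψ1 x hx).trans (Real.rpow_le_rpow (norm_nonneg _) hx.1 (by linarith))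
    · simp only [ψ, indicator_of_notMem hx, norm_zero]; positivity
  have hint : IntegrableOn (fun x => ‖w x‖ ^ r) (E N) volume := by
    refine Measure.integrableOn_of_bounded (M := (N : ℝ) ^ r) (hfin N)
      (hwm.norm.aemeasurable.pow_const _).aestronglyMeasurable ?_
    rw [ae_restrict_iff'₀ (hE N)]
    refine Eventually.of_forall fun x hx => ?_
    rw [Real.norm_of_nonneg (by positivity)]
    exact Real.rpow_le_rpow (norm_nonneg _) hx.1 (by linarith)
  have key := pairing_le_of_schwartz (a := 0) (c := 1 / p) (p := p) hw le_rfl (by positivity)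
    (by linarith) (fun φ => by simpa using h φ) (ψ := ψ) (R := N) hψm hψ2
    (fun x hx => indicator_of_notMem (fun hxE => absurd hxE.2 (by simpa using hx)) _)
  set I := ∫ x in E N, ‖w x‖ ^ r
  have hI0 : 0 ≤ I := integral_nonneg fun x => by positivity
  have e1 : ∫ x, ψ x * w x = (I : ℂ) := by
    simp only [I]
    rw [← integral_indicator₀ (hE N), ← integral_complex_ofReal]
    congr 1
    ext x
    by_cases hx : x ∈ E N
    · simp only [ψ, indicator_of_mem hx]
      rw [mul_right_comm, conj_sign_mul, ← Complex.ofReal_mul]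
      congr 1
      rcases (norm_nonneg (w x)).eq_or_lt with h0 | h0
      · rw [← h0, zero_mul, Real.zero_rpow (by linarith)]
      · rw [Real.rpow_sub_one h0.ne']; field_simp
    · simp [ψ, hx]
  have e2 : ∫ x, ‖ψ x‖ ^ p ≤ I := by
    simp only [I]
    rw [← integral_indicator₀ (hE N)]
    refine integral_mono_of_nonneg (Eventually.of_forall fun x => by positivity)
      (hint.integrable_indicator₀ (hE N)) (Eventually.of_forall fun x => ?_)
    by_cases hx : x ∈ E N
    · rw [indicator_of_mem hx]
      refine (Real.rpow_le_rpow (norm_nonneg _) (hψ1 x hx) (by linarith)).trans (le_of_eq ?_)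
      rw [← Real.rpow_mul (norm_nonneg _), hpr.sub_one_mul_conj]
    · simp [ψ, hx, Real.zero_rpow (by linarith : p ≠ 0)]
  rw [← ofReal_integral_eq_lintegral_ofReal hint (Eventually.of_forall fun x => by positivity)]
  refine ENNReal.ofReal_le_ofReal ?_
  change I ≤ _
  rw [e1, Complex.norm_real, Real.norm_of_nonneg hI0, Real.rpow_zero, one_mul] at key
  have h3 : I ≤ B * I ^ (1 / p) := key.trans (mul_le_mul_of_nonneg_left
    (Real.rpow_le_rpow (integral_nonneg fun x => by positivity) e2 (by positivity)) hB)
  rcases hI0.eq_or_lt with h0 | h0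
  · rw [← h0]; positivity
  have h4 : I ^ (1 / r) ≤ B := by
    have h5 : 1 / r = 1 - 1 / p := by
      have := hpr.inv_add_inv_eq_one
      simp only [one_div]; linarith
    rw [h5, Real.rpow_sub h0, Real.rpow_one, div_le_iff₀ (Real.rpow_pos_of_pos h0 _)]
    exact h3
  calc I = (I ^ (1 / r)) ^ r := by
        rw [← Real.rpow_mul h0.le, one_div_mul_cancel hpr.ne_zero, Real.rpow_one]
    _ ≤ B ^ r := Real.rpow_le_rpow (by positivity) h4 hpr.pos.le

/-- A functional on Schwartz functions that is bounded for `L¹ + L²` is given by a function. -/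
theorem exists_function_of_bound {n : ℕ} (Λ : 𝓢(Rn n, ℂ) →ₗ[ℂ] ℂ) {B : ℝ} (hB : 0 ≤ B)
    (h : ∀ φ, ‖Λ φ‖ ≤ B * ((∫ x, ‖φ x‖) + (∫ x, ‖φ x‖ ^ (2 : ℝ)) ^ (1 / (2 : ℝ)))) :
    ∃ w : Rn n → ℂ, LocallyIntegrable w volume ∧ (∀ φ : 𝓢(Rn n, ℂ), Integrable fun x => φ x * w x) ∧
      ∀ φ : 𝓢(Rn n, ℂ), Λ φ = ∫ x, φ x * w x := by
  -- The weight `(1+|x|²)^{-(n+1)}` is bounded by one and square integrable. Precomposing `Λ` with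
  -- it therefore turns the `L¹ + L²` bound into an `L²` bound, to which the Riesz theorem applies;
  -- the inverse weight, of polynomial growth, restores `Λ`.
  let e : ℝ := (n : ℝ) + 1
  let om : Rn n → ℝ := fun x => (1 + ‖x‖ ^ 2) ^ e
  let om' : Rn n → ℝ := fun x => (1 + ‖x‖ ^ 2) ^ (-e)
  have hom : om.HasTemperateGrowth := Function.hasTemperateGrowth_one_add_norm_sq_rpow _ _
  have hom' : om'.HasTemperateGrowth := Function.hasTemperateGrowth_one_add_norm_sq_rpow _ _
  have hprod : ∀ x, om' x * om x = 1 := fun x => by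
    simp only [om, om']
    rw [← Real.rpow_add (by positivity)]; simp
  have hpos : ∀ x, 0 ≤ om' x := fun x => by positivity
  have hle : ∀ x, om' x ≤ 1 := fun x =>
    Real.rpow_le_one_of_one_le_of_nonpos (by nlinarith [norm_nonneg x])
      (by simp only [e]; linarith [(Nat.cast_nonneg n : (0 : ℝ) ≤ n)])
  have homc : Continuous om' := hom'.1.continuous
  have hint : Integrable (fun x => om' x ^ (2 : ℝ)) volume := by
    have := integrable_rpow_neg_one_add_norm_sq (E := Rn n) (μ := volume) (r := 4 * e)
      (by simp only [e, finrank_euclideanSpace_fin]; linarith [(Nat.cast_nonneg n : (0 : ℝ) ≤ n)])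
    refine this.congr (Eventually.of_forall fun x => ?_)
    simp only [om']
    rw [← Real.rpow_mul (by positivity)]
    congr 1; ring
  have hmem : MemLp om' (ENNReal.ofReal 2) volume := by
    have h2 : ENNReal.ofReal 2 = 2 := by norm_num
    rw [h2, memLp_two_iff_integrable_sq homc.aestronglyMeasurable]
    exact_mod_cast hint
  have hmemC : MemLp (fun x => (om' x : ℂ)) (ENNReal.ofReal 2) volume := hmem.ofReal
  let J : 𝓢(Rn n, ℂ) →L[ℝ] 𝓢(Rn n, ℂ) := SchwartzMap.smulLeftCLM ℂ om'
  let K : 𝓢(Rn n, ℂ) →L[ℝ] 𝓢(Rn n, ℂ) := SchwartzMap.smulLeftCLM ℂ om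
  have hJ : ∀ φ x, J φ x = (om' x : ℂ) * φ x := fun φ x => by
    simp only [J]; rw [SchwartzMap.smulLeftCLM_apply_apply hom']; simp
  have hK : ∀ φ x, K φ x = (om x : ℂ) * φ x := fun φ x => by
    simp only [K]; rw [SchwartzMap.smulLeftCLM_apply_apply hom]; simp
  have hJK : ∀ φ, J (K φ) = φ := fun φ => by
    ext x; rw [hJ, hK, ← mul_assoc, ← Complex.ofReal_mul, hprod]; simp
  let Λ' : 𝓢(Rn n, ℂ) →ₗ[ℂ] ℂ :=
    { toFun := fun φ => Λ (J φ)
      map_add' := fun φ χ => by simp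
      map_smul' := fun c φ => by
        have : J (c • φ) = c • J φ := by
          ext x; rw [hJ]; simp only [smul_apply, smul_eq_mul]; rw [hJ]; ring
        rw [this, map_smul]; rfl }
  have hnorm : ∀ φ : 𝓢(Rn n, ℂ), ‖SchwartzMap.toLpCLM ℂ ℂ 2 volume φ‖ =
      (∫ x, ‖φ x‖ ^ (2 : ℝ)) ^ (1 / (2 : ℝ)) := fun φ => by
    rw [SchwartzMap.toLpCLM_apply, SchwartzMap.norm_toLp' (by simp) (by simp)]
    simp
  let D := (∫ x, om' x ^ (2 : ℝ)) ^ (1 / (2 : ℝ))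
  have hΛ' : ∀ φ, ‖Λ' φ‖ ≤ (B * (D + 1)) * ‖SchwartzMap.toLpCLM ℂ ℂ 2 volume φ‖ := by
    intro φ
    rw [hnorm, mul_assoc]
    refine (h (J φ)).trans (mul_le_mul_of_nonneg_left ?_ hB)
    rw [add_mul, one_mul]
    refine add_le_add ?_ ?_
    · have hm : MemLp φ (ENNReal.ofReal 2) volume := φ.memLp _
      have := integral_mul_norm_le_Lp_mul_Lq (μ := volume) Real.HolderConjugate.two_two hmemC hm
      refine le_trans (le_of_eq ?_) (this.trans (le_of_eq ?_))
      · congr 1; ext x; rw [hJ]; simp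
      · simp only [D, Complex.norm_real, Real.norm_eq_abs, abs_of_nonneg (hpos _)]
    · refine Real.rpow_le_rpow (integral_nonneg fun x => by positivity) ?_ (by norm_num)
      have hm : Integrable (fun x => ‖φ x‖ ^ (2 : ℝ)) volume := by
        have := (φ.memLp 2 volume).integrable_norm_rpow (by simp) (by simp)
        simpa using this
      refine integral_mono_of_nonneg (Eventually.of_forall fun x => by positivity) hm
        (Eventually.of_forall fun x => ?_)
      refine Real.rpow_le_rpow (norm_nonneg _) ?_ (by norm_num)
      rw [hJ, norm_mul, Complex.norm_real, Real.norm_of_nonneg (hpos x)]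
      exact mul_le_of_le_one_left (norm_nonneg _) (hle x)
  have hdense : DenseRange (SchwartzMap.toLpCLM ℂ ℂ 2 (volume : Measure (Rn n))) :=
    SchwartzMap.denseRange_toLpCLM (by simp)
  let L := Λ'.extendOfNorm (SchwartzMap.toLpCLM ℂ ℂ 2 (volume : Measure (Rn n))).toLinearMap
  have hL : ∀ φ, L (SchwartzMap.toLpCLM ℂ ℂ 2 (volume : Measure (Rn n)) φ) = Λ' φ :=
    fun φ => LinearMap.extendOfNorm_eq hdense ⟨_, hΛ'⟩ φ
  let g := (InnerProductSpace.toDual ℂ (Lp ℂ 2 (volume : Measure (Rn n)))).symm L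
  have hg : ∀ φ : 𝓢(Rn n, ℂ), Λ φ = ∫ x, φ x * ((om x : ℂ) * (starRingEnd ℂ) (g x)) := by
    intro φ
    have h1 : Λ φ = Λ' (K φ) := by
      change _ = Λ (J (K φ)); rw [hJK]
    rw [h1, ← hL, ← InnerProductSpace.toDual_symm_apply, L2.inner_def]
    refine integral_congr_ae ?_
    rw [SchwartzMap.toLpCLM_apply]
    filter_upwards [(K φ).coeFn_toLp 2 volume] with x hx
    rw [hx, hK]
    simp only [RCLike.inner_apply]
    change _ * (starRingEnd ℂ) (g x) = _
    ring
  have hgm : AEStronglyMeasurable (fun x => (starRingEnd ℂ) (g x)) volume :=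
    Complex.continuous_conj.comp_aestronglyMeasurable (Lp.aestronglyMeasurable g)
  have homc2 : Continuous om := hom.1.continuous
  have hgL : MemLp (fun x => (starRingEnd ℂ) (g x)) 2 volume :=
    (Lp.memLp g).star
  refine ⟨fun x => (om x : ℂ) * (starRingEnd ℂ) (g x), ?_, ?_, hg⟩
  · exact (hgL.locallyIntegrable (by norm_num)).continuous_mul
      (Complex.continuous_ofReal.comp homc2)
  · intro φ
    have := ((K φ).memLp 2 volume).integrable_mul hgL
    refine this.congr (Eventually.of_forall fun x => ?_)
    simp only [Pi.mul_apply, hK]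
    ring

/-! ### The Schrödinger propagator on Schwartz functions -/

/-- The transpose of `schrodingerGroup n t`, acting on Schwartz functions. -/
noncomputable def propagator (n : ℕ) (t : ℝ) : 𝓢(Rn n, ℂ) →L[ℂ] 𝓢(Rn n, ℂ) :=
  fourierCLM ℂ 𝓢(Rn n, ℂ) ∘L (SchwartzMap.smulLeftCLM ℂ (schrodingerSymbol n t)) ∘L
    fourierInvCLM ℂ 𝓢(Rn n, ℂ)

theorem schrodingerGroup_apply {n : ℕ} (t : ℝ) (T : 𝓢'(Rn n, ℂ)) (ψ : 𝓢(Rn n, ℂ)) :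
    schrodingerGroup n t T ψ = T (propagator n t ψ) := rfl

theorem propagator_eq {n : ℕ} (t : ℝ) (ψ : 𝓢(Rn n, ℂ)) :
    propagator n t ψ = 𝓕 (SchwartzMap.smulLeftCLM ℂ (schrodingerSymbol n t) (𝓕⁻ ψ)) := rfl

theorem norm_schrodingerSymbol {n : ℕ} (t : ℝ) (ξ : Rn n) : ‖schrodingerSymbol n t ξ‖ = 1 := by
  rw [schrodingerSymbol, mul_comm, Complex.norm_exp_ofReal_mul_I]

theorem propagator_apply {n : ℕ} (t : ℝ) (ψ : 𝓢(Rn n, ℂ)) (x : Rn n) :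
    propagator n t ψ x =
      ∫ ξ, Complex.exp ((↑(-2 * Real.pi * ⟪ξ, x⟫) * Complex.I)) *
        (schrodingerSymbol n t ξ * (𝓕⁻ ψ) ξ) := by
  rw [propagator_eq, SchwartzMap.fourier_coe, Real.fourier_eq']
  congr 1
  ext ξ
  rw [SchwartzMap.smulLeftCLM_apply_apply (schrodingerSymbol_hasTemperateGrowth n t)]
  rfl

theorem integral_norm_sq_propagator {n : ℕ} (t : ℝ) (ψ : 𝓢(Rn n, ℂ)) :
    ∫ x, ‖propagator n t ψ x‖ ^ 2 = ∫ x, ‖ψ x‖ ^ 2 := by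
  rw [propagator_eq, SchwartzMap.integral_norm_sq_fourier]
  have h1 : ∀ x, ‖SchwartzMap.smulLeftCLM ℂ (schrodingerSymbol n t) (𝓕⁻ ψ) x‖ ^ 2 =
      ‖(𝓕⁻ ψ) x‖ ^ 2 := fun x => by
    rw [SchwartzMap.smulLeftCLM_apply_apply (schrodingerSymbol_hasTemperateGrowth n t), norm_smul,
      norm_schrodingerSymbol, one_mul]
  simp_rw [h1]
  rw [← SchwartzMap.integral_norm_sq_fourier, fourier_fourierInv_eq]

theorem integral_fourier_mul_eq_flip {n : ℕ} {f g : Rn n → ℂ} (hf : Integrable f)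
    (hg : Integrable g) : ∫ x, 𝓕 f x * g x = ∫ x, f x * 𝓕 g x := by
  have := VectorFourier.integral_fourierIntegral_smul_eq_flip (L := innerₗ (Rn n))
    (μ := volume) (ν := volume) Real.continuous_fourierChar continuous_inner hf hg
  rw [flip_innerₗ] at this
  exact this

/-- The bound involves `Im b` only, so it survives the limit `Re b → 0` in which the Gaussian
becomes the Schrödinger symbol. -/
theorem norm_fourier_gaussian_le {n : ℕ} {b : ℂ} (hb : 0 < b.re) (hbi : 0 < b.im) (x w : Rn n) :
    ‖𝓕 (fun v : Rn n => Complex.exp (-b * ‖v‖ ^ 2 + 2 * Real.pi * Complex.I * ⟪x, v⟫)) w‖ ≤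
      (Real.pi / b.im) ^ ((n : ℝ) / 2) := by
  have hb0 : b ≠ 0 := fun h => by simp [h] at hb
  rw [fourier_gaussian_innerProductSpace' hb, norm_mul]
  have h1 : ‖((Real.pi : ℂ) / b) ^ ((Module.finrank ℝ (Rn n) : ℂ) / 2)‖ ≤
      (Real.pi / b.im) ^ ((n : ℝ) / 2) := by
    have e : ((Module.finrank ℝ (Rn n) : ℂ) / 2) = (((n : ℝ) / 2 : ℝ) : ℂ) := by
      simp
    rw [e, Complex.norm_cpow_real]
    refine Real.rpow_le_rpow (norm_nonneg _) ?_ (by positivity)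
    rw [norm_div, Complex.norm_real, Real.norm_of_nonneg Real.pi_pos.le]
    refine div_le_div_of_nonneg_left Real.pi_pos.le hbi ?_
    exact (le_abs_self _).trans (Complex.abs_im_le_norm b)
  have h2 : ‖Complex.exp (-(Real.pi : ℂ) ^ 2 * (‖x - w‖ : ℂ) ^ 2 / b)‖ ≤ 1 := by
    rw [Complex.norm_exp, Real.exp_le_one_iff]
    have e : -(Real.pi : ℂ) ^ 2 * (‖x - w‖ : ℂ) ^ 2 / b =
        ((-(Real.pi ^ 2 * ‖x - w‖ ^ 2) : ℝ) : ℂ) * b⁻¹ := by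
      push_cast; ring
    rw [e, Complex.re_ofReal_mul, Complex.inv_re]
    have : 0 ≤ b.re / Complex.normSq b := div_nonneg hb.le (Complex.normSq_nonneg _)
    have h3 : 0 ≤ Real.pi ^ 2 * ‖x - w‖ ^ 2 := by positivity
    nlinarith
  calc _ ≤ (Real.pi / b.im) ^ ((n : ℝ) / 2) * 1 :=
        mul_le_mul h1 h2 (norm_nonneg _) (by positivity)
    _ = _ := mul_one _

/-- The dispersive estimate. Damping the symbol by `e^{-ε|ξ|²}` gives a complex Gaussian; the
multiplication formula moves the Fourier transform from `ψ` onto it, where the bound is uniform in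
`ε`, and `ε → 0` by dominated convergence. -/
theorem norm_propagator_le {n : ℕ} {t : ℝ} (ht : 0 < t) (ψ : 𝓢(Rn n, ℂ)) (x : Rn n) :
    ‖propagator n t ψ x‖ ≤ (4 * Real.pi * t) ^ (-((n : ℝ) / 2)) * ∫ y, ‖ψ y‖ := by
  let F : ℕ → Rn n → ℂ := fun k ξ =>
    Complex.exp (-((1 / ((k : ℝ) + 1) : ℝ) : ℂ) * ‖ξ‖ ^ 2) *
      (Complex.exp ((↑(-2 * Real.pi * ⟪ξ, x⟫) * Complex.I)) *
        (schrodingerSymbol n t ξ * (𝓕⁻ ψ) ξ))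
  have hcont : Continuous fun ξ : Rn n => Complex.exp ((↑(-2 * Real.pi * ⟪ξ, x⟫) * Complex.I)) *
        (schrodingerSymbol n t ξ * (𝓕⁻ ψ) ξ) := by
    have h1 := (schrodingerSymbol_hasTemperateGrowth n t).1.continuous
    have h2 := (𝓕⁻ ψ).continuous
    fun_prop
  have hlim : Tendsto (fun k => ∫ ξ, F k ξ) atTop (𝓝 (propagator n t ψ x)) := by
    rw [propagator_apply]
    refine tendsto_integral_of_dominated_convergence (fun ξ => ‖(𝓕⁻ ψ) ξ‖) ?_ ?_ ?_ ?_
    · intro k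
      refine Continuous.aestronglyMeasurable ?_
      refine Continuous.mul ?_ hcont
      fun_prop
    · exact (𝓕⁻ ψ).integrable.norm
    · intro k
      refine Eventually.of_forall fun ξ => ?_
      simp only [F]
      rw [norm_mul, norm_mul, norm_mul, norm_schrodingerSymbol, Complex.norm_exp_ofReal_mul_I,
        one_mul, one_mul]
      refine mul_le_of_le_one_left (norm_nonneg _) ?_
      have e : (-((1 / ((k : ℝ) + 1) : ℝ) : ℂ) * ‖ξ‖ ^ 2) =
          ((-(1 / ((k : ℝ) + 1) * ‖ξ‖ ^ 2) : ℝ) : ℂ) := by push_cast; ring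
      rw [e, Complex.norm_exp_ofReal, Real.exp_le_one_iff, neg_nonpos]
      positivity
    · refine Eventually.of_forall fun ξ => ?_
      have h0 : Tendsto (fun k : ℕ => Complex.exp (-((1 / ((k : ℝ) + 1) : ℝ) : ℂ) * ‖ξ‖ ^ 2)) atTop
          (𝓝 1) := by
        have h1 : Tendsto (fun k : ℕ => -((1 / ((k : ℝ) + 1) : ℝ) : ℂ) * (‖ξ‖ : ℂ) ^ 2) atTop
            (𝓝 (-((0 : ℝ) : ℂ) * (‖ξ‖ : ℂ) ^ 2)) :=
          ((Complex.continuous_ofReal.tendsto _).comp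
            tendsto_one_div_add_atTop_nhds_zero_nat).neg.mul_const _
        have h2 := (Complex.continuous_exp.tendsto _).comp h1
        simpa [Function.comp_def] using h2
      have h3 := h0.mul_const (Complex.exp ((↑(-2 * Real.pi * ⟪ξ, x⟫) * Complex.I)) *
        (schrodingerSymbol n t ξ * (𝓕⁻ ψ) ξ))
      rw [one_mul] at h3
      exact h3
  refine le_of_tendsto hlim.norm (Eventually.of_forall fun k => ?_)
  -- The real part is the damping and the imaginary part comes from the symbol: `π / Im b =
  -- 1/(4πt)`.
  let b : ℂ := ((1 / ((k : ℝ) + 1) : ℝ) : ℂ) + ((t * (2 * Real.pi) ^ 2 : ℝ) : ℂ) * Complex.I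
  have hbre : b.re = 1 / ((k : ℝ) + 1) := by
    simp only [b, Complex.add_re, Complex.ofReal_re, Complex.re_ofReal_mul, Complex.I_re]; ring
  have hbim : b.im = t * (2 * Real.pi) ^ 2 := by
    simp only [b, Complex.add_im, Complex.ofReal_im, Complex.im_ofReal_mul, Complex.I_im]; ring
  have hbpos : 0 < b.re := by rw [hbre]; positivity
  let G : Rn n → ℂ := fun v =>
    Complex.exp (-b * ‖v‖ ^ 2 + 2 * Real.pi * Complex.I * ⟪-x, v⟫)
  have hGi : Integrable G := by
    have := GaussianFourier.integrable_cexp_neg_mul_sq_norm_add (V := Rn n) hbpos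
      (2 * Real.pi * Complex.I) (-x)
    exact this
  have hψn : ⇑(𝓕⁻ ψ : 𝓢(Rn n, ℂ)) = 𝓕 (fun y => ψ (-y)) := by
    rw [SchwartzMap.fourierInv_coe, Real.fourierInv_eq_fourier_comp_neg]
  have hψi : Integrable (fun y => ψ (-y)) := ψ.integrable.comp_neg
  have e1 : ∫ ξ, F k ξ = ∫ ξ, 𝓕 G ξ * ψ (-ξ) := by
    rw [integral_fourier_mul_eq_flip hGi hψi]
    congr 1
    ext ξ
    rw [← hψn]
    simp only [F, G, schrodingerSymbol]
    rw [← mul_assoc, ← mul_assoc, ← Complex.exp_add, ← Complex.exp_add]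
    congr 2
    simp only [b, inner_neg_left, real_inner_comm x ξ]
    push_cast
    ring
  rw [e1]
  calc ‖∫ ξ, 𝓕 G ξ * ψ (-ξ)‖ ≤ ∫ ξ, (Real.pi / b.im) ^ ((n : ℝ) / 2) * ‖ψ (-ξ)‖ := by
        refine norm_integral_le_of_norm_le (hψi.norm.const_mul _) (Eventually.of_forall fun ξ => ?_)
        rw [norm_mul]
        exact mul_le_mul_of_nonneg_right
          (norm_fourier_gaussian_le hbpos (by rw [hbim]; positivity) _ _) (norm_nonneg _)
    _ = (4 * Real.pi * t) ^ (-((n : ℝ) / 2)) * ∫ y, ‖ψ y‖ := by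
        rw [integral_const_mul, integral_neg_eq_self (fun y => ‖ψ y‖) volume, hbim,
          Real.rpow_neg (by positivity), ← Real.inv_rpow (by positivity)]
        congr 2
        field_simp
        norm_num

/-- This is what makes the Duhamel integrand jointly measurable in time and space. -/
theorem continuous_propagator {n : ℕ} (ψ : 𝓢(Rn n, ℂ)) :
    Continuous fun z : ℝ × Rn n => propagator n z.1 ψ z.2 := by
  simp_rw [propagator_apply]
  refine continuous_of_dominated (bound := fun ξ => ‖(𝓕⁻ ψ) ξ‖) ?_ ?_ (𝓕⁻ ψ).integrable.norm ?_
  · intro z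
    have h1 := (schrodingerSymbol_hasTemperateGrowth n z.1).1.continuous
    have h2 := (𝓕⁻ ψ).continuous
    exact Continuous.aestronglyMeasurable (by fun_prop)
  · intro z
    refine Eventually.of_forall fun ξ => ?_
    rw [norm_mul, norm_mul, norm_schrodingerSymbol, Complex.norm_exp_ofReal_mul_I, one_mul, one_mul]
  · refine Eventually.of_forall fun ξ => ?_
    unfold schrodingerSymbol
    fun_prop

/-- The dilation `ψ(c ·)` of a Schwartz function. -/
noncomputable def dilate {n : ℕ} (c : ℝ) (hc : c ≠ 0) : 𝓢(Rn n, ℂ) →L[ℂ] 𝓢(Rn n, ℂ) :=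
  SchwartzMap.compCLMOfContinuousLinearEquiv ℂ
    (ContinuousLinearEquiv.smulLeft (R₁ := ℝ) (M₁ := Rn n) (Units.mk0 c hc))

theorem dilate_apply {n : ℕ} {c : ℝ} (hc : c ≠ 0) (ψ : 𝓢(Rn n, ℂ)) (x : Rn n) :
    dilate c hc ψ x = ψ (c • x) := rfl

theorem fourierInv_dilate {n : ℕ} {c : ℝ} (hc : 0 < c) (ψ : 𝓢(Rn n, ℂ)) (ξ : Rn n) :
    (𝓕⁻ (dilate c hc.ne' ψ)) (c • ξ) = (((c ^ n)⁻¹ : ℝ) : ℂ) * (𝓕⁻ ψ) ξ := by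
  rw [SchwartzMap.fourierInv_coe, SchwartzMap.fourierInv_coe, Real.fourierInv_eq', Real.fourierInv_eq']
  have := Measure.integral_comp_smul_of_nonneg (volume : Measure (Rn n))
    (fun v => Complex.exp ((↑(2 * Real.pi * ⟪v, ξ⟫) * Complex.I)) • ψ v) c (hR := hc.le)
  rw [finrank_euclideanSpace_fin, Complex.real_smul] at this
  rw [← this]
  congr 1
  ext v
  rw [dilate_apply, inner_smul_left, inner_smul_right]
  simp

/-- The symbol depends on `t|ξ|²` only: dilating space by `c` multiplies time by `c²`. -/
theorem propagator_dilate {n : ℕ} {c : ℝ} (hc : 0 < c) (s : ℝ) (ψ : 𝓢(Rn n, ℂ)) (x : Rn n) :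
    propagator n s (dilate c hc.ne' ψ) x = propagator n (c ^ 2 * s) ψ (c • x) := by
  rw [propagator_apply, propagator_apply]
  have := Measure.integral_comp_smul_of_nonneg (volume : Measure (Rn n))
    (fun ξ => Complex.exp ((↑(-2 * Real.pi * ⟪ξ, x⟫) * Complex.I)) *
        (schrodingerSymbol n s ξ * (𝓕⁻ (dilate c hc.ne' ψ)) ξ)) c (hR := hc.le)
  rw [finrank_euclideanSpace_fin, Complex.real_smul] at this
  have hcn : ((c ^ n : ℝ) : ℂ) ≠ 0 := by
    rw [Complex.ofReal_ne_zero]; positivity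
  have e : ∀ I J : ℂ, J = (((c ^ n)⁻¹ : ℝ) : ℂ) * I → I = ((c ^ n : ℝ) : ℂ) * J := by
    intro I J h
    rw [h, ← mul_assoc, ← Complex.ofReal_mul, mul_inv_cancel₀ (by positivity)]; simp
  rw [e _ _ this, ← integral_const_mul]
  congr 1
  ext ξ
  rw [fourierInv_dilate hc]
  have h1 : schrodingerSymbol n s (c • ξ) = schrodingerSymbol n (c ^ 2 * s) ξ := by
    unfold schrodingerSymbol
    rw [norm_smul, Real.norm_of_nonneg hc.le]
    congr 4; ring
  rw [h1, inner_smul_left, inner_smul_right]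
  simp only [Complex.ofReal_inv]
  field_simp
  simp
  ring_nf

/-! ### Harmonic polynomials times Gaussians -/

/-- The polynomial function on `ℝⁿ` defined by a polynomial with complex coefficients. -/
noncomputable def polyFun {n : ℕ} (P : MvPolynomial (Fin n) ℂ) (x : Rn n) : ℂ :=
  MvPolynomial.eval (fun i => (x i : ℂ)) P

theorem continuous_polyFun {n : ℕ} (P : MvPolynomial (Fin n) ℂ) : Continuous (polyFun P) := by
  have h : Continuous fun x : Rn n => fun i => (x i : ℂ) := by fun_prop
  exact (MvPolynomial.continuous_eval P).comp h

theorem hasDerivAt_polyFun {n : ℕ} (P : MvPolynomial (Fin n) ℂ) (x : Rn n) (j : Fin n) :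
    HasDerivAt (fun t : ℝ => polyFun P (x + t • EuclideanSpace.single j (1 : ℝ)))
      (polyFun (MvPolynomial.pderiv j P) x) 0 := by
  induction P using MvPolynomial.induction_on with
  | C a => simpa [polyFun] using hasDerivAt_const (0 : ℝ) a
  | add p q hp hq =>
    have := hp.add hq
    simp only [polyFun, map_add] at this ⊢
    exact this
  | mul_X p i hp =>
    have hX : HasDerivAt
        (fun t : ℝ => (((x + t • EuclideanSpace.single j (1 : ℝ) : Rn n) i : ℝ) : ℂ))
        (((if i = j then 1 else 0 : ℝ)) : ℂ) 0 := by
      refine HasDerivAt.ofReal_comp ?_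
      have h1 : (fun t : ℝ => (x + t • EuclideanSpace.single j (1 : ℝ) : Rn n) i) =
          fun t : ℝ => x i + t * (if i = j then 1 else 0) := by
        ext t; simp
      rw [h1]
      simpa using ((hasDerivAt_id (0 : ℝ)).mul_const (if i = j then (1 : ℝ) else 0)).const_add (x i)
    have := hp.mul hX
    simp only [polyFun, map_mul, MvPolynomial.eval_X, zero_smul, add_zero, Derivation.leibniz,
      MvPolynomial.pderiv_X, smul_eq_mul, map_add] at this ⊢
    convert! this using 1
    by_cases hij : i = j
    · subst hij; simp; ring
    · simp [hij]; ring

theorem exists_norm_polyFun_le {n : ℕ} (P : MvPolynomial (Fin n) ℂ) :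
    ∃ (C : ℝ) (N : ℕ), 0 ≤ C ∧ ∀ x, ‖polyFun P x‖ ≤ C * (1 + ‖x‖ ^ 2) ^ N := by
  induction P using MvPolynomial.induction_on with
  | C a => exact ⟨‖a‖, 0, norm_nonneg _, fun x => by simp [polyFun]⟩
  | add p q hp hq =>
    obtain ⟨C, N, hC, h⟩ := hp
    obtain ⟨C', N', hC', h'⟩ := hq
    refine ⟨C + C', max N N', by positivity, fun x => ?_⟩
    have h1 : 1 ≤ 1 + ‖x‖ ^ 2 := by nlinarith [norm_nonneg x]
    have e : polyFun (p + q) x = polyFun p x + polyFun q x := by simp [polyFun]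
    rw [e, add_mul]
    refine (norm_add_le _ _).trans (add_le_add ((h x).trans ?_) ((h' x).trans ?_))
    · exact mul_le_mul_of_nonneg_left (pow_le_pow_right₀ h1 (le_max_left _ _)) hC
    · exact mul_le_mul_of_nonneg_left (pow_le_pow_right₀ h1 (le_max_right _ _)) hC'
  | mul_X p i hp =>
    obtain ⟨C, N, hC, h⟩ := hp
    refine ⟨C, N + 1, hC, fun x => ?_⟩
    have e : polyFun (p * MvPolynomial.X i) x = polyFun p x * (x i : ℂ) := by simp [polyFun]
    rw [e, norm_mul, pow_succ, ← mul_assoc]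
    refine mul_le_mul (h x) ?_ (norm_nonneg _) (by positivity)
    rw [Complex.norm_real]
    have := PiLp.norm_apply_le x i
    nlinarith [norm_nonneg x]

/-- This is `y^N / N! ≤ e^y` at `y = a(1+s)`. -/
theorem one_add_pow_mul_exp_le (N : ℕ) {a s : ℝ} (ha : 0 < a) (hs : 0 ≤ s) :
    (1 + s) ^ N * Real.exp (-a * s) ≤ N.factorial * Real.exp a / a ^ N := by
  have h1 := Real.pow_div_factorial_le_exp (a * (1 + s)) (by positivity) N
  have hf : (0 : ℝ) < N.factorial := by exact_mod_cast N.factorial_pos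
  rw [div_le_iff₀ hf, mul_pow] at h1
  rw [le_div_iff₀ (by positivity)]
  have h2 : Real.exp (a * (1 + s)) * Real.exp (-a * s) = Real.exp a := by
    rw [← Real.exp_add]; congr 1; ring
  calc (1 + s) ^ N * Real.exp (-a * s) * a ^ N = (a ^ N * (1 + s) ^ N) * Real.exp (-a * s) := by ring
    _ ≤ (Real.exp (a * (1 + s)) * N.factorial) * Real.exp (-a * s) := by gcongr
    _ = N.factorial * (Real.exp (a * (1 + s)) * Real.exp (-a * s)) := by ring
    _ = _ := by rw [h2]

theorem norm_gaussian {n : ℕ} (b : ℂ) (x : Rn n) :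
    ‖Complex.exp (-b * ‖x‖ ^ 2)‖ = Real.exp (-b.re * ‖x‖ ^ 2) := by
  rw [Complex.norm_exp]
  congr 1
  rw [← Complex.ofReal_pow, Complex.re_mul_ofReal, Complex.neg_re]

theorem integrable_one_add_pow_mul_gaussian {n : ℕ} (N : ℕ) {a : ℝ} (ha : 0 < a) :
    Integrable (fun x : Rn n => (1 + ‖x‖ ^ 2) ^ N * Real.exp (-a * ‖x‖ ^ 2)) := by
  have h1 := (integrable_rpow_neg_one_add_norm_sq (E := Rn n) (μ := volume) (r := 2 * ((n : ℝ) + 1))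
    (by simp only [finrank_euclideanSpace_fin]; linarith [(Nat.cast_nonneg n : (0 : ℝ) ≤ n)])).const_mul
    ((N + (n + 1)).factorial * Real.exp a / a ^ (N + (n + 1)))
  refine h1.mono' (Continuous.aestronglyMeasurable (by fun_prop)) (Eventually.of_forall fun x => ?_)
  rw [Real.norm_of_nonneg (by positivity)]
  have e : (1 + ‖x‖ ^ 2) ^ (-(2 * ((n : ℝ) + 1)) / 2) = ((1 + ‖x‖ ^ 2) ^ (n + 1))⁻¹ := by
    rw [← Real.rpow_natCast (1 + ‖x‖ ^ 2) (n + 1), ← Real.rpow_neg (by positivity)]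
    congr 1; push_cast; ring
  have h2 := one_add_pow_mul_exp_le (N + (n + 1)) ha (sq_nonneg ‖x‖)
  rw [e, ← div_eq_mul_inv, le_div_iff₀ (by positivity)]
  refine le_trans (le_of_eq ?_) h2
  rw [pow_add]; ring

theorem integrable_polyFun_mul_gaussian {n : ℕ} (P : MvPolynomial (Fin n) ℂ) {b : ℂ}
    (hb : 0 < b.re) : Integrable (fun x : Rn n => polyFun P x * Complex.exp (-b * ‖x‖ ^ 2)) := by
  obtain ⟨C, N, hC, h⟩ := exists_norm_polyFun_le P
  refine ((integrable_one_add_pow_mul_gaussian N hb).const_mul C).mono'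
    (Continuous.aestronglyMeasurable (Continuous.mul (continuous_polyFun P) (by fun_prop)))
    (Eventually.of_forall fun x => ?_)
  rw [norm_mul, norm_gaussian, ← mul_assoc]
  exact mul_le_mul_of_nonneg_right (h x) (Real.exp_nonneg _)

theorem integrable_norm_mul_polyFun_mul_gaussian {n : ℕ} (P : MvPolynomial (Fin n) ℂ) {b : ℂ}
    (hb : 0 < b.re) :
    Integrable (fun x : Rn n => ‖x‖ * ‖polyFun P x * Complex.exp (-b * ‖x‖ ^ 2)‖) := by
  obtain ⟨C, N, hC, h⟩ := exists_norm_polyFun_le P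
  refine ((integrable_one_add_pow_mul_gaussian (N + 1) hb).const_mul C).mono'
    (Continuous.aestronglyMeasurable
      (continuous_norm.mul (Continuous.mul (continuous_polyFun P) (by fun_prop)).norm))
    (Eventually.of_forall fun x => ?_)
  rw [norm_mul, norm_norm, norm_norm, norm_mul, norm_gaussian]
  have h1 : ‖x‖ ≤ 1 + ‖x‖ ^ 2 := by nlinarith [norm_nonneg x]
  calc ‖x‖ * (‖polyFun P x‖ * Real.exp (-b.re * ‖x‖ ^ 2))
      ≤ (1 + ‖x‖ ^ 2) * ((C * (1 + ‖x‖ ^ 2) ^ N) * Real.exp (-b.re * ‖x‖ ^ 2)) := by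
        gcongr; exact h x
    _ = _ := by rw [pow_succ]; ring

theorem hasDerivAt_fourier_line {n : ℕ} {f : Rn n → ℂ} (hf : Integrable f)
    (hf' : Integrable fun v => ‖v‖ * ‖f v‖) (w : Rn n) (j : Fin n) :
    HasDerivAt (fun t : ℝ => 𝓕 f (w + t • EuclideanSpace.single j (1 : ℝ)))
      (-(2 * Real.pi * Complex.I) * 𝓕 (fun v => (v j : ℂ) * f v) w) 0 := by
  have h1 := Real.hasFDerivAt_fourier hf hf' w
  have h2 : HasDerivAt (fun t : ℝ => w + t • EuclideanSpace.single j (1 : ℝ))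
      (EuclideanSpace.single j (1 : ℝ)) 0 := by
    simpa using ((hasDerivAt_id (0 : ℝ)).smul_const (EuclideanSpace.single j (1 : ℝ))).const_add w
  have h3 := HasFDerivAt.comp_hasDerivAt_of_eq (0 : ℝ) h1 h2 (by simp)
  convert! h3 using 1
  rw [Real.fourier_continuousLinearMap_apply]
  · rw [Real.fourier_eq, Real.fourier_eq, ← integral_const_mul]
    congr 1
    ext v
    have hv : innerSL ℝ v (EuclideanSpace.single j (1 : ℝ)) = v j := by
      rw [innerSL_apply_apply, EuclideanSpace.inner_single_right]; simp
    rw [VectorFourier.fourierSMulRight_apply, hv]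
    simp [Circle.smul_def]
    ring
  · have hm : AEStronglyMeasurable (VectorFourier.fourierSMulRight (innerSL ℝ) f)
        (volume : Measure (Rn n)) := hf.1.fourierSMulRight
    refine (hf'.const_mul (2 * Real.pi * ‖(innerSL ℝ : Rn n →L[ℝ] _)‖)).mono' hm
      (Eventually.of_forall fun v => ?_)
    refine (VectorFourier.norm_fourierSMulRight_le _ _ _).trans (le_of_eq (by ring))

theorem hasDerivAt_norm_sq_line {n : ℕ} (w : Rn n) (j : Fin n) :
    HasDerivAt (fun t : ℝ => ((‖w + t • EuclideanSpace.single j (1 : ℝ)‖ : ℂ)) ^ 2)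
      ((2 * w j : ℝ) : ℂ) 0 := by
  have h : (fun t : ℝ => ((‖w + t • EuclideanSpace.single j (1 : ℝ)‖ : ℂ)) ^ 2) =
      fun t : ℝ => ((‖w‖ ^ 2 + 2 * (t * w j) + t * t : ℝ) : ℂ) := by
    ext t
    rw [← Complex.ofReal_pow, norm_add_sq_real, inner_smul_right,
      EuclideanSpace.inner_single_right, norm_smul]
    simp [sq]
  rw [h]
  refine HasDerivAt.ofReal_comp ?_
  have h1 : HasDerivAt (fun t : ℝ => ‖w‖ ^ 2 + 2 * (t * w j) + t * t)
      (2 * (1 * w j) + (1 * 0 + 0 * 1)) 0 :=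
    ((((hasDerivAt_id (0 : ℝ)).mul_const (w j)).const_mul 2).const_add (‖w‖ ^ 2)).add
      ((hasDerivAt_id (0 : ℝ)).mul (hasDerivAt_id 0))
  simpa using h1

theorem pderiv_comm {n : ℕ} (i j : Fin n) (P : MvPolynomial (Fin n) ℂ) :
    MvPolynomial.pderiv i (MvPolynomial.pderiv j P) =
      MvPolynomial.pderiv j (MvPolynomial.pderiv i P) := by
  by_cases hij : i = j
  · rw [hij]
  ext m
  simp only [MvPolynomial.coeff_pderiv, Finsupp.add_apply, Finsupp.single_apply, hij,
    Ne.symm hij, if_false, Nat.add_zero, add_right_comm m]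
  ring

theorem isHarmonicPoly_pderiv {n : ℕ} {P : MvPolynomial (Fin n) ℂ} (h : IsHarmonicPoly P)
    (j : Fin n) : IsHarmonicPoly (MvPolynomial.pderiv j P) := by
  have := congrArg (MvPolynomial.pderiv j) h
  rw [map_zero, map_sum] at this
  rw [IsHarmonicPoly, ← this]
  refine Finset.sum_congr rfl fun i _ => ?_
  rw [pderiv_comm i j P, pderiv_comm i j]

/-- Hecke's identity for complex Gaussians. -/
theorem fourier_polyFun_mul_gaussian {n : ℕ} {b : ℂ} (hb : 0 < b.re) (k : ℕ)
    (P : MvPolynomial (Fin n) ℂ) (hP : P.IsHomogeneous k) (hPh : IsHarmonicPoly P) (w : Rn n) :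
    𝓕 (fun v : Rn n => polyFun P v * Complex.exp (-b * ‖v‖ ^ 2)) w =
      ((Real.pi : ℂ) / b) ^ ((n : ℂ) / 2) * (-Complex.I * Real.pi / b) ^ k * polyFun P w *
        Complex.exp (-(Real.pi : ℂ) ^ 2 * ‖w‖ ^ 2 / b) := by
  have hb0 : b ≠ 0 := fun h => by simp [h] at hb
  induction k generalizing P w with
  | zero =>
    have hPC : P = MvPolynomial.C (P.coeff 0) :=
      MvPolynomial.totalDegree_eq_zero_iff_eq_C.1 (Nat.le_zero.1 hP.totalDegree_le)
    have hc : ∀ x, polyFun P x = P.coeff 0 := fun x => by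
      rw [hPC]; simp [polyFun]
    simp_rw [hc]
    have h1 := fourier_gaussian_innerProductSpace (V := Rn n) hb w
    rw [finrank_euclideanSpace_fin] at h1
    rw [Real.fourier_eq] at h1 ⊢
    simp_rw [Circle.smul_def, smul_eq_mul] at h1 ⊢
    simp_rw [mul_left_comm _ (P.coeff 0)]
    rw [integral_const_mul, h1]
    ring
  | succ k ih =>
    -- Euler's identity writes `(k+1)P` as the sum of `x_j ∂_j P`, where each `∂_j P` is harmonic of
    -- degree `k`. Multiplication by `x_j` is a derivative on the Fourier side. Where it falls on
    -- `∂_j P`, the sum over `j` is the Laplacian of `P`, which vanishes; where it falls on the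
    -- Gaussian, it gives `w_j ∂_j P`, and Euler's identity reassembles `P`.
    set Q : Fin n → MvPolynomial (Fin n) ℂ := fun j => MvPolynomial.pderiv j P
    have hQ : ∀ j, (Q j).IsHomogeneous k := fun j => by
      have := hP.pderiv (i := j); simpa using this
    have hQh : ∀ j, IsHarmonicPoly (Q j) := fun j => isHarmonicPoly_pderiv hPh j
    have hEuler : ∀ x, ((k : ℂ) + 1) * polyFun P x = ∑ j, (x j : ℂ) * polyFun (Q j) x := fun x => by
      have := congrArg (MvPolynomial.eval fun i => (x i : ℂ)) hP.sum_X_mul_pderiv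
      simp only [map_sum, map_mul, MvPolynomial.eval_X, nsmul_eq_mul, map_natCast] at this
      rw [← Nat.cast_succ]
      exact this.symm
    have hharm : ∑ j, polyFun (MvPolynomial.pderiv j (Q j)) w = 0 := by
      have := congrArg (MvPolynomial.eval fun i => (w i : ℂ)) hPh
      simpa [polyFun, map_sum] using this
    have hk : ((k : ℂ) + 1) ≠ 0 := by exact_mod_cast Nat.succ_ne_zero k
    set C := ((Real.pi : ℂ) / b) ^ ((n : ℂ) / 2) * (-Complex.I * Real.pi / b) ^ k
    set e := Complex.exp (-(Real.pi : ℂ) ^ 2 * ‖w‖ ^ 2 / b)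
    have hpi : (Real.pi : ℂ) ≠ 0 := by exact_mod_cast Real.pi_ne_zero
    have hj : ∀ j, -(2 * Real.pi * Complex.I) *
        𝓕 (fun v : Rn n => (v j : ℂ) * (polyFun (Q j) v * Complex.exp (-b * ‖v‖ ^ 2))) w =
        C * polyFun (MvPolynomial.pderiv j (Q j)) w * e +
          C * polyFun (Q j) w * (e * (-(Real.pi : ℂ) ^ 2 * (2 * w j : ℝ) / b)) := by
      intro j
      have h1 := hasDerivAt_fourier_line (integrable_polyFun_mul_gaussian (Q j) hb)
        (integrable_norm_mul_polyFun_mul_gaussian (Q j) hb) w j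
      have h2 : (fun t : ℝ => 𝓕 (fun v : Rn n => polyFun (Q j) v * Complex.exp (-b * ‖v‖ ^ 2))
          (w + t • EuclideanSpace.single j (1 : ℝ))) = fun t : ℝ =>
          C * polyFun (Q j) (w + t • EuclideanSpace.single j (1 : ℝ)) *
            Complex.exp (-(Real.pi : ℂ) ^ 2 *
              ‖w + t • EuclideanSpace.single j (1 : ℝ)‖ ^ 2 / b) := by
        ext t
        exact ih (Q j) (hQ j) (hQh j) _
      rw [h2] at h1
      have h3 := ((hasDerivAt_polyFun (Q j) w j).const_mul C).mul
        (((hasDerivAt_norm_sq_line w j).const_mul (-(Real.pi : ℂ) ^ 2)).div_const b).cexp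
      have h4 := h1.unique h3
      simpa [C, e] using h4
    have hsum : 𝓕 (fun v : Rn n => polyFun P v * Complex.exp (-b * ‖v‖ ^ 2)) w =
        ((k : ℂ) + 1)⁻¹ * ∑ j, 𝓕 (fun v : Rn n =>
          (v j : ℂ) * (polyFun (Q j) v * Complex.exp (-b * ‖v‖ ^ 2))) w := by
      simp_rw [Real.fourier_eq]
      rw [← integral_finsetSum, ← integral_const_mul]
      · congr 1
        ext v
        rw [← Finset.smul_sum]
        simp_rw [← mul_assoc]
        rw [← Finset.sum_mul, ← hEuler]
        simp only [Circle.smul_def, smul_eq_mul]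
        field_simp
      · intro j _
        refine (Real.fourierIntegral_convergent_iff w).2 ?_
        have := integrable_polyFun_mul_gaussian (MvPolynomial.X j * Q j) hb
        refine this.congr (Eventually.of_forall fun v => ?_)
        simp [polyFun, mul_assoc]
    rw [hsum]
    have hj' : ∀ j, 𝓕 (fun v : Rn n => (v j : ℂ) *
        (polyFun (Q j) v * Complex.exp (-b * ‖v‖ ^ 2))) w =
        (-(2 * Real.pi * Complex.I))⁻¹ * (C * e) * polyFun (MvPolynomial.pderiv j (Q j)) w +
          C * e * (-Complex.I * Real.pi / b) * ((w j : ℂ) * polyFun (Q j) w) := by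
      intro j
      have h5 : -(2 * (Real.pi : ℂ) * Complex.I) ≠ 0 := by simp [hpi]
      rw [← mul_right_inj' h5, hj j]
      push_cast
      field_simp
      ring_nf
      simp only [Complex.I_sq]
      ring
    simp_rw [hj']
    rw [Finset.sum_add_distrib, ← Finset.mul_sum, ← Finset.mul_sum, hharm, ← hEuler, pow_succ,
      mul_zero, zero_add]
    calc _ = (((k : ℂ) + 1)⁻¹ * ((k : ℂ) + 1)) *
          (C * e * (-Complex.I * Real.pi / b) * polyFun P w) := by ring
      _ = _ := by rw [inv_mul_cancel₀ hk]; simp only [C]; ring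

/-! ### Functions that define tempered distributions -/

theorem represents_of_memLp {n : ℕ} {f : Rn n → ℂ} {p : ℝ≥0∞} (hp : 1 ≤ p)
    (hf : MemLp f p volume) : ∃ T : 𝓢'(Rn n, ℂ), Represents f T := by
  have : Fact (1 ≤ p) := ⟨hp⟩
  refine ⟨Lp.toTemperedDistribution (hf.toLp f), hf.1, fun ψ => ?_, fun ψ => ?_⟩
  · have : p.conjExponent.HolderConjugate p :=
      (ENNReal.HolderConjugate.conjExponent hp).symm
    exact (ψ.memLp p.conjExponent volume).integrable_mul hf
  · rw [Lp.toTemperedDistribution_apply]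
    refine integral_congr_ae ?_
    filter_upwards [hf.coeFn_toLp] with x hx
    rw [hx, smul_eq_mul]

theorem isTemperedFun_of_memLp {n : ℕ} {f : Rn n → ℂ} {p : ℝ≥0∞} (hp : 1 ≤ p)
    (hf : MemLp f p volume) : IsTemperedFun f := represents_of_memLp hp hf

theorem isTemperedFun_add {n : ℕ} {f g : Rn n → ℂ} (hf : IsTemperedFun f)
    (hg : IsTemperedFun g) : IsTemperedFun fun x => f x + g x := by
  obtain ⟨T, hT⟩ := hf
  obtain ⟨T', hT'⟩ := hg
  refine ⟨T + T', hT.1.add hT'.1, fun ψ => ?_, fun ψ => ?_⟩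
  · simp_rw [mul_add]; exact (hT.2 ψ).add (hT'.2 ψ)
  · simp_rw [mul_add]
    rw [integral_add (hT.2 ψ) (hT'.2 ψ), ← hT.3, ← hT'.3]; rfl

theorem isTemperedFun_congr {n : ℕ} {f g : Rn n → ℂ} (hf : IsTemperedFun f) (h : f =ᵐ[volume] g) :
    IsTemperedFun g := by
  obtain ⟨T, hT⟩ := hf
  refine ⟨T, hT.1.congr h, fun ψ => ?_, fun ψ => ?_⟩
  · refine (hT.2 ψ).congr ?_
    filter_upwards [h] with x hx; rw [hx]
  · rw [hT.3]
    refine integral_congr_ae ?_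
    filter_upwards [h] with x hx; rw [hx]

/-- A tempered function is the sum of its restrictions to a set and to the complement. -/
theorem isTemperedFun_of_memLp_of_memLp_compl {n : ℕ} {f : Rn n → ℂ} {p q : ℝ≥0∞} (hp : 1 ≤ p)
    (hq : 1 ≤ q) {A : Set (Rn n)} (h1 : MemLp (A.indicator f) p volume)
    (h2 : MemLp (Aᶜ.indicator f) q volume) : IsTemperedFun f := by
  have := isTemperedFun_add (isTemperedFun_of_memLp hp h1) (isTemperedFun_of_memLp hq h2)
  convert! this using 1
  ext x
  exact (indicator_self_add_compl_apply A f x).symm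

theorem toDistribution_apply {n : ℕ} {f : Rn n → ℂ} (hf : IsTemperedFun f) (ψ : 𝓢(Rn n, ℂ)) :
    toDistribution f ψ = ∫ x, ψ x * f x := hf.represents.3 ψ

theorem ae_eq_of_pairing {n : ℕ} {f g : Rn n → ℂ} (hf : LocallyIntegrable f volume)
    (hg : LocallyIntegrable g volume)
    (hfi : ∀ ψ : 𝓢(Rn n, ℂ), Integrable fun x => ψ x * f x)
    (hgi : ∀ ψ : 𝓢(Rn n, ℂ), Integrable fun x => ψ x * g x)
    (h : ∀ ψ : 𝓢(Rn n, ℂ), ∫ x, ψ x * f x = ∫ x, ψ x * g x) : f =ᵐ[volume] g := by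
  have key := ae_norm_le_of_pairing (w := fun x => f x - g x) (B := 0) (hf.sub hg) le_rfl
    (fun φ => by
      simp_rw [mul_sub]
      rw [integral_sub (hfi φ) (hgi φ), h φ, sub_self]; simp)
  filter_upwards [key] with x hx
  exact sub_eq_zero.1 (norm_le_zero_iff.1 hx)

theorem ae_eq_of_represents {n : ℕ} {f g : Rn n → ℂ} {T : 𝓢'(Rn n, ℂ)} (hf : Represents f T)
    (hg : Represents g T) : f =ᵐ[volume] g :=
  ae_eq_of_pairing hf.locallyIntegrable hg.locallyIntegrable hf.2 hg.2
    fun ψ => by rw [← hf.3, ← hg.3]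

theorem distLpNorm_eq {n : ℕ} {g : Rn n → ℂ} {T : 𝓢'(Rn n, ℂ)} (r : ℝ≥0∞) (h : Represents g T) :
    distLpNorm r T = eLpNorm g r volume := by
  refine le_antisymm (iInf₂_le g h) (le_iInf₂ fun f hf => ?_)
  rw [eLpNorm_congr_ae (ae_eq_of_represents h hf)]

/-! ### Powers of the norm -/

/-- The function is integrable on the unit ball since `s < n`, and bounded outside it since `s ≥ 0`.
-/
theorem isTemperedFun_of_norm_le_rpow {n : ℕ} (hn : 1 ≤ n) {f : Rn n → ℂ} {C s : ℝ}
    (hs : 0 ≤ s) (hsn : s < n) (hC : 0 ≤ C) (hf : AEStronglyMeasurable f volume)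
    (h : ∀ x, ‖f x‖ ≤ C * ‖x‖ ^ (-s)) : IsTemperedFun f := by
  refine isTemperedFun_of_memLp_of_memLp_compl (p := 1) (q := ∞) le_rfl (by simp)
    (A := Metric.ball 0 1) ?_ ?_
  · rw [memLp_one_iff_integrable, integrable_indicator_iff measurableSet_ball]
    exact integrableOn_ball_of_norm_le_rpow (α := s) (C := C) (by simpa using hn) (by simpa using hsn)
      (Eventually.of_forall h) hf
  · refine memLp_top_of_bound (hf.indicator measurableSet_ball.compl) C
      (Eventually.of_forall fun x => ?_)
    by_cases hx : x ∈ (Metric.ball (0 : Rn n) 1)ᶜ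
    · rw [indicator_of_mem hx]
      have hx1 : 1 ≤ ‖x‖ := by simpa using hx
      exact (h x).trans (mul_le_of_le_one_right hC
        (Real.rpow_le_one_of_one_le_of_nonpos hx1 (by linarith)))
    · rw [indicator_of_notMem hx]; simpa using hC

/-! ### Scaling -/

theorem integral_comp_smul_eq {n : ℕ} {F : Type*} [NormedAddCommGroup F] [NormedSpace ℝ F]
    (f : Rn n → F) {c : ℝ} (hc : 0 < c) : ∫ x, f (c • x) = (c ^ n)⁻¹ • ∫ x, f x := by
  have := Measure.integral_comp_smul_of_nonneg (volume : Measure (Rn n)) f c (hR := hc.le)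
  rwa [finrank_euclideanSpace_fin] at this

theorem map_smul_volume {n : ℕ} {c : ℝ} (hc : 0 < c) :
    Measure.map (c • ·) (volume : Measure (Rn n)) = ENNReal.ofReal ((c ^ n)⁻¹) • volume := by
  rw [Measure.map_addHaar_smul _ hc.ne', finrank_euclideanSpace_fin, abs_of_nonneg]
  positivity

theorem quasiMeasurePreserving_smul {n : ℕ} {c : ℝ} (hc : 0 < c) :
    Measure.QuasiMeasurePreserving (fun x : Rn n => c • x) volume volume := by
  refine ⟨measurable_const_smul c, ?_⟩
  rw [map_smul_volume hc]
  exact Measure.smul_absolutelyContinuous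

theorem eLpNorm_comp_smul {n : ℕ} {f : Rn n → ℂ} {c r : ℝ} (hc : 0 < c) (hr : 0 < r)
    (hf : AEStronglyMeasurable f volume) :
    eLpNorm (fun x => f (c • x)) (ENNReal.ofReal r) volume =
      ENNReal.ofReal (c ^ (-(n : ℝ) / r)) * eLpNorm f (ENNReal.ofReal r) volume := by
  have h1 := eLpNorm_map_measure (p := ENNReal.ofReal r) (μ := (volume : Measure (Rn n)))
    (f := fun x => c • x) (g := f) (by
      rw [map_smul_volume hc]; exact hf.smul_measure _) (measurable_const_smul c).aemeasurable
  rw [map_smul_volume hc, eLpNorm_smul_measure_of_ne_top ENNReal.ofReal_ne_top] at h1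
  rw [show (fun x => f (c • x)) = f ∘ fun x => c • x from rfl, ← h1, smul_eq_mul]
  congr 1
  rw [ENNReal.toReal_div, ENNReal.toReal_one, ENNReal.toReal_ofReal hr.le,
    ENNReal.ofReal_rpow_of_pos (by positivity), ← Real.rpow_natCast, ← Real.rpow_neg hc.le,
    ← Real.rpow_mul hc.le]
  congr 2
  ring

/-! ### The evolution of homogeneous data -/

theorem polyFun_smul {n k : ℕ} {P : MvPolynomial (Fin n) ℂ} (hP : P.IsHomogeneous k) (c : ℝ)
    (x : Rn n) : polyFun P (c • x) = (c : ℂ) ^ k * polyFun P x := by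
  simp only [polyFun, MvPolynomial.eval_eq', Finset.mul_sum]
  refine Finset.sum_congr rfl fun d hd => ?_
  have h1 := hP (MvPolynomial.mem_support_iff.1 hd)
  have h2 : ∑ i, d i = k := by
    rw [← h1, Finsupp.weight_apply, Finsupp.sum_fintype] <;> simp
  rw [← h2, ← Finset.prod_pow_eq_pow_sum]
  simp only [PiLp.smul_apply, smul_eq_mul, Complex.ofReal_mul, mul_pow, Finset.prod_mul_distrib]
  ring

theorem exists_norm_polyFun_le_pow {n k : ℕ} {P : MvPolynomial (Fin n) ℂ}
    (hP : P.IsHomogeneous k) : ∃ C : ℝ, 0 ≤ C ∧ ∀ x, ‖polyFun P x‖ ≤ C * ‖x‖ ^ k := by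
  obtain ⟨C, N, hC, h⟩ := exists_norm_polyFun_le P
  refine ⟨C * 2 ^ N, by positivity, fun x => ?_⟩
  by_cases hx : x = 0
  · have h0 := polyFun_smul hP 0 x
    rw [zero_smul] at h0
    rw [hx, h0]
    rcases Nat.eq_zero_or_pos k with hk | hk
    · subst hk
      have := h 0
      simp only [hx, pow_zero, norm_zero, one_mul, mul_one] at this ⊢
      refine this.trans ?_
      simp only [ne_eq, OfNat.ofNat_ne_zero, not_false_eq_true, zero_pow, add_zero, one_pow, mul_one]
      exact le_mul_of_one_le_right hC (one_le_pow₀ one_le_two)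
    · rw [Complex.ofReal_zero, zero_pow hk.ne', zero_mul, norm_zero]; positivity
  · have hx0 : 0 < ‖x‖ := norm_pos_iff.2 hx
    have e : x = ‖x‖ • (‖x‖⁻¹ • x) := by
      rw [smul_smul, mul_inv_cancel₀ hx0.ne', one_smul]
    have h1 := h (‖x‖⁻¹ • x)
    have h2 : ‖‖x‖⁻¹ • x‖ = 1 := by
      rw [norm_smul, norm_inv, norm_norm, inv_mul_cancel₀ hx0.ne']
    rw [h2] at h1
    conv_lhs => rw [e, polyFun_smul hP]
    rw [norm_mul, norm_pow, Complex.norm_real, norm_norm, mul_comm]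
    refine mul_le_mul_of_nonneg_right (h1.trans (le_of_eq ?_)) (by positivity)
    norm_num

/-- Hecke's identity is used twice. The transform of `P e^{-y|x|²}` is a multiple of `P
e^{-π²|ξ|²/y}`; the symbol changes the parameter to `b = π²/y + 4π²i`; the second transform gives `P
e^{-π²|x|²/b}`. Since `π²/(yb) = (1+4iy)^{-1}`, the amplitude has modulus `(1+16y²)^{-(n/2+k)/2}`
and the width is `y/(1+16y²)`. The reflection `ψ(-x)` comes from the inverse transform. -/
theorem integral_polyFun_gaussian_mul_propagator {n k : ℕ} {P : MvPolynomial (Fin n) ℂ}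
    (hP : P.IsHomogeneous k) (hPh : IsHarmonicPoly P) {y : ℝ} (hy : 0 < y) (ψ : 𝓢(Rn n, ℂ)) :
    ‖∫ x, polyFun P x * Complex.exp (-y * ‖x‖ ^ 2) * propagator n 1 ψ x‖ ≤
      (1 + 16 * y ^ 2) ^ (-((n : ℝ) / 2 + k) / 2) *
        ∫ x, ‖polyFun P x‖ * Real.exp (-(y / (1 + 16 * y ^ 2)) * ‖x‖ ^ 2) * ‖ψ (-x)‖ := by
  have hy1 : 0 < (y : ℂ).re := by simpa using hy
  let b : ℂ := ((Real.pi ^ 2 / y : ℝ) : ℂ) + ((4 * Real.pi ^ 2 : ℝ) : ℂ) * Complex.I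
  have hb : 0 < b.re := by
    simp only [b, Complex.add_re, Complex.ofReal_re, Complex.re_ofReal_mul, Complex.I_re]
    have : 0 < Real.pi ^ 2 / y := by positivity
    linarith
  have hb0 : b ≠ 0 := fun h => by simp [h] at hb
  have hyC : (y : ℂ) ≠ 0 := by exact_mod_cast hy.ne'
  have hpi : (Real.pi : ℂ) ≠ 0 := by exact_mod_cast Real.pi_ne_zero
  have hby : (y : ℂ) * b = (Real.pi : ℂ) ^ 2 * (1 + ((4 * y : ℝ) : ℂ) * Complex.I) := by
    simp only [b]; push_cast; field_simp
  have hns : Complex.normSq (1 + ((4 * y : ℝ) : ℂ) * Complex.I) = 1 + 16 * y ^ 2 := by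
    rw [← Complex.ofReal_one, Complex.normSq_add_mul_I]; ring
  have hz : (1 + ((4 * y : ℝ) : ℂ) * Complex.I) ≠ 0 := by
    rw [← Complex.normSq_pos, hns]; positivity
  have hquot : (Real.pi : ℂ) / y * ((Real.pi : ℂ) / b) = (1 + ((4 * y : ℝ) : ℂ) * Complex.I)⁻¹ := by
    rw [div_mul_div_comm, hby, ← sq, div_mul_eq_div_div, div_self (pow_ne_zero 2 hpi), one_div]
  have hnq : ‖(Real.pi : ℂ) / y‖ * ‖(Real.pi : ℂ) / b‖ = (1 + 16 * y ^ 2) ^ (-(1 / 2) : ℝ) := by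
    rw [← norm_mul, hquot, norm_inv, Complex.norm_def, hns, Real.sqrt_eq_rpow,
      Real.rpow_neg (by positivity)]
  let G : Rn n → ℂ := fun x => polyFun P x * Complex.exp (-y * ‖x‖ ^ 2)
  let H : Rn n → ℂ := fun x => polyFun P x * Complex.exp (-b * ‖x‖ ^ 2)
  have hG : Integrable G := integrable_polyFun_mul_gaussian P hy1
  have hH : Integrable H := integrable_polyFun_mul_gaussian P hb
  let A : ℂ := ((Real.pi : ℂ) / y) ^ ((n : ℂ) / 2) * (-Complex.I * Real.pi / y) ^ k
  let A' : ℂ := ((Real.pi : ℂ) / b) ^ ((n : ℂ) / 2) * (-Complex.I * Real.pi / b) ^ k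
  have hψi : Integrable (fun x => ψ (-x)) := ψ.integrable.comp_neg
  have hψn : ⇑(𝓕⁻ ψ : 𝓢(Rn n, ℂ)) = 𝓕 (fun y => ψ (-y)) := by
    rw [SchwartzMap.fourierInv_coe, Real.fourierInv_eq_fourier_comp_neg]
  have e1 : ∫ x, G x * propagator n 1 ψ x =
      A * A' * ∫ x, polyFun P x * Complex.exp (-(Real.pi : ℂ) ^ 2 * ‖x‖ ^ 2 / b) * ψ (-x) := by
    rw [propagator_eq, SchwartzMap.fourier_coe, ← integral_fourier_mul_eq_flip hG
      (SchwartzMap.integrable _)]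
    have e2 : ∀ ξ, 𝓕 G ξ * SchwartzMap.smulLeftCLM ℂ (schrodingerSymbol n 1) (𝓕⁻ ψ) ξ =
        A * (H ξ * 𝓕 (fun y => ψ (-y)) ξ) := by
      intro ξ
      rw [SchwartzMap.smulLeftCLM_apply_apply (schrodingerSymbol_hasTemperateGrowth n 1), hψn,
        fourier_polyFun_mul_gaussian hy1 k P hP hPh, smul_eq_mul]
      simp only [A, H, schrodingerSymbol]
      have e3 : Complex.exp (-b * ‖ξ‖ ^ 2) = Complex.exp (-(Real.pi : ℂ) ^ 2 * ‖ξ‖ ^ 2 / y) *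
          Complex.exp (Complex.I * ((-(1 * (2 * Real.pi) ^ 2 * ‖ξ‖ ^ 2) : ℝ) : ℂ)) := by
        rw [← Complex.exp_add]
        congr 1
        simp only [b]
        push_cast
        ring
      rw [e3]
      ring
    simp_rw [e2]
    rw [integral_const_mul, ← integral_fourier_mul_eq_flip hH hψi, mul_assoc A A',
      ← integral_const_mul A']
    congr 2
    ext ξ
    rw [fourier_polyFun_mul_gaussian hb k P hP hPh]
    simp only [A']
    ring
  have e4 : ‖A * A'‖ = (1 + 16 * y ^ 2) ^ (-((n : ℝ) / 2 + k) / 2) := by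
    have hn2 : ((n : ℂ) / 2) = (((n : ℝ) / 2 : ℝ) : ℂ) := by push_cast; ring
    have h1 : ∀ z : ℂ, ‖-Complex.I * Real.pi / z‖ = ‖(Real.pi : ℂ) / z‖ := fun z => by
      simp
    simp only [A, A']
    rw [norm_mul, norm_mul, norm_mul, norm_pow, norm_pow, h1, h1, hn2, Complex.norm_cpow_real,
      Complex.norm_cpow_real, mul_mul_mul_comm, ← Real.mul_rpow (norm_nonneg _) (norm_nonneg _),
      ← mul_pow, hnq, ← Real.rpow_natCast ((1 + 16 * y ^ 2) ^ (-(1 / 2) : ℝ)) k, ← Real.rpow_mul (by positivity),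
      ← Real.rpow_mul (by positivity), ← Real.rpow_add (by positivity)]
    congr 1
    ring
  have e5 : ∀ x : Rn n, ‖Complex.exp (-(Real.pi : ℂ) ^ 2 * ‖x‖ ^ 2 / b)‖ =
      Real.exp (-(y / (1 + 16 * y ^ 2)) * ‖x‖ ^ 2) := by
    intro x
    have h1 : -(Real.pi : ℂ) ^ 2 * ‖x‖ ^ 2 / b =
        ((-(‖x‖ ^ 2 * y) : ℝ) : ℂ) * (1 + ((4 * y : ℝ) : ℂ) * Complex.I)⁻¹ := by
      rw [← hquot]; push_cast; field_simp
    rw [Complex.norm_exp, h1, Complex.re_ofReal_mul, Complex.inv_re, hns]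
    congr 1
    have : (1 + ((4 * y : ℝ) : ℂ) * Complex.I).re = 1 := by
      rw [Complex.add_re, Complex.re_ofReal_mul]; simp
    rw [this]
    field_simp
  rw [e1, norm_mul, e4]
  refine mul_le_mul_of_nonneg_left ((norm_integral_le_integral_norm _).trans (le_of_eq ?_))
    (by positivity)
  congr 1
  ext x
  rw [norm_mul, norm_mul, e5]

theorem integrable_rpow_polyFun_mul_gaussian {n : ℕ} (P : MvPolynomial (Fin n) ℂ) {a r : ℝ}
    (ha : 0 < a) (hr : 0 < r) :
    Integrable (fun x : Rn n => (‖polyFun P x‖ * Real.exp (-a * ‖x‖ ^ 2)) ^ r) := by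
  obtain ⟨C, N, hC, h⟩ := exists_norm_polyFun_le P
  obtain ⟨M, hM⟩ := exists_nat_ge (N * r)
  refine ((integrable_one_add_pow_mul_gaussian M (mul_pos ha hr)).const_mul (C ^ r)).mono' ?_
    (Eventually.of_forall fun x => ?_)
  · have h1 := continuous_polyFun P
    exact Continuous.aestronglyMeasurable (Continuous.rpow_const (by fun_prop) fun _ => Or.inr hr.le)
  · have h1 : 1 ≤ 1 + ‖x‖ ^ 2 := by nlinarith [norm_nonneg x]
    rw [Real.norm_of_nonneg (by positivity), Real.mul_rpow (norm_nonneg _) (Real.exp_nonneg _),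
      ← Real.exp_mul, ← mul_assoc]
    have e : -a * ‖x‖ ^ 2 * r = -(a * r) * ‖x‖ ^ 2 := by ring
    rw [e]
    refine mul_le_mul_of_nonneg_right ?_ (Real.exp_nonneg _)
    refine (Real.rpow_le_rpow (norm_nonneg _) (h x) hr.le).trans ?_
    rw [Real.mul_rpow hC (by positivity), ← Real.rpow_natCast (1 + ‖x‖ ^ 2) N,
      ← Real.rpow_natCast (1 + ‖x‖ ^ 2) M, ← Real.rpow_mul (by positivity)]
    refine mul_le_mul_of_nonneg_left ?_ (by positivity)
    exact Real.rpow_le_rpow_of_exponent_le h1 hM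

theorem integral_rpow_polyFun_mul_gaussian {n k : ℕ} {P : MvPolynomial (Fin n) ℂ}
    (hP : P.IsHomogeneous k) {a r : ℝ} (ha : 0 < a) :
    ∫ x : Rn n, (‖polyFun P x‖ * Real.exp (-a * ‖x‖ ^ 2)) ^ r =
      a ^ (-((k * r + n) / 2)) * ∫ x : Rn n, (‖polyFun P x‖ * Real.exp (-1 * ‖x‖ ^ 2)) ^ r := by
  have hs : 0 < Real.sqrt a := Real.sqrt_pos.2 ha
  have h1 := integral_comp_smul_eq
    (fun x : Rn n => (‖polyFun P x‖ * Real.exp (-1 * ‖x‖ ^ 2)) ^ r) hs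
  have h2 : ∀ x : Rn n, (‖polyFun P (Real.sqrt a • x)‖ *
      Real.exp (-1 * ‖Real.sqrt a • x‖ ^ 2)) ^ r =
      a ^ (k * r / 2) * (‖polyFun P x‖ * Real.exp (-a * ‖x‖ ^ 2)) ^ r := by
    intro x
    rw [polyFun_smul hP, norm_mul, norm_pow, Complex.norm_real, Real.norm_of_nonneg hs.le, norm_smul,
      Real.norm_of_nonneg hs.le, mul_pow, Real.sq_sqrt ha.le, mul_assoc,
      Real.mul_rpow (by positivity) (by positivity), Real.sqrt_eq_rpow, ← Real.rpow_natCast,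
      ← Real.rpow_mul ha.le, ← Real.rpow_mul ha.le]
    congr 2
    · ring
    · ring_nf
  simp_rw [h2] at h1
  rw [integral_const_mul, smul_eq_mul, Real.sqrt_eq_rpow, ← Real.rpow_natCast, ← Real.rpow_mul ha.le,
    ← Real.rpow_neg ha.le] at h1
  have h3 : a ^ (-(k * r / 2)) * a ^ (k * r / 2) = 1 := by
    rw [← Real.rpow_add ha]; simp
  calc _ = a ^ (-(k * r / 2)) * (a ^ (k * r / 2) *
        ∫ x : Rn n, (‖polyFun P x‖ * Real.exp (-a * ‖x‖ ^ 2)) ^ r) := by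
        rw [← mul_assoc, h3, one_mul]
    _ = _ := by
        rw [h1, ← mul_assoc, ← Real.rpow_add ha]
        congr 2; ring

theorem integrableOn_rpow_mul_one_add_rpow {e₁ e₂ : ℝ} (h1 : 0 < e₁) (h2 : e₁ < 2 * e₂) :
    IntegrableOn (fun y : ℝ => y ^ (e₁ - 1) * (1 + 16 * y ^ 2) ^ (-e₂)) (Ioi 0) := by
  have hm : AEStronglyMeasurable (fun y : ℝ => y ^ (e₁ - 1) * (1 + 16 * y ^ 2) ^ (-e₂)) volume :=
    Measurable.aestronglyMeasurable (by fun_prop)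
  rw [← Ioo_union_Ici_eq_Ioi one_pos]
  refine IntegrableOn.union ?_ ?_
  · refine Integrable.mono' ((intervalIntegral.integrableOn_Ioo_rpow_iff (s := e₁ - 1) one_pos).2
      (by linarith)) hm.restrict ?_
    rw [ae_restrict_iff' measurableSet_Ioo]
    refine Eventually.of_forall fun y hy => ?_
    have hy0 : 0 < y := hy.1
    rw [Real.norm_of_nonneg (by positivity)]
    exact mul_le_of_le_one_right (by positivity)
      (Real.rpow_le_one_of_one_le_of_nonpos (by nlinarith) (by linarith))
  · rw [integrableOn_Ici_iff_integrableOn_Ioi]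
    refine Integrable.mono' (integrableOn_Ioi_rpow_of_lt (a := e₁ - 1 - 2 * e₂) (c := 1)
      (by linarith) one_pos) hm.restrict ?_
    rw [ae_restrict_iff' measurableSet_Ioi]
    refine Eventually.of_forall fun y hy => ?_
    have hy0 : (0 : ℝ) < y := lt_trans one_pos hy
    rw [Real.norm_of_nonneg (by positivity), Real.rpow_sub hy0 (e₁ - 1), div_eq_mul_inv,
      ← Real.rpow_neg hy0.le]
    refine mul_le_mul_of_nonneg_left ?_ (by positivity)
    rw [show -(2 * e₂) = 2 * (-e₂) by ring, Real.rpow_mul hy0.le, Real.rpow_two]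
    exact Real.rpow_le_rpow_of_nonpos (by positivity) (by nlinarith) (by linarith)

theorem integrable_rpow_norm_mul_schwartz {n : ℕ} (hn : 1 ≤ n) {s : ℝ} (hs : 0 ≤ s) (hsn : s < n)
    (ψ : 𝓢(Rn n, ℂ)) : Integrable fun x => ‖x‖ ^ (-s) * ‖ψ x‖ := by
  have h1 : IsTemperedFun fun x : Rn n => ((‖x‖ ^ (-s) : ℝ) : ℂ) := by
    refine isTemperedFun_of_norm_le_rpow hn hs hsn zero_le_one
      (Measurable.aestronglyMeasurable (by fun_prop)) fun x => ?_
    rw [Complex.norm_real, Real.norm_of_nonneg (by positivity), one_mul]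
  obtain ⟨T, hT⟩ := h1
  refine (hT.2 ψ).norm.congr (Eventually.of_forall fun x => ?_)
  simp only
  rw [norm_mul, Complex.norm_real, Real.norm_of_nonneg (by positivity), mul_comm]

theorem ae_ne_zero {n : ℕ} (hn : 1 ≤ n) : ∀ᵐ x : Rn n, x ≠ 0 := by
  have : Nonempty (Fin n) := ⟨⟨0, hn⟩⟩
  exact Measure.ae_ne volume 0

theorem norm_homogeneous_le {n k : ℕ} {P : MvPolynomial (Fin n) ℂ} (hP : P.IsHomogeneous k)
    {p : ℂ} (hp : 0 < p.re) : ∃ C : ℝ, 0 ≤ C ∧ ∀ x : Rn n,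
      ‖polyFun P x * (‖x‖ : ℂ) ^ (-p - (k : ℂ))‖ ≤ C * ‖x‖ ^ (-p.re) := by
  obtain ⟨C, hC, h⟩ := exists_norm_polyFun_le_pow hP
  refine ⟨C, hC, fun x => ?_⟩
  by_cases hx : x = 0
  · have h0 : -p - (k : ℂ) ≠ 0 := fun h0 => by
      have h1 := congrArg Complex.re h0
      simp only [Complex.sub_re, Complex.neg_re, Complex.natCast_re, Complex.zero_re] at h1
      linarith [(Nat.cast_nonneg k : (0 : ℝ) ≤ k)]
    rw [hx, norm_zero, Complex.ofReal_zero, Complex.zero_cpow h0, mul_zero, norm_zero]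
    positivity
  · have hx0 : 0 < ‖x‖ := norm_pos_iff.2 hx
    rw [norm_mul, Complex.norm_cpow_eq_rpow_re_of_pos hx0]
    have e : (-p - (k : ℂ)).re = -p.re - k := by simp
    rw [e]
    calc ‖polyFun P x‖ * ‖x‖ ^ (-p.re - k) ≤ C * ‖x‖ ^ k * ‖x‖ ^ (-p.re - k) := by
          gcongr; exact h x
      _ = C * ‖x‖ ^ (-p.re) := by
          rw [mul_assoc, ← Real.rpow_natCast, ← Real.rpow_add hx0]
          congr 2; ring

theorem homogeneous_smul {n k : ℕ} {P : MvPolynomial (Fin n) ℂ} (hP : P.IsHomogeneous k)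
    (p : ℂ) {c : ℝ} (hc : 0 < c) (x : Rn n) :
    polyFun P (c • x) * (‖c • x‖ : ℂ) ^ (-p - (k : ℂ)) =
      (c : ℂ) ^ (-p) * (polyFun P x * (‖x‖ : ℂ) ^ (-p - (k : ℂ))) := by
  have hc0 : (c : ℂ) ≠ 0 := by exact_mod_cast hc.ne'
  rw [polyFun_smul hP, norm_smul, Real.norm_of_nonneg hc.le, Complex.ofReal_mul,
    Complex.mul_cpow_ofReal_nonneg hc.le (norm_nonneg x), Complex.cpow_sub _ _ hc0,
    Complex.cpow_natCast]
  field_simp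

theorem aestronglyMeasurable_homogeneous {n k : ℕ} (P : MvPolynomial (Fin n) ℂ) (p : ℂ) :
    AEStronglyMeasurable (fun x : Rn n => polyFun P x * (‖x‖ : ℂ) ^ (-p - (k : ℂ))) volume := by
  have h1 := (continuous_polyFun P).measurable
  exact Measurable.aestronglyMeasurable (by fun_prop)

theorem integrableOn_cpow_mul_exp {a : ℂ} {r : ℝ} (ha : 0 < a.re) (hr : 0 < r) :
    IntegrableOn (fun t : ℝ => (t : ℂ) ^ (a - 1) * Complex.exp (-(r * t))) (Ioi 0) ∧
      ∫ t in Ioi (0 : ℝ), ‖(t : ℂ) ^ (a - 1) * Complex.exp (-(r * t))‖ =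
        (1 / r) ^ a.re * Real.Gamma a.re := by
  have e : ∀ t ∈ Ioi (0 : ℝ), ‖(t : ℂ) ^ (a - 1) * Complex.exp (-(r * t))‖ =
      t ^ (a.re - 1) * Real.exp (-(r * t)) := by
    intro t ht
    rw [norm_mul, Complex.norm_cpow_eq_rpow_re_of_pos ht, ← Complex.ofReal_mul,
      ← Complex.ofReal_neg, Complex.norm_exp_ofReal]
    simp
  have h1 := Real.integral_rpow_mul_exp_neg_mul_Ioi ha hr
  have h2 : 0 < (1 / r) ^ a.re * Real.Gamma a.re := mul_pos (by positivity) (Real.Gamma_pos_of_pos ha)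
  have h3 : IntegrableOn (fun t : ℝ => t ^ (a.re - 1) * Real.exp (-(r * t))) (Ioi 0) := by
    by_contra hne
    rw [integral_undef hne] at h1
    exact h2.ne h1
  refine ⟨?_, ?_⟩
  · refine Integrable.mono' h3 (Measurable.aestronglyMeasurable (by fun_prop)) ?_
    rw [ae_restrict_iff' measurableSet_Ioi]
    exact Eventually.of_forall fun t ht => (e t ht).le
  · rw [← h1]
    exact setIntegral_congr_fun measurableSet_Ioi e

/-- The evolution of `P(x)|x|^{-p-k}` at time one is bounded by duality. -/
theorem pairing_homogeneous_le {n k : ℕ} (hn : 1 ≤ n) {p : ℂ} {r r' : ℝ}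
    (hr : r.HolderConjugate r') (hp1 : n / r < p.re) (hp2 : p.re < n / r')
    {P : MvPolynomial (Fin n) ℂ} (hP : P.IsHomogeneous k) (hPh : IsHarmonicPoly P) :
    ∃ C : ℝ, 0 ≤ C ∧ ∀ ψ : 𝓢(Rn n, ℂ),
      ‖∫ x, polyFun P x * (‖x‖ : ℂ) ^ (-p - (k : ℂ)) * propagator n 1 ψ x‖ ≤
        C * (∫ x, ‖ψ x‖ ^ r') ^ (1 / r') := by
  have hr1 : 1 < r := hr.lt
  have hr0 : 0 < r := hr.pos
  have hr'0 : 0 < r' := hr.symm.pos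
  have hn0 : (0 : ℝ) < n := by exact_mod_cast hn
  have hσ0 : 0 < p.re := lt_trans (by positivity) hp1
  have hrr : n / r' = n - n / r := by
    have := hr.inv_add_inv_eq_one
    have h1 : r'⁻¹ = 1 - r⁻¹ := by linarith
    rw [div_eq_mul_inv, h1]; ring
  have hσn : p.re < n := by
    have : 0 < n / r := by positivity
    linarith
  -- Subordination: `∫₀^∞ y^{a-1} e^{-y|x|²} dy = Γ(a) |x|^{-2a}`, with `2a = p + k`.
  let a : ℂ := (p + k) / 2
  have hare : a.re = (p.re + k) / 2 := by simp [a]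
  have ha : 0 < a.re := by rw [hare]; positivity
  let I1 := ∫ x : Rn n, (‖polyFun P x‖ * Real.exp (-1 * ‖x‖ ^ 2)) ^ r
  -- Exponents of the remaining integral in `y`: `e₁ > 0` is `Re p > n/r`, for convergence at zero,
  -- and `e₁ < 2e₂` is `Re p < n - n/r = n/r'`, for convergence at infinity.
  let e₁ := (p.re - n / r) / 2
  let e₂ := (n / 2 - n / r) / 2
  let W : ℝ → ℝ := fun y => y ^ (e₁ - 1) * (1 + 16 * y ^ 2) ^ (-e₂)
  have hW : IntegrableOn W (Ioi 0) := integrableOn_rpow_mul_one_add_rpow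
    (by simp only [e₁]; linarith) (by simp only [e₁, e₂]; linarith)
  have hW0 : 0 ≤ ∫ y in Ioi (0 : ℝ), W y :=
    setIntegral_nonneg measurableSet_Ioi fun y hy => by
      have : (0 : ℝ) < y := hy
      positivity
  have hI1 : 0 ≤ I1 := integral_nonneg fun x => by positivity
  have hΓ : Complex.Gamma a ≠ 0 := Complex.Gamma_ne_zero_of_re_pos ha
  refine ⟨‖Complex.Gamma a‖⁻¹ * ((∫ y in Ioi (0 : ℝ), W y) * I1 ^ (1 / r)), by positivity, fun ψ => ?_⟩
  set χ := propagator n 1 ψ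
  let F : Rn n → ℝ → ℂ := fun x y =>
    polyFun P x * χ x * ((y : ℂ) ^ (a - 1) * Complex.exp (-((‖x‖ ^ 2 : ℝ) * y)))
  have hx2 : ∀ x : Rn n, x ≠ 0 → 0 < ‖x‖ ^ 2 := fun x hx => by
    have := norm_pos_iff.2 hx; positivity
  have hpow : ∀ x : Rn n, x ≠ 0 → (1 / ((‖x‖ ^ 2 : ℝ) : ℂ)) ^ a = (‖x‖ : ℂ) ^ (-p - (k : ℂ)) := by
    intro x hx
    have hx0 : 0 < ‖x‖ := norm_pos_iff.2 hx
    rw [one_div, Complex.inv_cpow _ _ (by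
      rw [Complex.arg_ofReal_of_nonneg (sq_nonneg _)]; exact Real.pi_pos.ne), ← Complex.cpow_neg,
      Complex.ofReal_pow, ← Complex.cpow_ofNat, ← Complex.cpow_mul]
    · congr 1; simp only [a]; ring
    all_goals
      rw [← Complex.ofReal_log hx0.le, Complex.im_ofReal_mul]
      simp [Real.pi_pos, Real.pi_pos.le]
  have hFm : AEStronglyMeasurable (Function.uncurry F) (volume.prod (volume.restrict (Ioi 0))) := by
    have h1 := (continuous_polyFun P).measurable
    have h2 := χ.continuous.measurable
    refine Measurable.aestronglyMeasurable ?_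
    unfold Function.uncurry
    fun_prop
  obtain ⟨CP, hCP, hCPx⟩ := exists_norm_polyFun_le_pow hP
  -- Integrating the modulus in `y` first leaves `|P| |x|^{-Re p - k} |χ|`, at most a multiple of
  -- `|x|^{-Re p} |χ|`, which is integrable because `Re p < n` and `χ` is Schwartz.
  have hFi : Integrable (Function.uncurry F) (volume.prod (volume.restrict (Ioi 0))) := by
    rw [integrable_prod_iff hFm]
    constructor
    · filter_upwards [ae_ne_zero hn] with x hx
      exact (integrableOn_cpow_mul_exp ha (hx2 x hx)).1.const_mul (polyFun P x * χ x)
    · refine ((integrable_rpow_norm_mul_schwartz hn hσ0.le hσn χ).const_mul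
        (CP * Real.Gamma a.re)).mono' hFm.norm.integral_prod_right' ?_
      filter_upwards [ae_ne_zero hn] with x hx
      have hx0 : 0 < ‖x‖ := norm_pos_iff.2 hx
      have e1 : ∫ y in Ioi (0 : ℝ), ‖Function.uncurry F (x, y)‖ =
          ‖polyFun P x * χ x‖ * ((1 / ‖x‖ ^ 2) ^ a.re * Real.Gamma a.re) := by
        rw [← (integrableOn_cpow_mul_exp ha (hx2 x hx)).2, ← integral_const_mul]
        congr 1
        ext y
        simp only [Function.uncurry, F, norm_mul]
      rw [e1, Real.norm_of_nonneg (mul_nonneg (norm_nonneg _)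
        (mul_nonneg (by positivity) (Real.Gamma_pos_of_pos ha).le)), norm_mul]
      have e2 : (1 / ‖x‖ ^ 2) ^ a.re = ‖x‖ ^ (-p.re - k) := by
        rw [one_div, Real.inv_rpow (by positivity), ← Real.rpow_neg (by positivity),
          ← Real.rpow_natCast, ← Real.rpow_mul hx0.le, hare]
        congr 1; push_cast; ring
      have hΓ' := (Real.Gamma_pos_of_pos ha).le
      rw [e2]
      calc ‖polyFun P x‖ * ‖χ x‖ * (‖x‖ ^ (-p.re - k) * Real.Gamma a.re)
          ≤ (CP * ‖x‖ ^ k) * ‖χ x‖ * (‖x‖ ^ (-p.re - k) * Real.Gamma a.re) := by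
            gcongr; exact hCPx x
        _ = CP * Real.Gamma a.re * ((‖x‖ ^ k * ‖x‖ ^ (-p.re - k)) * ‖χ x‖) := by ring
        _ = _ := by
            rw [← Real.rpow_natCast, ← Real.rpow_add hx0]
            congr 3; ring
  have hswap := integral_integral_swap hFi
  have hleft : ∫ x, ∫ y in Ioi (0 : ℝ), F x y = Complex.Gamma a *
      ∫ x, polyFun P x * (‖x‖ : ℂ) ^ (-p - (k : ℂ)) * χ x := by
    rw [← integral_const_mul]
    refine integral_congr_ae ?_
    filter_upwards [ae_ne_zero hn] with x hx
    simp only [F]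
    rw [integral_const_mul, Complex.integral_cpow_mul_exp_neg_mul_Ioi ha (hx2 x hx), hpow x hx]
    ring
  have hright : ∀ y ∈ Ioi (0 : ℝ), ‖∫ x, F x y‖ ≤
      W y * (I1 ^ (1 / r) * (∫ x, ‖ψ x‖ ^ r') ^ (1 / r')) := by
    intro y hy
    have hy0 : (0 : ℝ) < y := hy
    have e1 : ∫ x, F x y = (y : ℂ) ^ (a - 1) *
        ∫ x, polyFun P x * Complex.exp (-y * ‖x‖ ^ 2) * χ x := by
      rw [← integral_const_mul]
      congr 1
      ext x
      simp only [F]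
      have : -(((‖x‖ ^ 2 : ℝ) : ℂ) * y) = -y * ‖x‖ ^ 2 := by push_cast; ring
      rw [this]; ring
    have ha1 : (a - 1).re = (p.re + k) / 2 - 1 := by rw [Complex.sub_re, hare]; simp
    rw [e1, norm_mul, Complex.norm_cpow_eq_rpow_re_of_pos hy0, ha1]
    have h2 := integral_polyFun_gaussian_mul_propagator hP hPh hy0 ψ
    set d := y / (1 + 16 * y ^ 2)
    have hd : 0 < d := by positivity
    have hm1 : MemLp (fun x : Rn n => ‖polyFun P x‖ * Real.exp (-d * ‖x‖ ^ 2)) (ENNReal.ofReal r)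
        volume := by
      have hc := continuous_polyFun P
      rw [← integrable_norm_rpow_iff (Continuous.aestronglyMeasurable (by fun_prop))
        (by simpa using hr0) ENNReal.ofReal_ne_top, ENNReal.toReal_ofReal hr0.le]
      refine (integrable_rpow_polyFun_mul_gaussian P hd hr0).congr (Eventually.of_forall fun x => ?_)
      simp only
      rw [Real.norm_of_nonneg (by positivity)]
    have hm2 : MemLp (fun x : Rn n => ‖ψ (-x)‖) (ENNReal.ofReal r') volume :=
      ((ψ.memLp (ENNReal.ofReal r') volume).comp_measurePreserving
        (Measure.measurePreserving_neg volume)).norm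
    have h3 := integral_mul_le_Lp_mul_Lq_of_nonneg hr
      (Eventually.of_forall fun x => by positivity) (Eventually.of_forall fun x => norm_nonneg _)
      hm1 hm2
    rw [integral_rpow_polyFun_mul_gaussian hP hd,
      integral_neg_eq_self (fun x => ‖ψ x‖ ^ r') volume,
      Real.mul_rpow (by positivity) hI1, ← Real.rpow_mul hd.le] at h3
    -- The degree `k` cancels: the power from subordination, the decay of the amplitude and the
    -- scaling of the Gaussian's `L^r` norm combine into a weight independent of `k`.
    have e3 : y ^ ((p.re + k) / 2 - 1) * ((1 + 16 * y ^ 2) ^ (-((n : ℝ) / 2 + k) / 2) *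
        d ^ (-((k * r + n) / 2) * (1 / r))) = W y := by
      simp only [W, d]
      have hQ : (0 : ℝ) < 1 + 16 * y ^ 2 := by positivity
      have hE : -((k * r + n) / 2) * (1 / r) = -((k + n / r) / 2) := by
        field_simp
      rw [hE, Real.div_rpow hy0.le hQ.le]
      calc _ = (y ^ ((p.re + k) / 2 - 1) * y ^ (-((k + n / r) / 2))) *
            ((1 + 16 * y ^ 2) ^ (-((n : ℝ) / 2 + k) / 2) *
              (1 + 16 * y ^ 2) ^ (- -((k + n / r) / 2))) := by
            rw [Real.rpow_neg hQ.le (-((k + n / r) / 2))]; ring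
        _ = _ := by
          rw [← Real.rpow_add hy0, ← Real.rpow_add hQ]
          congr 2
          · simp only [e₁]; ring
          · simp only [e₂]; ring
    calc _ ≤ y ^ ((p.re + k) / 2 - 1) * ((1 + 16 * y ^ 2) ^ (-((n : ℝ) / 2 + k) / 2) *
          (d ^ (-((k * r + n) / 2) * (1 / r)) * I1 ^ (1 / r) * (∫ x, ‖ψ x‖ ^ r') ^ (1 / r'))) := by
          refine mul_le_mul_of_nonneg_left (h2.trans ?_) (by positivity)
          exact mul_le_mul_of_nonneg_left h3 (by positivity)
      _ = _ := by rw [← e3]; ring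
  have hfin : ‖∫ y in Ioi (0 : ℝ), ∫ x, F x y‖ ≤
      (∫ y in Ioi (0 : ℝ), W y) * (I1 ^ (1 / r) * (∫ x, ‖ψ x‖ ^ r') ^ (1 / r')) := by
    rw [← integral_mul_const]
    refine norm_integral_le_of_norm_le (hW.mul_const _) ?_
    rw [ae_restrict_iff' measurableSet_Ioi]
    exact Eventually.of_forall hright
  rw [← hswap, hleft, norm_mul] at hfin
  have hΓn : 0 < ‖Complex.Gamma a‖ := norm_pos_iff.2 hΓ
  rw [mul_assoc, inv_mul_eq_div, le_div_iff₀ hΓn, mul_comm]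
  refine hfin.trans (le_of_eq (by ring))

/-- Each property is stable under linear combinations, so only the generators need an argument. The
dual bound is purely qualitative: its constant may depend on `φ`. -/
theorem bounds_of_mem_homogeneousData {n : ℕ} (hn : 1 ≤ n) {p : ℂ} {r r' : ℝ}
    (hr : r.HolderConjugate r') (hp1 : n / r < p.re) (hp2 : p.re < n / r') {φ : Rn n → ℂ}
    (hφ : φ ∈ homogeneousData n p) :
    (AEStronglyMeasurable φ volume ∧ ∃ C : ℝ, 0 ≤ C ∧ ∀ x, ‖φ x‖ ≤ C * ‖x‖ ^ (-p.re)) ∧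
      (∀ c : ℝ, 0 < c → ∀ x, φ (c • x) = (c : ℂ) ^ (-p) * φ x) ∧
      IsTemperedFun φ ∧
      ∃ C : ℝ, 0 ≤ C ∧ ∀ ψ : 𝓢(Rn n, ℂ),
        ‖∫ x, propagator n 1 ψ x * φ x‖ ≤ C * (∫ x, ‖ψ x‖ ^ r') ^ (1 / r') := by
  have hn0 : (0 : ℝ) < n := by exact_mod_cast hn
  have hσ0 : 0 < p.re := lt_trans (div_pos hn0 hr.pos) hp1
  have hσn : p.re < n := hp2.trans_le (div_le_self hn0.le hr.symm.lt.le)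
  induction hφ using Submodule.span_induction with
  | mem φ h =>
    obtain ⟨k, P, hP, hPh, rfl⟩ := h
    have hm := aestronglyMeasurable_homogeneous (k := k) P p
    obtain ⟨C, hC, hCx⟩ := norm_homogeneous_le hP hσ0
    refine ⟨⟨hm, C, hC, hCx⟩, fun c hc x => homogeneous_smul hP p hc x,
      isTemperedFun_of_norm_le_rpow hn hσ0.le hσn hC hm hCx, ?_⟩
    obtain ⟨D, hD, hDx⟩ := pairing_homogeneous_le hn hr hp1 hp2 hP hPh
    refine ⟨D, hD, fun ψ => ?_⟩
    simp_rw [mul_comm (propagator n 1 ψ _)]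
    exact hDx ψ
  | zero =>
    refine ⟨⟨aestronglyMeasurable_const, 0, le_rfl, by simp⟩, by simp, ?_, 0, le_rfl, by simp⟩
    exact isTemperedFun_of_norm_le_rpow hn hσ0.le hσn le_rfl aestronglyMeasurable_const (by simp)
  | add f g _ _ hf hg =>
    obtain ⟨⟨hf1, C, hC, hf2⟩, hf3, hf4, D, hD, hf5⟩ := hf
    obtain ⟨⟨hg1, C', hC', hg2⟩, hg3, hg4, D', hD', hg5⟩ := hg
    refine ⟨⟨hf1.add hg1, C + C', by positivity, fun x => ?_⟩, fun c hc x => ?_,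
      isTemperedFun_add hf4 hg4, D + D', by positivity, fun ψ => ?_⟩
    · rw [add_mul]
      exact (norm_add_le _ _).trans (add_le_add (hf2 x) (hg2 x))
    · simp only [Pi.add_apply, hf3 c hc, hg3 c hc, mul_add]
    · simp only [Pi.add_apply, mul_add]
      rw [integral_add (hf4.represents.2 _) (hg4.represents.2 _), add_mul]
      exact (norm_add_le _ _).trans (add_le_add (hf5 ψ) (hg5 ψ))
  | smul a f _ hf =>
    obtain ⟨⟨hf1, C, hC, hf2⟩, hf3, hf4, D, hD, hf5⟩ := hf
    have h1 : AEStronglyMeasurable (a • f) volume := hf1.const_smul a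
    have h2 : ∀ x, ‖(a • f) x‖ ≤ ‖a‖ * C * ‖x‖ ^ (-p.re) := fun x => by
      rw [Pi.smul_apply, norm_smul, mul_assoc]
      exact mul_le_mul_of_nonneg_left (hf2 x) (norm_nonneg _)
    refine ⟨⟨h1, ‖a‖ * C, by positivity, h2⟩, fun c hc x => ?_,
      isTemperedFun_of_norm_le_rpow hn hσ0.le hσn (by positivity) h1 h2, ‖a‖ * D, by positivity,
      fun ψ => ?_⟩
    · simp only [Pi.smul_apply, hf3 c hc, smul_eq_mul]; ring
    · simp only [Pi.smul_apply, smul_eq_mul, mul_left_comm _ a]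
      rw [integral_const_mul, norm_mul, mul_assoc]
      exact mul_le_mul_of_nonneg_left (hf5 ψ) (norm_nonneg _)

/-! ### Functionals bounded in `L^{r'}` as functions in `L^r`. -/

theorem integrable_norm_rpow_schwartz {n : ℕ} (ψ : 𝓢(Rn n, ℂ)) {p : ℝ} (hp : 0 < p) :
    Integrable fun x => ‖ψ x‖ ^ p := by
  have := (ψ.memLp (ENNReal.ofReal p) volume).integrable_norm_rpow (by simpa using hp)
    ENNReal.ofReal_ne_top
  rwa [ENNReal.toReal_ofReal hp.le] at this

/-- After division by the sum `N` of the two norms, this is `t^p ≤ t + t²` for `1 ≤ p ≤ 2`. It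
brings functionals bounded in `L^{r'}` within reach of `exists_function_of_bound`. -/
theorem rpow_integral_norm_rpow_le {n : ℕ} (ψ : 𝓢(Rn n, ℂ)) {p : ℝ} (hp1 : 1 ≤ p) (hp2 : p ≤ 2) :
    (∫ x, ‖ψ x‖ ^ p) ^ (1 / p) ≤
      2 * ((∫ x, ‖ψ x‖) + (∫ x, ‖ψ x‖ ^ (2 : ℝ)) ^ (1 / (2 : ℝ))) := by
  have hp0 : 0 < p := by linarith
  set N1 := ∫ x, ‖ψ x‖
  set N2 := ∫ x, ‖ψ x‖ ^ (2 : ℝ)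
  have hN1 : 0 ≤ N1 := integral_nonneg fun x => norm_nonneg _
  have hN2 : 0 ≤ N2 := integral_nonneg fun x => by positivity
  set N := N1 + N2 ^ (1 / (2 : ℝ))
  have hN : 0 ≤ N := by positivity
  rcases hN.eq_or_lt with h0 | h0
  · have h1 : N1 = 0 := le_antisymm (by
      rw [h0]; exact le_add_of_nonneg_right (by positivity)) hN1
    have h2 : ψ = 0 := by
      have := (integral_eq_zero_iff_of_nonneg (fun x => norm_nonneg _) ψ.integrable.norm).1 h1
      have h3 := (Continuous.ae_eq_iff_eq volume ψ.continuous.norm continuous_const).1 this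
      ext x
      exact norm_eq_zero.1 (congrFun h3 x)
    rw [h2]
    simp only [zero_apply, norm_zero, Real.zero_rpow hp0.ne', integral_zero]
    rw [Real.zero_rpow (by positivity)]
    positivity
  · have h1 : ∫ x, ‖ψ x‖ ^ p ≤ N ^ p * (N1 / N + N2 / N ^ (2 : ℝ)) := by
      rw [mul_add, ← integral_div, ← integral_div, ← integral_const_mul, ← integral_const_mul,
        ← integral_add]
      · refine integral_mono (integrable_norm_rpow_schwartz ψ hp0) ?_ fun x => ?_
        · exact ((ψ.integrable.norm.div_const N).const_mul _).add
            (((integrable_norm_rpow_schwartz ψ two_pos).div_const _).const_mul _)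
        · have h3 : (‖ψ x‖ / N) ^ p ≤ ‖ψ x‖ / N + (‖ψ x‖ / N) ^ (2 : ℝ) := by
            have hx : 0 ≤ ‖ψ x‖ / N := by positivity
            rcases le_total (‖ψ x‖ / N) 1 with h | h
            · have := Real.rpow_le_rpow_of_exponent_ge' hx h zero_le_one hp1
              rw [Real.rpow_one] at this
              exact this.trans (le_add_of_nonneg_right (by positivity))
            · exact (Real.rpow_le_rpow_of_exponent_le h hp2).trans (le_add_of_nonneg_left hx)
          rw [Real.div_rpow (norm_nonneg _) hN, Real.div_rpow (norm_nonneg _) hN,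
            div_le_iff₀ (by positivity)] at h3
          simp only
          linarith
      · exact (ψ.integrable.norm.div_const N).const_mul _
      · exact ((integrable_norm_rpow_schwartz ψ two_pos).div_const _).const_mul _
    have h2 : N1 / N + N2 / N ^ (2 : ℝ) ≤ 2 := by
      have h3 : N1 / N ≤ 1 := (div_le_one h0).2 (le_add_of_nonneg_right (by positivity))
      have h4 : N2 / N ^ (2 : ℝ) ≤ 1 := by
        rw [div_le_one (by positivity)]
        calc N2 = (N2 ^ (1 / (2 : ℝ))) ^ (2 : ℝ) := by
              rw [← Real.rpow_mul hN2]; norm_num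
          _ ≤ _ := Real.rpow_le_rpow (by positivity) (le_add_of_nonneg_left hN1) (by norm_num)
      linarith
    calc _ ≤ (N ^ p * 2) ^ (1 / p) :=
          Real.rpow_le_rpow (integral_nonneg fun x => by positivity)
            (h1.trans (mul_le_mul_of_nonneg_left h2 (by positivity))) (by positivity)
      _ = N * 2 ^ (1 / p) := by
          rw [Real.mul_rpow (by positivity) (by norm_num), ← Real.rpow_mul hN,
            mul_one_div_cancel hp0.ne', Real.rpow_one]
      _ ≤ N * 2 := by
          refine mul_le_mul_of_nonneg_left ?_ hN
          have := Real.rpow_le_rpow_of_exponent_le one_le_two ((div_le_one hp0).2 hp1)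
          rwa [Real.rpow_one] at this
      _ = _ := mul_comm _ _

/-- A functional bounded by the `L^{r'}` norm, `2 < r`, is given by a function in `L^r`. -/
theorem exists_memLp_of_pairing {n : ℕ} {r r' B : ℝ} (hr : r.HolderConjugate r') (hr2 : 2 ≤ r)
    (Λ : 𝓢(Rn n, ℂ) →ₗ[ℂ] ℂ) (hB : 0 ≤ B)
    (h : ∀ ψ, ‖Λ ψ‖ ≤ B * (∫ x, ‖ψ x‖ ^ r') ^ (1 / r')) :
    ∃ w : Rn n → ℂ, MemLp w (ENNReal.ofReal r) volume ∧
      eLpNorm w (ENNReal.ofReal r) volume ≤ ENNReal.ofReal B ∧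
      (∀ φ : 𝓢(Rn n, ℂ), Integrable fun x => φ x * w x) ∧
      ∀ φ : 𝓢(Rn n, ℂ), Λ φ = ∫ x, φ x * w x := by
  have hr'2 : r' ≤ 2 := by
    have h1 := hr.inv_add_inv_eq_one
    have h2 : r⁻¹ ≤ 2⁻¹ := inv_anti₀ two_pos hr2
    have h3 : (2 : ℝ)⁻¹ ≤ r'⁻¹ := by linarith
    exact (inv_le_inv₀ two_pos hr.symm.pos).1 h3
  obtain ⟨w, hw1, hw2, hw3⟩ := exists_function_of_bound Λ (B := B * 2) (by positivity) fun ψ =>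
    (h ψ).trans (by
      rw [mul_assoc]
      exact mul_le_mul_of_nonneg_left (rpow_integral_norm_rpow_le ψ hr.symm.lt.le hr'2) hB)
  have hb := eLpNorm_le_of_pairing hw1 hB hr fun φ => by rw [← hw3]; exact h φ
  exact ⟨w, ⟨hw1.aestronglyMeasurable, hb.trans_lt ENNReal.ofReal_lt_top⟩, hb, hw2, hw3⟩

/-! ### Self-similar functions and the linear evolution. -/

theorem integral_propagator_mul_comp_smul {n : ℕ} (s : ℝ) {c : ℝ} (hc : 0 < c) (ψ : 𝓢(Rn n, ℂ))
    (f : Rn n → ℂ) : ∫ x, propagator n (c ^ 2 * s) ψ x * f (c⁻¹ • x) =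
      ((c ^ n : ℝ) : ℂ) * ∫ x, propagator n s (dilate c hc.ne' ψ) x * f x := by
  have h1 := integral_comp_smul_eq (fun x => propagator n (c ^ 2 * s) ψ x * f (c⁻¹ • x)) hc
  simp only [smul_smul, inv_mul_cancel₀ hc.ne', one_smul, ← propagator_dilate hc] at h1
  rw [h1, Complex.real_smul, ← mul_assoc, ← Complex.ofReal_mul, mul_inv_cancel₀ (by positivity)]
  simp

theorem integral_mul_comp_smul {n : ℕ} {c : ℝ} (hc : 0 < c) (ψ : 𝓢(Rn n, ℂ))
    (f : Rn n → ℂ) : ∫ x, ψ x * f (c⁻¹ • x) =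
      ((c ^ n : ℝ) : ℂ) * ∫ x, dilate c hc.ne' ψ x * f x := by
  have h1 := integral_comp_smul_eq (fun x => ψ x * f (c⁻¹ • x)) hc
  simp only [smul_smul, inv_mul_cancel₀ hc.ne', one_smul] at h1
  simp only [dilate_apply]
  rw [h1, Complex.real_smul, ← mul_assoc, ← Complex.ofReal_mul, mul_inv_cancel₀ (by positivity)]
  simp

/-- The self-similar function of space-time with profile `U`. -/
noncomputable def selfSimilarFun {n : ℕ} (p : ℂ) (U : Rn n → ℂ) (t : ℝ) (x : Rn n) : ℂ :=
  ((√t : ℝ) : ℂ) ^ (-p) * U ((√t)⁻¹ • x)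

theorem aestronglyMeasurable_selfSimilarFun {n : ℕ} (p : ℂ) {U : Rn n → ℂ}
    (hU : AEStronglyMeasurable U volume) {t : ℝ} (ht : 0 < t) :
    AEStronglyMeasurable (selfSimilarFun p U t) volume :=
  (hU.comp_quasiMeasurePreserving (quasiMeasurePreserving_smul (by positivity))).const_mul _

theorem eLpNorm_selfSimilarFun {n : ℕ} (p : ℂ) {U : Rn n → ℂ} {r : ℝ} (hr : 0 < r)
    (hU : AEStronglyMeasurable U volume) {t : ℝ} (ht : 0 < t) :
    eLpNorm (selfSimilarFun p U t) (ENNReal.ofReal r) volume =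
      ENNReal.ofReal (t ^ (-(p.re / 2 - n / (2 * r)))) * eLpNorm U (ENNReal.ofReal r) volume := by
  have hs : 0 < √t := Real.sqrt_pos.2 ht
  have h1 := eLpNorm_const_smul (((√t : ℝ) : ℂ) ^ (-p)) (fun x => U ((√t)⁻¹ • x))
    (ENNReal.ofReal r) volume
  rw [eLpNorm_comp_smul (inv_pos.2 hs) hr hU, ← ofReal_norm,
    Complex.norm_cpow_eq_rpow_re_of_pos hs, ← mul_assoc,
    ← ENNReal.ofReal_mul (by positivity)] at h1
  refine Eq.trans ?_ (h1.trans ?_)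
  · rfl
  · congr 2
    rw [Real.inv_rpow hs.le, ← Real.rpow_neg hs.le, ← Real.rpow_add hs, Real.sqrt_eq_rpow,
      ← Real.rpow_mul ht.le]
    congr 1
    simp only [Complex.neg_re]
    field_simp
    ring

theorem selfSimilarFun_smul {n : ℕ} (p : ℂ) (U : Rn n → ℂ) {l t : ℝ} (hl : 0 < l) (ht : 0 < t)
    (x : Rn n) : selfSimilarFun p U t x =
      (l : ℂ) ^ p * selfSimilarFun p U (l ^ 2 * t) (l • x) := by
  have hl0 : (l : ℂ) ≠ 0 := by exact_mod_cast hl.ne'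
  have hs : √(l ^ 2 * t) = l * √t := by
    rw [Real.sqrt_mul (sq_nonneg l), Real.sqrt_sq hl.le]
  have hs0 : √t ≠ 0 := (Real.sqrt_pos.2 ht).ne'
  simp only [selfSimilarFun, hs]
  rw [Complex.ofReal_mul, Complex.mul_cpow_ofReal_nonneg hl.le (Real.sqrt_nonneg t), ← mul_assoc,
    ← mul_assoc, ← Complex.cpow_add _ _ hl0, add_neg_cancel, Complex.cpow_zero, one_mul, smul_smul]
  congr 2
  rw [mul_inv, mul_assoc, mul_comm _ l, ← mul_assoc, inv_mul_cancel₀ hl.ne', one_mul]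

theorem integrable_mul_selfSimilarFun {n : ℕ} (p : ℂ) {U : Rn n → ℂ} {t : ℝ} (ht : 0 < t)
    (hU : ∀ ψ : 𝓢(Rn n, ℂ), Integrable fun x => ψ x * U x) (ψ : 𝓢(Rn n, ℂ)) :
    Integrable fun x => ψ x * selfSimilarFun p U t x := by
  have hs : √t ≠ 0 := (Real.sqrt_pos.2 ht).ne'
  have h1 := (hU (dilate (√t) hs ψ)).comp_smul (inv_ne_zero hs)
  refine (h1.const_mul (((√t : ℝ) : ℂ) ^ (-p))).congr (Eventually.of_forall fun x => ?_)
  simp only [dilate_apply, selfSimilarFun, smul_smul, mul_inv_cancel₀ hs, one_smul]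
  ring

theorem integral_mul_selfSimilarFun {n : ℕ} (p : ℂ) (U : Rn n → ℂ) {t : ℝ} (ht : 0 < t)
    (ψ : 𝓢(Rn n, ℂ)) : ∫ x, ψ x * selfSimilarFun p U t x =
      ((√t : ℝ) : ℂ) ^ (-p) * ((√t ^ n : ℝ) : ℂ) *
        ∫ x, dilate (√t) (Real.sqrt_pos.2 ht).ne' ψ x * U x := by
  rw [mul_assoc, ← integral_mul_comp_smul (Real.sqrt_pos.2 ht), ← integral_const_mul]
  congr 1
  ext x
  simp only [selfSimilarFun]
  ring

/-- The flow at time `t` is conjugate to the flow at time one by the dilation by `√t`; the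
homogeneity of `φ` supplies the factor `(√t)^{-p}`. -/
theorem represents_selfSimilarFun {n : ℕ} {p : ℂ} {φ g : Rn n → ℂ} (hφ : IsTemperedFun φ)
    (hhom : ∀ c : ℝ, 0 < c → ∀ x, φ (c • x) = (c : ℂ) ^ (-p) * φ x)
    (hg : Represents g (schrodingerGroup n 1 (toDistribution φ))) {t : ℝ} (ht : 0 < t) :
    Represents (selfSimilarFun p g t) (schrodingerGroup n t (toDistribution φ)) := by
  have hs : 0 < √t := Real.sqrt_pos.2 ht
  refine ⟨aestronglyMeasurable_selfSimilarFun p hg.1 ht,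
    integrable_mul_selfSimilarFun p ht hg.2, fun ψ => ?_⟩
  rw [integral_mul_selfSimilarFun p g ht, ← hg.3, schrodingerGroup_apply, schrodingerGroup_apply,
    toDistribution_apply hφ, toDistribution_apply hφ, mul_assoc,
    ← integral_propagator_mul_comp_smul 1 hs, Real.sq_sqrt ht.le, mul_one, ← integral_const_mul]
  congr 1
  ext x
  have h1 := hhom _ hs ((√t)⁻¹ • x)
  rw [smul_smul, mul_inv_cancel₀ hs.ne', one_smul] at h1
  rw [h1]; ring

/-- The dual bound at time one produces a profile in `L^r`, and scaling produces all other times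
from it. -/
theorem exists_linear_evolution {n : ℕ} (hn : 1 ≤ n) {p : ℂ} {r r' : ℝ}
    (hr : r.HolderConjugate r') (hr2 : 2 ≤ r) (hp1 : n / r < p.re) (hp2 : p.re < n / r')
    {φ : Rn n → ℂ} (hφ : φ ∈ homogeneousData n p) :
    AEStronglyMeasurable φ volume ∧ IsTemperedFun φ ∧
      (∀ c : ℝ, 0 < c → ∀ x, φ (c • x) = (c : ℂ) ^ (-p) * φ x) ∧
      ∃ g : Rn n → ℂ, MemLp g (ENNReal.ofReal r) volume ∧ ∀ t : ℝ, 0 < t →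
        Represents (selfSimilarFun p g t) (schrodingerGroup n t (toDistribution φ)) := by
  obtain ⟨⟨h1, -⟩, h2, h3, C, hC, h4⟩ :=
    bounds_of_mem_homogeneousData hn hr hp1 hp2 hφ
  refine ⟨h1, h3, h2, ?_⟩
  obtain ⟨g, hg1, -, hg2, hg3⟩ := exists_memLp_of_pairing hr hr2
    (schrodingerGroup n 1 (toDistribution φ)).toLinearMap hC fun ψ => by
      have := h4 ψ
      rw [← toDistribution_apply h3] at this
      exact this
  exact ⟨g, hg1, fun t ht => represents_selfSimilarFun h3 h2 ⟨hg1.1, hg2, hg3⟩ ht⟩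

/-! ### Dispersive estimates in dual form -/

theorem integrable_of_lintegral_enorm_le {n : ℕ} {f : Rn n → ℂ} {I : ℝ}
    (hf : AEStronglyMeasurable f volume) (h : ∫⁻ x, ‖f x‖ₑ ≤ ENNReal.ofReal I) : Integrable f :=
  ⟨hf, h.trans_lt ENNReal.ofReal_lt_top⟩

theorem integral_norm_le_of_lintegral_enorm_le {n : ℕ} {f : Rn n → ℂ} {I : ℝ} (hI : 0 ≤ I)
    (hf : AEStronglyMeasurable f volume) (h : ∫⁻ x, ‖f x‖ₑ ≤ ENNReal.ofReal I) :
    ∫ x, ‖f x‖ ≤ I := by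
  rw [integral_norm_eq_lintegral_enorm hf]
  exact ENNReal.toReal_le_of_le_ofReal hI h

theorem norm_integral_propagator_mul_le_of_L1 {n : ℕ} {f : Rn n → ℂ} {I : ℝ} (hI : 0 ≤ I)
    (hf : AEStronglyMeasurable f volume) (h : ∫⁻ x, ‖f x‖ₑ ≤ ENNReal.ofReal I) {σ : ℝ}
    (hσ : 0 < σ) (ψ : 𝓢(Rn n, ℂ)) :
    ‖∫ x, propagator n σ ψ x * f x‖ ≤ (4 * Real.pi * σ) ^ (-((n : ℝ) / 2)) * I * ∫ x, ‖ψ x‖ := by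
  have hψ : 0 ≤ ∫ x, ‖ψ x‖ := integral_nonneg fun x => norm_nonneg _
  have hD : 0 ≤ (4 * Real.pi * σ) ^ (-((n : ℝ) / 2)) := by positivity
  calc _ ≤ ∫ x, ((4 * Real.pi * σ) ^ (-((n : ℝ) / 2)) * ∫ x, ‖ψ x‖) * ‖f x‖ := by
        refine norm_integral_le_of_norm_le
          ((integrable_of_lintegral_enorm_le hf h).norm.const_mul _)
          (Eventually.of_forall fun x => ?_)
        rw [norm_mul]
        exact mul_le_mul_of_nonneg_right (norm_propagator_le hσ ψ x) (norm_nonneg _)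
    _ ≤ ((4 * Real.pi * σ) ^ (-((n : ℝ) / 2)) * ∫ x, ‖ψ x‖) * I := by
        rw [integral_const_mul]
        exact mul_le_mul_of_nonneg_left (integral_norm_le_of_lintegral_enorm_le hI hf h)
          (by positivity)
    _ = _ := by ring

theorem memLp_two_of_lintegral_le {n : ℕ} {f : Rn n → ℂ} {J : ℝ}
    (hf : AEStronglyMeasurable f volume)
    (h : ∫⁻ x, ‖f x‖ₑ ^ (2 : ℝ) ≤ ENNReal.ofReal (J ^ (2 : ℝ))) : MemLp f 2 volume := by
  refine ⟨hf, ?_⟩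
  rw [eLpNorm_lt_top_iff_lintegral_rpow_enorm_lt_top two_ne_zero ENNReal.ofNat_ne_top]
  exact (by simpa using h : _ ≤ _).trans_lt ENNReal.ofReal_lt_top

theorem norm_integral_propagator_mul_le_of_L2 {n : ℕ} {f : Rn n → ℂ} {J : ℝ} (hJ : 0 ≤ J)
    (hf : AEStronglyMeasurable f volume)
    (h : ∫⁻ x, ‖f x‖ₑ ^ (2 : ℝ) ≤ ENNReal.ofReal (J ^ (2 : ℝ))) (σ : ℝ) (ψ : 𝓢(Rn n, ℂ)) :
    ‖∫ x, propagator n σ ψ x * f x‖ ≤ J * (∫ x, ‖ψ x‖ ^ (2 : ℝ)) ^ (1 / (2 : ℝ)) := by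
  have hm := memLp_two_of_lintegral_le hf h
  have e2 : (2 : ℝ≥0∞) = ENNReal.ofReal 2 := by simp
  have h1 : ∫ x, ‖f x‖ ^ (2 : ℝ) ≤ J ^ (2 : ℝ) := by
    rw [integral_eq_lintegral_of_nonneg_ae (Eventually.of_forall fun x => by positivity)
      (hf.norm.aemeasurable.pow_const _).aestronglyMeasurable]
    refine ENNReal.toReal_le_of_le_ofReal (by positivity) (le_trans (le_of_eq ?_) h)
    refine lintegral_congr fun x => ?_
    rw [← ENNReal.ofReal_rpow_of_nonneg (norm_nonneg _) two_pos.le, ofReal_norm]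
  have h2 := integral_mul_norm_le_Lp_mul_Lq (μ := volume) (p := 2) (q := 2)
    (f := fun x => propagator n σ ψ x) (g := f) Real.HolderConjugate.two_two
    ((propagator n σ ψ).memLp _ volume) (e2 ▸ hm)
  have h3 : ∫ x, ‖propagator n σ ψ x‖ ^ (2 : ℝ) = ∫ x, ‖ψ x‖ ^ (2 : ℝ) := by
    simp only [Real.rpow_two]
    exact integral_norm_sq_propagator σ ψ
  rw [h3] at h2
  calc _ ≤ ∫ x, ‖propagator n σ ψ x‖ * ‖f x‖ := by
        refine (norm_integral_le_integral_norm _).trans (le_of_eq ?_)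
        simp only [norm_mul]
    _ ≤ _ := h2
    _ ≤ (∫ x, ‖ψ x‖ ^ (2 : ℝ)) ^ (1 / (2 : ℝ)) * J := by
        refine mul_le_mul_of_nonneg_left ?_ (by positivity)
        calc _ ≤ (J ^ (2 : ℝ)) ^ (1 / (2 : ℝ)) :=
              Real.rpow_le_rpow (integral_nonneg fun x => by positivity) h1 (by norm_num)
          _ = J := by rw [← Real.rpow_mul hJ]; norm_num
    _ = _ := mul_comm _ _

theorem lintegral_enorm_indicator {n : ℕ} (f : Rn n → ℂ) {A : Set (Rn n)} (hA : MeasurableSet A)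
    {p : ℝ} (hp : 0 < p) :
    ∫⁻ x, ‖A.indicator f x‖ₑ ^ p = ∫⁻ x in A, ‖f x‖ₑ ^ p := by
  rw [← lintegral_indicator hA]
  refine lintegral_congr fun x => ?_
  by_cases hx : x ∈ A <;> simp [hx, hp]

/-- `f` splits into an integrable part, on `A`, and a square integrable part, off `A`. -/
structure SplitBound {n : ℕ} (f : Rn n → ℂ) (A : Set (Rn n)) (I J : ℝ) : Prop where
  meas : AEStronglyMeasurable f volume
  meas_set : MeasurableSet A
  nonneg_left : 0 ≤ I
  nonneg_right : 0 ≤ J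
  left : ∫⁻ x in A, ‖f x‖ₑ ≤ ENNReal.ofReal I
  right : ∫⁻ x in Aᶜ, ‖f x‖ₑ ^ (2 : ℝ) ≤ ENNReal.ofReal (J ^ (2 : ℝ))

namespace SplitBound

variable {n : ℕ} {f : Rn n → ℂ} {A : Set (Rn n)} {I J : ℝ}

theorem left' (h : SplitBound f A I J) : ∫⁻ x, ‖A.indicator f x‖ₑ ≤ ENNReal.ofReal I := by
  have := lintegral_enorm_indicator f h.meas_set one_pos
  simp only [ENNReal.rpow_one] at this
  rw [this]; exact h.left

theorem right' (h : SplitBound f A I J) :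
    ∫⁻ x, ‖Aᶜ.indicator f x‖ₑ ^ (2 : ℝ) ≤ ENNReal.ofReal (J ^ (2 : ℝ)) := by
  rw [lintegral_enorm_indicator f h.meas_set.compl two_pos]; exact h.right

theorem isTemperedFun (h : SplitBound f A I J) : IsTemperedFun f :=
  isTemperedFun_of_memLp_of_memLp_compl (p := 1) (q := 2) le_rfl one_le_two
    (memLp_one_iff_integrable.2
      (integrable_of_lintegral_enorm_le (h.meas.indicator h.meas_set) h.left'))
    (memLp_two_of_lintegral_le (h.meas.indicator h.meas_set.compl) h.right')

theorem isTemperedFun_indicator (h : SplitBound f A I J) : IsTemperedFun (A.indicator f) :=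
  isTemperedFun_of_memLp (p := 1) le_rfl
    (memLp_one_iff_integrable.2
      (integrable_of_lintegral_enorm_le (h.meas.indicator h.meas_set) h.left'))

theorem isTemperedFun_indicator_compl (h : SplitBound f A I J) : IsTemperedFun (Aᶜ.indicator f) :=
  isTemperedFun_of_memLp (p := 2) one_le_two
    (memLp_two_of_lintegral_le (h.meas.indicator h.meas_set.compl) h.right')

theorem integral_eq (h : SplitBound f A I J) (χ : 𝓢(Rn n, ℂ)) :
    ∫ x, χ x * f x = (∫ x, χ x * A.indicator f x) + ∫ x, χ x * Aᶜ.indicator f x := by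
  rw [← integral_add (h.isTemperedFun_indicator.represents.2 χ)
    (h.isTemperedFun_indicator_compl.represents.2 χ)]
  congr 1
  ext x
  rw [← mul_add, indicator_self_add_compl_apply]

theorem norm_integral_le (h : SplitBound f A I J) {σ : ℝ} (hσ : 0 < σ) (ψ : 𝓢(Rn n, ℂ)) :
    ‖∫ x, propagator n σ ψ x * f x‖ ≤ (4 * Real.pi * σ) ^ (-((n : ℝ) / 2)) * I * (∫ x, ‖ψ x‖) +
      J * (∫ x, ‖ψ x‖ ^ (2 : ℝ)) ^ (1 / (2 : ℝ)) := by
  rw [h.integral_eq]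
  exact (norm_add_le _ _).trans (add_le_add
    (norm_integral_propagator_mul_le_of_L1 h.nonneg_left (h.meas.indicator h.meas_set) h.left' hσ ψ)
    (norm_integral_propagator_mul_le_of_L2 h.nonneg_right (h.meas.indicator h.meas_set.compl)
      h.right' σ ψ))

end SplitBound

/-- The functional `ψ ↦ ⟨e^{iσΔ} f, ψ⟩`. -/
noncomputable def evolutionFunctional {n : ℕ} (f : Rn n → ℂ) (σ : ℝ) : 𝓢(Rn n, ℂ) →ₗ[ℂ] ℂ :=
  (schrodingerGroup n σ (toDistribution f)).toLinearMap

theorem evolutionFunctional_apply {n : ℕ} {f : Rn n → ℂ} (hf : IsTemperedFun f) (σ : ℝ)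
    (ψ : 𝓢(Rn n, ℂ)) : evolutionFunctional f σ ψ = ∫ x, propagator n σ ψ x * f x := by
  rw [← toDistribution_apply hf]; rfl

/-- Only the existence of `w` matters here; the constant in the `L¹ + L²` bound is discarded. -/
theorem SplitBound.exists_evolution {n : ℕ} {f : Rn n → ℂ} {A : Set (Rn n)} {I J : ℝ}
    (h : SplitBound f A I J) {σ : ℝ} (hσ : 0 < σ) :
    ∃ w : Rn n → ℂ, LocallyIntegrable w volume ∧ (∀ ψ : 𝓢(Rn n, ℂ), Integrable fun x => ψ x * w x) ∧
      ∀ ψ : 𝓢(Rn n, ℂ), ∫ x, propagator n σ ψ x * f x = ∫ x, ψ x * w x := by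
  have hI := h.nonneg_left
  have hJ := h.nonneg_right
  obtain ⟨w, hw1, hw2, hw3⟩ := exists_function_of_bound (evolutionFunctional f σ)
    (B := (4 * Real.pi * σ) ^ (-((n : ℝ) / 2)) * I + J) (by positivity) fun ψ => by
      rw [evolutionFunctional_apply h.isTemperedFun]
      refine (h.norm_integral_le hσ ψ).trans ?_
      have h1 : 0 ≤ ∫ x, ‖ψ x‖ := integral_nonneg fun x => norm_nonneg _
      have h2 : 0 ≤ (∫ x, ‖ψ x‖ ^ (2 : ℝ)) ^ (1 / (2 : ℝ)) :=
        Real.rpow_nonneg (integral_nonneg fun x => by positivity) _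
      have h3 : 0 ≤ (4 * Real.pi * σ) ^ (-((n : ℝ) / 2)) * I := by positivity
      nlinarith [mul_nonneg h3 h2, mul_nonneg hJ h1]
  exact ⟨w, hw1, hw2, fun ψ => by rw [← hw3, evolutionFunctional_apply h.isTemperedFun]⟩

/-- Chebyshev's inequality for the evolution of the square integrable part. -/
theorem SplitBound.measure_lt_norm_le {n : ℕ} {f w : Rn n → ℂ} {A : Set (Rn n)} {I J : ℝ}
    (h : SplitBound f A I J) {σ : ℝ} (hσ : 0 < σ) (hw : LocallyIntegrable w volume)
    (hwi : ∀ ψ : 𝓢(Rn n, ℂ), Integrable fun x => ψ x * w x)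
    (hwf : ∀ ψ : 𝓢(Rn n, ℂ), ∫ x, propagator n σ ψ x * f x = ∫ x, ψ x * w x)
    {l : ℝ} (hl : 0 < l) (hlI : (4 * Real.pi * σ) ^ (-((n : ℝ) / 2)) * I ≤ l / 2) :
    volume {x | l < ‖w x‖} ≤ ENNReal.ofReal ((J / (l / 2)) ^ (2 : ℝ)) := by
  have hI := h.nonneg_left
  have hJ := h.nonneg_right
  -- Each piece is a split of its own with the other constant zero, so each evolves into a function:
  -- `w₁` is bounded by `l/2` and `w₂` satisfies Chebyshev's inequality. As `w = w₁ + w₂` almost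
  -- everywhere, `|w| > l` forces `|w₂| > l/2`.
  have h1 : SplitBound (A.indicator f) A I 0 := by
    refine ⟨h.meas.indicator h.meas_set, h.meas_set, hI, le_rfl, ?_, ?_⟩
    · exact (setLIntegral_le_lintegral _ _).trans h.left'
    · rw [setLIntegral_congr_fun (g := fun _ => 0) h.meas_set.compl (fun x hx => by
        simp [indicator_of_notMem hx])]
      simp
  have h2 : SplitBound (Aᶜ.indicator f) ∅ 0 J := by
    refine ⟨h.meas.indicator h.meas_set.compl, MeasurableSet.empty, le_rfl, hJ, by simp, ?_⟩
    exact (setLIntegral_le_lintegral _ _).trans h.right'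
  obtain ⟨w1, hw1, hw1i, hw1f⟩ := h1.exists_evolution hσ
  obtain ⟨w2, hw2, hw2i, hw2f⟩ := h2.exists_evolution hσ
  have hb1 : ∀ᵐ x, ‖w1 x‖ ≤ (4 * Real.pi * σ) ^ (-((n : ℝ) / 2)) * I :=
    ae_norm_le_of_pairing hw1 (by positivity) fun ψ => by
      rw [← hw1f]
      simpa using h1.norm_integral_le hσ ψ
  have hb2 : volume {x | l / 2 < ‖w2 x‖} ≤ ENNReal.ofReal ((J / (l / 2)) ^ (2 : ℝ)) :=
    measure_lt_norm_le_of_pairing (a := 0) (c := 1 / 2) (p := 2) hw2 hJ le_rfl (by norm_num)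
      two_pos two_pos (by norm_num) (fun ψ => by
        rw [← hw2f]
        simpa using h2.norm_integral_le hσ ψ) (by linarith)
  have hsum : w =ᵐ[volume] fun x => w1 x + w2 x := by
    refine ae_eq_of_pairing hw (hw1.add hw2) hwi (fun ψ => ?_) fun ψ => ?_
    · simp_rw [mul_add]; exact (hw1i ψ).add (hw2i ψ)
    · simp_rw [mul_add]
      rw [integral_add (hw1i ψ) (hw2i ψ), ← hw1f, ← hw2f, ← hwf, h.integral_eq]
  refine le_trans (measure_mono_ae ?_) hb2
  filter_upwards [hb1, hsum] with x hx1 hx2 hx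
  have hx' : l < ‖w x‖ := hx
  show l / 2 < ‖w2 x‖
  rw [hx2] at hx'
  have := norm_add_le (w1 x) (w2 x)
  linarith

/-! ### Integrals of powers over balls and their complements -/

theorem lintegral_comp_smul_eq {n : ℕ} {h : Rn n → ℝ≥0∞} (hh : Measurable h) {c : ℝ} (hc : 0 < c) :
    ∫⁻ x, h (c • x) = ENNReal.ofReal ((c ^ n)⁻¹) * ∫⁻ x, h x := by
  have := lintegral_map (μ := (volume : Measure (Rn n))) hh (measurable_const_smul c)
  rw [← this, map_smul_volume hc, lintegral_smul_measure, smul_eq_mul]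

theorem setLIntegral_rpow_norm_scale {n : ℕ} {S : Set (Rn n)} (hS : MeasurableSet S) (a : ℝ)
    {R : ℝ} (hR : 0 < R) :
    ∫⁻ x in (fun x => R⁻¹ • x) ⁻¹' S, ENNReal.ofReal (‖x‖ ^ (-a)) =
      ENNReal.ofReal (R ^ ((n : ℝ) - a)) * ∫⁻ x in S, ENNReal.ofReal (‖x‖ ^ (-a)) := by
  have hS' : MeasurableSet ((fun x : Rn n => R⁻¹ • x) ⁻¹' S) := measurable_const_smul R⁻¹ hS
  have hm : Measurable fun x : Rn n => ENNReal.ofReal (‖x‖ ^ (-a)) := by fun_prop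
  have h1 := lintegral_comp_smul_eq (hm.indicator hS') hR
  have h2 : ∀ x : Rn n, ((fun x : Rn n => R⁻¹ • x) ⁻¹' S).indicator
      (fun x : Rn n => ENNReal.ofReal (‖x‖ ^ (-a))) (R • x) =
      ENNReal.ofReal (R ^ (-a)) * S.indicator (fun x : Rn n => ENNReal.ofReal (‖x‖ ^ (-a))) x := by
    intro x
    have e : R⁻¹ • R • x = x := by rw [smul_smul, inv_mul_cancel₀ hR.ne', one_smul]
    by_cases hx : x ∈ S
    · rw [indicator_of_mem hx, indicator_of_mem (by rwa [mem_preimage, e]), norm_smul,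
        Real.norm_of_nonneg hR.le, Real.mul_rpow hR.le (norm_nonneg _),
        ENNReal.ofReal_mul (by positivity)]
    · rw [indicator_of_notMem hx, indicator_of_notMem (by rwa [mem_preimage, e]), mul_zero]
  simp_rw [h2] at h1
  rw [lintegral_const_mul _ (hm.indicator hS), lintegral_indicator hS, lintegral_indicator hS'] at h1
  have h3 : ENNReal.ofReal (R ^ n) * ENNReal.ofReal ((R ^ n)⁻¹) = 1 := by
    rw [← ENNReal.ofReal_mul (by positivity), mul_inv_cancel₀ (by positivity), ENNReal.ofReal_one]
  calc _ = ENNReal.ofReal (R ^ n) * (ENNReal.ofReal ((R ^ n)⁻¹) *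
        ∫⁻ x in (fun x => R⁻¹ • x) ⁻¹' S, ENNReal.ofReal (‖x‖ ^ (-a))) := by
        rw [← mul_assoc, h3, one_mul]
    _ = _ := by
        rw [← h1, ← mul_assoc, ← ENNReal.ofReal_mul (by positivity), ← Real.rpow_natCast,
          ← Real.rpow_add hR, sub_eq_add_neg]

theorem preimage_smul_ball {n : ℕ} {R : ℝ} (hR : 0 < R) :
    (fun x : Rn n => R⁻¹ • x) ⁻¹' Metric.ball 0 1 = Metric.ball 0 R := by
  ext x
  simp only [mem_preimage, mem_ball_zero_iff, norm_smul, norm_inv, Real.norm_of_nonneg hR.le]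
  rw [inv_mul_lt_one₀ hR]

theorem exists_setLIntegral_ball_rpow_le {n : ℕ} (hn : 1 ≤ n) {a : ℝ} (ha : a < n) :
    ∃ C : ℝ, 0 ≤ C ∧ ∀ R : ℝ, 0 < R →
      ∫⁻ x in Metric.ball (0 : Rn n) R, ENNReal.ofReal (‖x‖ ^ (-a)) ≤
        ENNReal.ofReal (C * R ^ ((n : ℝ) - a)) := by
  have h1 : IntegrableOn (fun x : Rn n => ‖x‖ ^ (-a)) (Metric.ball 0 1) :=
    integrableOn_ball_of_norm_le_rpow (α := a) (C := 1) (by simpa using hn) (by simpa using ha)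
      (Eventually.of_forall fun x => by rw [Real.norm_of_nonneg (by positivity), one_mul])
      (Measurable.aestronglyMeasurable (by fun_prop))
  refine ⟨∫ x in Metric.ball (0 : Rn n) 1, ‖x‖ ^ (-a), integral_nonneg fun x => by positivity,
    fun R hR => ?_⟩
  rw [← preimage_smul_ball hR, setLIntegral_rpow_norm_scale measurableSet_ball a hR,
    ← ofReal_integral_eq_lintegral_ofReal h1 (Eventually.of_forall fun x => by positivity),
    ← ENNReal.ofReal_mul (by positivity), mul_comm]

theorem exists_setLIntegral_compl_ball_rpow_le {n : ℕ} {a : ℝ} (ha : n < a) :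
    ∃ C : ℝ, 0 ≤ C ∧ ∀ R : ℝ, 0 < R →
      ∫⁻ x in (Metric.ball (0 : Rn n) R)ᶜ, ENNReal.ofReal (‖x‖ ^ (-a)) ≤
        ENNReal.ofReal (C * R ^ ((n : ℝ) - a)) := by
  have ha0 : 0 < a := lt_of_le_of_lt (Nat.cast_nonneg n) ha
  have h1 : IntegrableOn (fun x : Rn n => ‖x‖ ^ (-a)) (Metric.ball 0 1)ᶜ := by
    refine Integrable.mono' ((integrable_one_add_norm (μ := (volume : Measure (Rn n))) (r := a)
      (by simpa using ha)).const_mul (2 ^ a)).integrableOn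
      (Measurable.aestronglyMeasurable (by fun_prop)) ?_
    rw [ae_restrict_iff' measurableSet_ball.compl]
    refine Eventually.of_forall fun x hx => ?_
    have hx1 : 1 ≤ ‖x‖ := by simpa using hx
    rw [Real.norm_of_nonneg (by positivity), Real.rpow_neg (by positivity),
      Real.rpow_neg (by positivity), ← div_eq_mul_inv, ← Real.div_rpow (by norm_num) (by positivity),
      ← Real.inv_rpow (by positivity)]
    refine Real.rpow_le_rpow (by positivity) ?_ ha0.le
    rw [inv_eq_one_div, div_le_div_iff₀ (by positivity) (by positivity)]
    linarith
  refine ⟨∫ x in (Metric.ball (0 : Rn n) 1)ᶜ, ‖x‖ ^ (-a), integral_nonneg fun x => by positivity,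
    fun R hR => ?_⟩
  rw [← preimage_smul_ball hR, ← preimage_compl,
    setLIntegral_rpow_norm_scale measurableSet_ball.compl a hR,
    ← ofReal_integral_eq_lintegral_ofReal h1 (Eventually.of_forall fun x => by positivity),
    ← ENNReal.ofReal_mul (by positivity), mul_comm]

/-! ### The strong estimate for `|x|^{-b} g` -/

/-- Hölder's inequality with exponents `1/(1-θ)` and `1/θ`. The parameter `θ` is free because it is
chosen differently near the origin and far from it. -/
theorem setLIntegral_rpow_mul_rpow_le {n : ℕ} {g : Rn n → ℂ} {s θ a K : ℝ} {S : Set (Rn n)}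
    (hg : Measurable g) (hθ0 : 0 ≤ θ) (hθ1 : θ ≤ 1) (hK : 0 ≤ K)
    (hS : ∫⁻ x in S, ENNReal.ofReal (‖x‖ ^ (-a)) ≤ ENNReal.ofReal K)
    (h1 : ∫⁻ x, ENNReal.ofReal (‖g x‖ ^ s) ≤ 1) :
    ∫⁻ x in S, ENNReal.ofReal (‖x‖ ^ (-(a * (1 - θ))) * ‖g x‖ ^ (s * θ)) ≤
      ENNReal.ofReal (K ^ (1 - θ)) := by
  have e : ∀ x, ENNReal.ofReal (‖x‖ ^ (-(a * (1 - θ))) * ‖g x‖ ^ (s * θ)) =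
      ENNReal.ofReal (‖x‖ ^ (-a)) ^ (1 - θ) * ENNReal.ofReal (‖g x‖ ^ s) ^ θ := by
    intro x
    rw [ENNReal.ofReal_mul (by positivity), ENNReal.ofReal_rpow_of_nonneg (by positivity)
      (by linarith), ENNReal.ofReal_rpow_of_nonneg (by positivity) hθ0, ← Real.rpow_mul (by positivity),
      ← Real.rpow_mul (by positivity), neg_mul]
  simp_rw [e]
  refine (ENNReal.lintegral_mul_norm_pow_le (Measurable.aemeasurable (by fun_prop))
    (Measurable.aemeasurable (by fun_prop)) (by linarith) hθ0 (by ring)).trans ?_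
  calc _ ≤ ENNReal.ofReal K ^ (1 - θ) * 1 ^ θ := by
        gcongr
        exact (setLIntegral_le_lintegral _ _).trans h1
    _ = _ := by
        rw [ENNReal.one_rpow, mul_one, ENNReal.ofReal_rpow_of_nonneg hK (by linarith)]

/-- The set where `|x|^{-b}|g|` is large, at level `κ`. -/
def highSet {n : ℕ} (b s r : ℝ) (g : Rn n → ℂ) (κ : ℝ) : Set (Rn n) :=
  {x | ‖x‖ ^ (2 * b) * ‖g x‖ ^ s < κ ^ (r - 2) * ‖g x‖ ^ (2 : ℝ)}

theorem measurableSet_highSet {n : ℕ} (b s r : ℝ) {g : Rn n → ℂ} (hg : Measurable g) (κ : ℝ) :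
    MeasurableSet (highSet b s r g κ) :=
  measurableSet_lt (by fun_prop) (by fun_prop)

/-- The integral is cut at `|x| = κ^{r/n}`. Inside, Hölder's inequality suffices, the power of `|x|`
being integrable at zero. Outside, `|x|^{-b}` decays too slowly, and the inequality defining the
high set, raised to a power `ω`, trades powers of `g` and of `κ` for extra decay in `|x|`. -/
theorem exists_setLIntegral_highSet_le {n : ℕ} (hn : 1 ≤ n) {b s r : ℝ} (hb : 0 < b) (hs : 1 < s)
    (hsr : s < r) (hr : 2 < r) (hrel : 1 / s + b / n = 1 - 1 / r) :
    ∃ C : ℝ, 0 < C ∧ ∀ g : Rn n → ℂ, Measurable g → ∫⁻ x, ENNReal.ofReal (‖g x‖ ^ s) ≤ 1 →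
      ∀ κ : ℝ, 0 < κ →
        ∫⁻ x in highSet b s r g κ, ENNReal.ofReal (‖x‖ ^ (-b) * ‖g x‖) ≤
          ENNReal.ofReal (C * κ) := by
  have hn0 : (0 : ℝ) < n := by exact_mod_cast hn
  have hs0 : 0 < s := by linarith
  have hr0 : 0 < r := by linarith
  have hbn : b = n * (1 - 1 / r - 1 / s) := by
    field_simp at hrel ⊢; linarith
  -- the exponent of the interpolation far from the origin
  have hgap : s + r < s * r := by
    have h1 : 0 < b / n := by positivity
    have h2 : 1 / s + 1 / r < 1 := by linarith
    rw [div_add_div _ _ hs0.ne' hr0.ne', div_lt_one (by positivity)] at h2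
    linarith
  -- Here `y = 1/ω`. The lower bounds mean `ω > 0`, `θ > 0` and `θ < 1`; the upper bound `y < r - 2`
  -- makes the exponent `a₂` exceed `n`. They are compatible because `s + r < sr`, which is where `b
  -- > 0` enters.
  obtain ⟨y, hy1, hy2⟩ : ∃ y, max 0 (max (s - 2) ((2 - s) / (s - 1))) < y ∧ y < r - 2 := by
    refine exists_between (max_lt (by linarith) (max_lt (by linarith) ?_))
    rw [div_lt_iff₀ (by linarith)]
    nlinarith
  have hy0 : 0 < y := (le_max_left _ _).trans_lt hy1
  have hys : s - 2 < y := ((le_max_left _ _).trans (le_max_right _ _)).trans_lt hy1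
  have hys' : 2 - s < y * (s - 1) := by
    have := ((le_max_right _ _).trans (le_max_right _ _)).trans_lt hy1
    rwa [div_lt_iff₀ (by linarith)] at this
  let ω := 1 / y
  have hω0 : 0 < ω := by positivity
  have hωy : ω * y = 1 := by simp only [ω]; field_simp
  have hω1 : 1 < ω * (r - 2) := by nlinarith
  have hω2 : ω * (s - 2) < 1 := by nlinarith
  have hω3 : ω * (2 - s) < s - 1 := by nlinarith
  let θ := (1 - ω * (s - 2)) / s
  have hθs : s * θ = 1 - ω * (s - 2) := by simp only [θ]; field_simp
  have hθ0 : 0 < θ := div_pos (by linarith) hs0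
  have hθ1 : θ < 1 := by rw [div_lt_one hs0]; linarith
  let k := b * (1 + 2 * ω)
  let a₂ := k / (1 - θ)
  have ha₂ : a₂ * (1 - θ) = k := div_mul_cancel₀ _ (by linarith)
  -- The total power of `κ` far from the origin is exactly one. As `(r-2)ω > 1`, the second term is
  -- negative, hence `a₂ > n`: the power of `|x|` is integrable at infinity.
  have hexp2 : (r - 2) * ω + r / n * ((n - a₂) * (1 - θ)) = 1 := by
    rw [sub_mul (n : ℝ) a₂, ha₂]
    simp only [k, θ]
    rw [hbn]
    field_simp
    ring
  have ha₂n : (n : ℝ) < a₂ := by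
    by_contra hcon
    push Not at hcon
    have : 0 ≤ r / n * ((n - a₂) * (1 - θ)) :=
      mul_nonneg (by positivity) (mul_nonneg (by linarith) (by linarith))
    linarith
  let a₁ := b / (1 - 1 / s)
  have hs1 : 0 < 1 - 1 / s := by
    rw [sub_pos, div_lt_one hs0]; exact hs
  have ha₁ : a₁ * (1 - 1 / s) = b := div_mul_cancel₀ _ hs1.ne'
  have hexp1 : r / n * ((n - a₁) * (1 - 1 / s)) = 1 := by
    rw [sub_mul (n : ℝ) a₁, ha₁, hbn]
    field_simp
    ring
  have ha₁n : a₁ < n := by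
    by_contra hcon
    push Not at hcon
    have : r / n * ((n - a₁) * (1 - 1 / s)) ≤ 0 :=
      mul_nonpos_of_nonneg_of_nonpos (by positivity)
        (mul_nonpos_of_nonpos_of_nonneg (by linarith) hs1.le)
    linarith
  obtain ⟨C₁, hC₁, hball⟩ := exists_setLIntegral_ball_rpow_le hn ha₁n
  obtain ⟨C₂, hC₂, hcompl⟩ := exists_setLIntegral_compl_ball_rpow_le ha₂n
  refine ⟨C₁ ^ (1 - 1 / s) + C₂ ^ (1 - θ) + 1, by positivity, fun g hg hg1 κ hκ => ?_⟩
  -- The radius dictated by scaling, for which both regions contribute a constant times `κ`.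
  let R := κ ^ (r / n)
  have hR : 0 < R := by positivity
  have hgm : Measurable fun x : Rn n => ENNReal.ofReal (‖x‖ ^ (-b) * ‖g x‖) := by fun_prop
  have part1 : ∫⁻ x in Metric.ball (0 : Rn n) R, ENNReal.ofReal (‖x‖ ^ (-b) * ‖g x‖) ≤
      ENNReal.ofReal (C₁ ^ (1 - 1 / s) * κ) := by
    have h1 := setLIntegral_rpow_mul_rpow_le (θ := 1 / s) hg (by positivity) (by linarith)
      (by positivity) (hball R hR) hg1
    rw [ha₁, mul_one_div_cancel hs0.ne', Real.mul_rpow hC₁ (by positivity)] at h1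
    simp only [Real.rpow_one] at h1
    refine h1.trans (le_of_eq ?_)
    congr 2
    rw [← Real.rpow_mul hR.le, ← Real.rpow_mul hκ.le, hexp1, Real.rpow_one]
  have part2 : ∫⁻ x in highSet b s r g κ ∩ (Metric.ball (0 : Rn n) R)ᶜ,
      ENNReal.ofReal (‖x‖ ^ (-b) * ‖g x‖) ≤ ENNReal.ofReal (C₂ ^ (1 - θ) * κ) := by
    have h1 := setLIntegral_rpow_mul_rpow_le hg hθ0.le hθ1.le
      (by positivity) (hcompl R hR) hg1
    rw [ha₂, Real.mul_rpow hC₂ (by positivity)] at h1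
    have hpt : ∀ x ∈ highSet b s r g κ ∩ (Metric.ball (0 : Rn n) R)ᶜ,
        ENNReal.ofReal (‖x‖ ^ (-b) * ‖g x‖) ≤ ENNReal.ofReal (κ ^ ((r - 2) * ω)) *
          ENNReal.ofReal (‖x‖ ^ (-k) * ‖g x‖ ^ (s * θ)) := by
      rintro x ⟨hx1, hx2⟩
      have hX : 0 < ‖x‖ := hR.trans_le (by simpa using hx2)
      have hx1' : ‖x‖ ^ (2 * b) * ‖g x‖ ^ s < κ ^ (r - 2) * ‖g x‖ ^ (2 : ℝ) := hx1
      have hG : 0 < ‖g x‖ := by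
        rcases (norm_nonneg (g x)).eq_or_lt with h | h
        · rw [← h, Real.zero_rpow hs0.ne', Real.zero_rpow two_ne_zero] at hx1'
          simp at hx1'
        · exact h
      have hq : ‖x‖ ^ (2 * b) * ‖g x‖ ^ (s - 2) ≤ κ ^ (r - 2) := by
        rw [Real.rpow_sub hG, ← mul_div_assoc, div_le_iff₀ (by positivity)]
        exact hx1'.le
      rw [← ENNReal.ofReal_mul (by positivity)]
      refine ENNReal.ofReal_le_ofReal ?_
      have hq2 := Real.rpow_le_rpow (by positivity) hq hω0.le
      rw [← Real.rpow_mul hκ.le, Real.mul_rpow (by positivity) (by positivity),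
        ← Real.rpow_mul hX.le, ← Real.rpow_mul hG.le] at hq2
      calc ‖x‖ ^ (-b) * ‖g x‖ = (‖x‖ ^ (2 * b * ω) * ‖g x‖ ^ ((s - 2) * ω)) *
            (‖x‖ ^ (-k) * ‖g x‖ ^ (s * θ)) := by
            rw [mul_mul_mul_comm, ← Real.rpow_add hX, ← Real.rpow_add hG, hθs]
            have e1 : 2 * b * ω + -k = -b := by simp only [k]; ring
            have e2 : (s - 2) * ω + (1 - ω * (s - 2)) = 1 := by ring
            rw [e1, e2, Real.rpow_one]
        _ ≤ _ := mul_le_mul_of_nonneg_right hq2 (by positivity)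
    have hmS : MeasurableSet (highSet b s r g κ ∩ (Metric.ball (0 : Rn n) R)ᶜ) :=
      (measurableSet_highSet b s r hg κ).inter measurableSet_ball.compl
    calc _ ≤ ∫⁻ x in highSet b s r g κ ∩ (Metric.ball (0 : Rn n) R)ᶜ,
          ENNReal.ofReal (κ ^ ((r - 2) * ω)) * ENNReal.ofReal (‖x‖ ^ (-k) * ‖g x‖ ^ (s * θ)) :=
          setLIntegral_mono' hmS hpt
      _ ≤ ∫⁻ x in (Metric.ball (0 : Rn n) R)ᶜ,
          ENNReal.ofReal (κ ^ ((r - 2) * ω)) * ENNReal.ofReal (‖x‖ ^ (-k) * ‖g x‖ ^ (s * θ)) :=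
          lintegral_mono_set inter_subset_right
      _ ≤ ENNReal.ofReal (κ ^ ((r - 2) * ω)) *
          ENNReal.ofReal (C₂ ^ (1 - θ) * (R ^ ((n : ℝ) - a₂)) ^ (1 - θ)) := by
          rw [lintegral_const_mul _ (by fun_prop)]
          gcongr
      _ = _ := by
          rw [← ENNReal.ofReal_mul (by positivity), mul_left_comm, ← Real.rpow_mul hR.le,
            ← Real.rpow_mul hκ.le, ← Real.rpow_add hκ, hexp2, Real.rpow_one]
  calc _ ≤ ∫⁻ x in Metric.ball (0 : Rn n) R ∪ highSet b s r g κ ∩ (Metric.ball (0 : Rn n) R)ᶜ,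
        ENNReal.ofReal (‖x‖ ^ (-b) * ‖g x‖) := by
        refine lintegral_mono_set fun x hx => ?_
        by_cases hxR : x ∈ Metric.ball (0 : Rn n) R
        · exact Or.inl hxR
        · exact Or.inr ⟨hx, hxR⟩
    _ ≤ _ := lintegral_union_le _ _ _
    _ ≤ _ := add_le_add part1 part2
    _ ≤ _ := by
        rw [← ENNReal.ofReal_add (by positivity) (by positivity)]
        exact ENNReal.ofReal_le_ofReal (by nlinarith)

theorem lintegral_Ioi_rpow_cut_le {m Q : ℝ} (hm : 0 < m) (hQ : 0 ≤ Q) :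
    ∫⁻ t in Ioi (0 : ℝ), (if t ^ m ≤ Q then ENNReal.ofReal (t ^ (m - 1)) else 0) ≤
      ENNReal.ofReal (Q / m) := by
  set R := Q ^ (1 / m)
  have hR : 0 ≤ R := by positivity
  have h1 : ∀ t ∈ Ioi (0 : ℝ), (if t ^ m ≤ Q then ENNReal.ofReal (t ^ (m - 1)) else 0) ≤
      (Ioc 0 R).indicator (fun t => ENNReal.ofReal (t ^ (m - 1))) t := by
    intro t ht
    have ht0 : 0 < t := ht
    split_ifs with h
    · rw [indicator_of_mem]
      refine ⟨ht0, ?_⟩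
      have := Real.rpow_le_rpow (by positivity) h (by positivity : 0 ≤ 1 / m)
      rwa [← Real.rpow_mul ht0.le, mul_one_div_cancel hm.ne', Real.rpow_one] at this
    · exact zero_le
  refine (setLIntegral_mono' measurableSet_Ioi h1).trans ?_
  refine (setLIntegral_le_lintegral _ _).trans ?_
  rw [lintegral_indicator measurableSet_Ioc]
  have h2 : IntervalIntegrable (fun t : ℝ => t ^ (m - 1)) volume 0 R :=
    intervalIntegral.intervalIntegrable_rpow' (by linarith)
  have h3 := (intervalIntegrable_iff_integrableOn_Ioc_of_le hR).1 h2
  rw [← ofReal_integral_eq_lintegral_ofReal h3, ← intervalIntegral.integral_of_le hR,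
    integral_rpow (Or.inl (by linarith)), sub_add_cancel, Real.zero_rpow hm.ne', sub_zero,
    ← Real.rpow_mul hQ, one_div_mul_cancel hm.ne', Real.rpow_one]
  rw [EventuallyLE, ae_restrict_iff' measurableSet_Ioc]
  exact Eventually.of_forall fun t ht => Real.rpow_nonneg ht.1.le _

/-- Multiply the reversed defining inequality by `κ^{2-r} |x|^{-2b}`. At `x = 0` the left side
vanishes, since zero to the power `-b` is zero. This bound serves only to make the `L²` part finite.
-/
theorem setLIntegral_compl_highSet_le {n : ℕ} {b s r : ℝ} (hb : 0 < b) {g : Rn n → ℂ}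
    (hg : Measurable g) (hg1 : ∫⁻ x, ENNReal.ofReal (‖g x‖ ^ s) ≤ 1) {κ : ℝ} (hκ : 0 < κ) :
    ∫⁻ x in (highSet b s r g κ)ᶜ, ENNReal.ofReal ((‖x‖ ^ (-b) * ‖g x‖) ^ (2 : ℝ)) ≤
      ENNReal.ofReal (κ ^ (2 - r)) := by
  calc _ ≤ ∫⁻ x in (highSet b s r g κ)ᶜ,
        ENNReal.ofReal (κ ^ (2 - r)) * ENNReal.ofReal (‖g x‖ ^ s) := by
        refine setLIntegral_mono' (measurableSet_highSet b s r hg κ).compl fun x hx => ?_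
        have hx' : κ ^ (r - 2) * ‖g x‖ ^ (2 : ℝ) ≤ ‖x‖ ^ (2 * b) * ‖g x‖ ^ s := not_lt.1 hx
        rw [← ENNReal.ofReal_mul (by positivity)]
        refine ENNReal.ofReal_le_ofReal ?_
        rcases (norm_nonneg x).eq_or_lt with h | h
        · rw [← h, Real.zero_rpow (by linarith), zero_mul, Real.zero_rpow two_ne_zero]
          positivity
        · rw [Real.mul_rpow (by positivity) (by positivity), ← Real.rpow_mul h.le]
          calc _ = κ ^ (2 - r) * (‖x‖ ^ (-b * 2) * (κ ^ (r - 2) * ‖g x‖ ^ (2 : ℝ))) := by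
                have : κ ^ (2 - r) * κ ^ (r - 2) = 1 := by
                  rw [← Real.rpow_add hκ]; simp
                linear_combination (-(‖x‖ ^ (-b * 2) * ‖g x‖ ^ (2 : ℝ))) * this
            _ ≤ κ ^ (2 - r) * (‖x‖ ^ (-b * 2) * (‖x‖ ^ (2 * b) * ‖g x‖ ^ s)) := by gcongr
            _ = _ := by
                have : ‖x‖ ^ (-b * 2) * ‖x‖ ^ (2 * b) = 1 := by
                  rw [← Real.rpow_add h, show -b * 2 + 2 * b = 0 by ring, Real.rpow_zero]
                linear_combination (κ ^ (2 - r) * ‖g x‖ ^ s) * this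
    _ ≤ ENNReal.ofReal (κ ^ (2 - r)) * ∫⁻ x, ENNReal.ofReal (‖g x‖ ^ s) := by
        rw [lintegral_const_mul _ (by fun_prop)]
        gcongr
        exact Measure.restrict_le_self
    _ ≤ _ := mul_le_of_le_one_right' hg1

/-- Multiplication by `|x|^{-b}`. -/
noncomputable def weighted {n : ℕ} (b : ℝ) (g : Rn n → ℂ) (x : Rn n) : ℂ :=
  ((‖x‖ ^ (-b) : ℝ) : ℂ) * g x

theorem enorm_weighted {n : ℕ} (b : ℝ) (g : Rn n → ℂ) (x : Rn n) :
    ‖weighted b g x‖ₑ = ENNReal.ofReal (‖x‖ ^ (-b) * ‖g x‖) := by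
  rw [weighted, ← ofReal_norm, norm_mul, Complex.norm_real, Real.norm_of_nonneg (by positivity)]

theorem splitBound_weighted {n : ℕ} {b s r : ℝ} {g : Rn n → ℂ}
    (hg : Measurable g) {κ C : ℝ} (hκ : 0 < κ)
    (hC : 0 < C) (h : ∫⁻ x in highSet b s r g κ, ENNReal.ofReal (‖x‖ ^ (-b) * ‖g x‖) ≤
          ENNReal.ofReal (C * κ)) {J : ℝ} (hJ : 0 ≤ J)
    (hJ2 : ∫⁻ x in (highSet b s r g κ)ᶜ, ENNReal.ofReal ((‖x‖ ^ (-b) * ‖g x‖) ^ (2 : ℝ)) ≤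
      ENNReal.ofReal (J ^ (2 : ℝ))) :
    SplitBound (weighted b g) (highSet b s r g κ) (C * κ) J := by
  refine ⟨Measurable.aestronglyMeasurable (by unfold weighted; fun_prop),
    measurableSet_highSet b s r hg κ, by positivity, hJ, ?_, ?_⟩
  · simp_rw [enorm_weighted]; exact h
  · simp_rw [enorm_weighted]
    refine le_trans (le_of_eq ?_) hJ2
    refine lintegral_congr fun x => ?_
    rw [ENNReal.ofReal_rpow_of_nonneg (by positivity) two_pos.le]

theorem norm_integral_mul_le_of_eLpNorm {n : ℕ} {r r' B : ℝ} (hr : r.HolderConjugate r')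
    (hB : 0 ≤ B) {w : Rn n → ℂ} (hw : AEStronglyMeasurable w volume)
    (h : eLpNorm w (ENNReal.ofReal r) volume ≤ ENNReal.ofReal B) (ψ : 𝓢(Rn n, ℂ)) :
    ‖∫ x, ψ x * w x‖ ≤ B * (∫ x, ‖ψ x‖ ^ r') ^ (1 / r') := by
  have hm : MemLp w (ENNReal.ofReal r) volume := ⟨hw, h.trans_lt ENNReal.ofReal_lt_top⟩
  rw [eLpNorm_ofReal_le_iff hr.pos hB] at h
  have h1 : ∫ x, ‖w x‖ ^ r ≤ B ^ r := by
    rw [integral_eq_lintegral_of_nonneg_ae (Eventually.of_forall fun x => by positivity)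
      (hw.norm.aemeasurable.pow_const _).aestronglyMeasurable]
    exact ENNReal.toReal_le_of_le_ofReal (by positivity) h
  have h2 := integral_mul_norm_le_Lp_mul_Lq hr hm (ψ.memLp (ENNReal.ofReal r') volume)
  calc _ ≤ ∫ x, ‖w x‖ * ‖ψ x‖ := by
        refine (norm_integral_le_integral_norm _).trans (le_of_eq ?_)
        simp only [norm_mul, mul_comm]
    _ ≤ _ := h2
    _ ≤ (B ^ r) ^ (1 / r) * (∫ x, ‖ψ x‖ ^ r') ^ (1 / r') := by
        refine mul_le_mul_of_nonneg_right ?_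
          (Real.rpow_nonneg (integral_nonneg fun x => by positivity) _)
        exact Real.rpow_le_rpow (integral_nonneg fun x => by positivity) h1
          (by have := hr.pos; positivity)
    _ = _ := by rw [← Real.rpow_mul hB, mul_one_div_cancel hr.pos.ne', Real.rpow_one]

/-- The dispersive estimate for `|x|^{-b} g` with `g` in the unit ball of `L^s`. -/
theorem exists_strong_estimate_aux {n : ℕ} (hn : 1 ≤ n) {b s r r' : ℝ} (hb : 0 < b) (hs : 1 < s)
    (hsr : s < r) (hr : 2 < r) (hrel : 1 / s + b / n = 1 - 1 / r) (hr' : r.HolderConjugate r') :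
    ∃ C : ℝ, 0 < C ∧ ∀ g : Rn n → ℂ, Measurable g → ∫⁻ x, ENNReal.ofReal (‖g x‖ ^ s) ≤ 1 →
      IsTemperedFun (weighted b g) ∧ ∀ σ : ℝ, 0 < σ → ∀ ψ : 𝓢(Rn n, ℂ),
        ‖∫ x, propagator n σ ψ x * weighted b g x‖ ≤
          C * σ ^ (-((n : ℝ) / 2 * (1 - 2 / r))) * (∫ x, ‖ψ x‖ ^ r') ^ (1 / r') := by
  obtain ⟨C, hC, hCx⟩ := exists_setLIntegral_highSet_le hn hb hs hsr hr hrel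
  have hr0 : 0 < r := by linarith
  have hr2 : 0 < r - 2 := by linarith
  refine ⟨(4 * r / (r - 2) * (2 * C) ^ (r - 2)) ^ (1 / r) *
    (4 * Real.pi) ^ (-((n : ℝ) / 2 * (1 - 2 / r))), by positivity, fun g hg hg1 => ?_⟩
  -- `J` is the exact `L²` norm off the high set. The bound `κ^{2-r}` in its place would lose the
  -- dependence on `κ` and yield a weak-type estimate only.
  have hJκ : ∀ κ : ℝ, 0 < κ → ∃ J : ℝ, 0 ≤ J ∧
      ∫⁻ x in (highSet b s r g κ)ᶜ, ENNReal.ofReal ((‖x‖ ^ (-b) * ‖g x‖) ^ (2 : ℝ)) =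
        ENNReal.ofReal (J ^ (2 : ℝ)) := by
    intro κ hκ
    have hfin := (setLIntegral_compl_highSet_le (r := r) hb hg hg1 hκ).trans_lt ENNReal.ofReal_lt_top
    refine ⟨(∫⁻ x in (highSet b s r g κ)ᶜ,
      ENNReal.ofReal ((‖x‖ ^ (-b) * ‖g x‖) ^ (2 : ℝ))).toReal ^ (1 / (2 : ℝ)), by positivity, ?_⟩
    rw [← Real.rpow_mul ENNReal.toReal_nonneg, one_div_mul_cancel two_ne_zero, Real.rpow_one,
      ENNReal.ofReal_toReal hfin.ne]
  obtain ⟨J₁, hJ₁, hJ₁'⟩ := hJκ 1 one_pos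
  have hS1 := splitBound_weighted hg one_pos hC (hCx g hg hg1 1 one_pos) hJ₁ hJ₁'.le
  refine ⟨hS1.isTemperedFun, fun σ hσ ψ => ?_⟩
  obtain ⟨w, hw, hwi, hwf⟩ := hS1.exists_evolution hσ
  set D := (4 * Real.pi * σ) ^ (-((n : ℝ) / 2))
  have hD : 0 < D := by positivity
  -- The cut follows the output level: `κ = t/(2CD)` makes the bounded part of the evolution at most
  -- `D · Cκ = t/2`, and Chebyshev's inequality handles the rest.
  have hlevel : ∀ t : ℝ, 0 < t → volume {x | t < ‖w x‖} ≤ ENNReal.ofReal (4 / t ^ (2 : ℝ)) *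
      ∫⁻ x in (highSet b s r g (t / (2 * C * D)))ᶜ,
        ENNReal.ofReal ((‖x‖ ^ (-b) * ‖g x‖) ^ (2 : ℝ)) := by
    intro t ht
    have hκ : 0 < t / (2 * C * D) := by positivity
    obtain ⟨J, hJ, hJ'⟩ := hJκ _ hκ
    have hS := splitBound_weighted hg hκ hC (hCx g hg hg1 _ hκ) hJ hJ'.le
    refine (hS.measure_lt_norm_le hσ hw hwi hwf ht (le_of_eq ?_)).trans (le_of_eq ?_)
    · change D * _ = _
      field_simp
    · rw [hJ', ← ENNReal.ofReal_mul (by positivity), Real.div_rpow hJ (by positivity),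
        Real.div_rpow ht.le (by norm_num)]
      congr 1
      norm_num
      ring
  have hLp : ∫⁻ x, ENNReal.ofReal (‖w x‖ ^ r) ≤
      ENNReal.ofReal (4 * r / (r - 2) * (2 * C * D) ^ (r - 2)) := by
    rw [lintegral_rpow_eq_lintegral_meas_lt_mul volume (Eventually.of_forall fun x => norm_nonneg _)
      hw.aestronglyMeasurable.norm.aemeasurable hr0]
    -- After the layer-cake formula the integrals in `t` and `x` are exchanged. For fixed `x` with
    -- `x` and `g x` nonzero, membership in the low part reads `t^{r-2} ≤ Q`, and `∫ t^{r-3} dt =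
    -- Q/(r-2)` over this range. The cut is designed so that `Q (|x|^{-b}|g|)²` is a constant times
    -- `|g|^s`, whose integral is at most one.
    let F : ℝ → Rn n → ℝ≥0∞ := fun t x =>
      if (t / (2 * C * D)) ^ (r - 2) * ‖g x‖ ^ (2 : ℝ) ≤ ‖x‖ ^ (2 * b) * ‖g x‖ ^ s then
        ENNReal.ofReal (4 * t ^ (r - 2 - 1) * (‖x‖ ^ (-b) * ‖g x‖) ^ (2 : ℝ)) else 0
    have hFm : Measurable (Function.uncurry F) :=
      Measurable.ite (measurableSet_le (by fun_prop) (by fun_prop)) (by fun_prop) measurable_const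
    have h1 : ∀ t ∈ Ioi (0 : ℝ), volume {x | t < ‖w x‖} * ENNReal.ofReal (t ^ (r - 1)) ≤
        ∫⁻ x, F t x := by
      intro t ht
      have ht0 : 0 < t := ht
      calc _ ≤ (ENNReal.ofReal (4 / t ^ (2 : ℝ)) *
            ∫⁻ x in (highSet b s r g (t / (2 * C * D)))ᶜ,
              ENNReal.ofReal ((‖x‖ ^ (-b) * ‖g x‖) ^ (2 : ℝ))) * ENNReal.ofReal (t ^ (r - 1)) := by
            gcongr; exact hlevel t ht0
        _ = ENNReal.ofReal (4 * t ^ (r - 2 - 1)) *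
            ∫⁻ x in (highSet b s r g (t / (2 * C * D)))ᶜ,
              ENNReal.ofReal ((‖x‖ ^ (-b) * ‖g x‖) ^ (2 : ℝ)) := by
            rw [mul_right_comm, ← ENNReal.ofReal_mul (by positivity)]
            congr 2
            rw [show r - 2 - 1 = (r - 1) - 2 by ring, Real.rpow_sub ht0 (r - 1)]
            ring
        _ ≤ _ := by
            rw [← lintegral_const_mul _ (by fun_prop),
              ← lintegral_indicator (measurableSet_highSet b s r hg _).compl]
            refine lintegral_mono fun x => ?_
            by_cases hx : x ∈ highSet b s r g (t / (2 * C * D))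
            · rw [indicator_of_notMem (by simpa using hx)]; exact zero_le
            · rw [indicator_of_mem (by simpa using hx)]
              simp only [F]
              rw [if_pos (not_lt.1 hx), ← ENNReal.ofReal_mul (by positivity)]
    have h2 : ∀ x, ∫⁻ t in Ioi (0 : ℝ), F t x ≤
        ENNReal.ofReal (4 / (r - 2) * (2 * C * D) ^ (r - 2)) * ENNReal.ofReal (‖g x‖ ^ s) := by
      intro x
      rcases (norm_nonneg x).eq_or_lt with hX | hX
      · have : ∀ t, F t x = 0 := fun t => by
          simp only [F]
          rw [← hX, Real.zero_rpow (by linarith : -b ≠ 0), zero_mul, Real.zero_rpow two_ne_zero,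
            mul_zero, ENNReal.ofReal_zero, ite_self]
        simp [this]
      rcases (norm_nonneg (g x)).eq_or_lt with hG | hG
      · have : ∀ t, F t x = 0 := fun t => by
          simp only [F]
          rw [← hG, mul_zero, Real.zero_rpow two_ne_zero, mul_zero (4 * _), ENNReal.ofReal_zero,
            ite_self]
        simp [this]
      let Q := (2 * C * D) ^ (r - 2) * (‖x‖ ^ (2 * b) * ‖g x‖ ^ (s - 2))
      have h3 : ∀ t ∈ Ioi (0 : ℝ), F t x ≤
          ENNReal.ofReal (4 * (‖x‖ ^ (-b) * ‖g x‖) ^ (2 : ℝ)) *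
            (if t ^ (r - 2) ≤ Q then ENNReal.ofReal (t ^ (r - 2 - 1)) else 0) := by
        intro t ht
        have ht0 : 0 < t := ht
        simp only [F]
        split_ifs with h4 h5 h5
        · rw [← ENNReal.ofReal_mul (by positivity)]
          refine ENNReal.ofReal_le_ofReal (le_of_eq (by ring))
        · refine absurd ?_ h5
          rw [← le_div_iff₀ (by positivity), Real.div_rpow ht0.le (by positivity),
            div_le_iff₀ (by positivity), mul_div_assoc, ← Real.rpow_sub hG] at h4
          refine h4.trans (le_of_eq ?_)
          simp only [Q]; ring
        · exact zero_le
        · exact zero_le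
      calc _ ≤ _ := setLIntegral_mono' measurableSet_Ioi h3
        _ ≤ ENNReal.ofReal (4 * (‖x‖ ^ (-b) * ‖g x‖) ^ (2 : ℝ)) * ENNReal.ofReal (Q / (r - 2)) := by
            rw [lintegral_const_mul _ (Measurable.ite (measurableSet_le (by fun_prop) (by fun_prop))
              (by fun_prop) measurable_const)]
            gcongr
            exact lintegral_Ioi_rpow_cut_le hr2 (by positivity)
        _ = _ := by
            rw [← ENNReal.ofReal_mul (by positivity), ← ENNReal.ofReal_mul (by positivity)]
            congr 1
            have e1 : ‖x‖ ^ (-b * 2) * ‖x‖ ^ (2 * b) = 1 := by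
              rw [← Real.rpow_add hX, show -b * 2 + 2 * b = 0 by ring, Real.rpow_zero]
            have e2 : ‖g x‖ ^ (2 : ℝ) * ‖g x‖ ^ (s - 2) = ‖g x‖ ^ s := by
              rw [← Real.rpow_add hG]; congr 1; ring
            rw [Real.mul_rpow (by positivity) hG.le, ← Real.rpow_mul hX.le, ← e2]
            simp only [Q]
            linear_combination (4 / (r - 2) * (2 * C * D) ^ (r - 2) *
              (‖g x‖ ^ (2 : ℝ) * ‖g x‖ ^ (s - 2))) * e1
    calc _ ≤ ENNReal.ofReal r * ∫⁻ t in Ioi (0 : ℝ), ∫⁻ x, F t x := by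
          exact mul_le_mul' le_rfl (setLIntegral_mono' measurableSet_Ioi h1)
      _ = ENNReal.ofReal r * ∫⁻ x, ∫⁻ t in Ioi (0 : ℝ), F t x := by
          rw [lintegral_lintegral_swap hFm.aemeasurable]
      _ ≤ ENNReal.ofReal r * (ENNReal.ofReal (4 / (r - 2) * (2 * C * D) ^ (r - 2)) * 1) := by
          gcongr
          refine (lintegral_mono h2).trans ?_
          rw [lintegral_const_mul _ (by fun_prop)]
          gcongr
      _ = _ := by
          rw [mul_one, ← ENNReal.ofReal_mul hr0.le]
          congr 1; ring
  have hB : 0 ≤ (4 * r / (r - 2) * (2 * C * D) ^ (r - 2)) ^ (1 / r) := by positivity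
  have hLp' : eLpNorm w (ENNReal.ofReal r) volume ≤
      ENNReal.ofReal ((4 * r / (r - 2) * (2 * C * D) ^ (r - 2)) ^ (1 / r)) := by
    rw [eLpNorm_ofReal_le_iff hr0 hB, ← Real.rpow_mul (by positivity), one_div_mul_cancel hr0.ne',
      Real.rpow_one]
    exact hLp
  rw [hwf]
  refine (norm_integral_mul_le_of_eLpNorm hr' hB hw.aestronglyMeasurable hLp' ψ).trans
    (le_of_eq ?_)
  congr 1
  have hDr : (D ^ (r - 2)) ^ (1 / r) =
      (4 * Real.pi) ^ (-((n : ℝ) / 2 * (1 - 2 / r))) * σ ^ (-((n : ℝ) / 2 * (1 - 2 / r))) := by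
    rw [← Real.mul_rpow (by positivity) hσ.le, ← Real.rpow_mul hD.le, ← Real.rpow_mul (by positivity)]
    congr 1
    field_simp
  rw [Real.mul_rpow (by positivity) hD.le, ← mul_assoc, Real.mul_rpow (by positivity) (by positivity),
    hDr]
  ring

theorem lintegral_ofReal_norm_rpow_le_of_eLpNorm {n : ℕ} {g : Rn n → ℂ} {s G : ℝ} (hs : 0 < s)
    (hG : 0 < G) (h : eLpNorm g (ENNReal.ofReal s) volume ≤ ENNReal.ofReal G) :
    ∫⁻ x, ENNReal.ofReal (‖((G⁻¹ : ℝ) : ℂ) * g x‖ ^ s) ≤ 1 := by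
  rw [eLpNorm_ofReal_le_iff hs hG.le] at h
  have e : ∀ x, ENNReal.ofReal (‖((G⁻¹ : ℝ) : ℂ) * g x‖ ^ s) =
      ENNReal.ofReal ((G ^ s)⁻¹) * ENNReal.ofReal (‖g x‖ ^ s) := by
    intro x
    rw [norm_mul, Complex.norm_real, Real.norm_of_nonneg (by positivity),
      Real.mul_rpow (by positivity) (norm_nonneg _), ENNReal.ofReal_mul (by positivity),
      Real.inv_rpow hG.le]
  simp_rw [e]
  rw [lintegral_const_mul' _ _ ENNReal.ofReal_ne_top]
  calc _ ≤ ENNReal.ofReal ((G ^ s)⁻¹) * ENNReal.ofReal (G ^ s) := by gcongr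
    _ = 1 := by
      rw [← ENNReal.ofReal_mul (by positivity), inv_mul_cancel₀ (by positivity), ENNReal.ofReal_one]

/-- The dispersive estimate `L^s → L^r` for `g ↦ e^{iσΔ}(|x|^{-b} g)`, in dual form. -/
theorem exists_strong_estimate {n : ℕ} (hn : 1 ≤ n) {b s r r' : ℝ} (hb : 0 < b) (hs : 1 < s)
    (hsr : s < r) (hr : 2 < r) (hrel : 1 / s + b / n = 1 - 1 / r) (hr' : r.HolderConjugate r') :
    ∃ C : ℝ, 0 < C ∧ ∀ (g : Rn n → ℂ) (G : ℝ), AEStronglyMeasurable g volume → 0 ≤ G →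
      eLpNorm g (ENNReal.ofReal s) volume ≤ ENNReal.ofReal G →
      IsTemperedFun (weighted b g) ∧ ∀ σ : ℝ, 0 < σ → ∀ ψ : 𝓢(Rn n, ℂ),
        ‖∫ x, propagator n σ ψ x * weighted b g x‖ ≤
          C * G * σ ^ (-((n : ℝ) / 2 * (1 - 2 / r))) * (∫ x, ‖ψ x‖ ^ r') ^ (1 / r') := by
  obtain ⟨C, hC, hCx⟩ := exists_strong_estimate_aux hn hb hs hsr hr hrel hr'
  have hs0 : 0 < s := by linarith
  refine ⟨C, hC, fun g G hg hG hgG => ?_⟩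
  rcases hG.eq_or_lt with h0 | h0
  · have hg0 : g =ᵐ[volume] 0 := by
      rw [← h0, ENNReal.ofReal_zero, nonpos_iff_eq_zero, eLpNorm_eq_zero_iff hg (by simpa using hs0)]
        at hgG
      exact hgG
    have hw0 : (fun _ => 0) =ᵐ[volume] weighted b g := by
      filter_upwards [hg0] with x hx
      simp [weighted, hx]
    refine ⟨isTemperedFun_congr (isTemperedFun_of_memLp (p := 1) le_rfl MemLp.zero') hw0,
      fun σ hσ ψ => ?_⟩
    have : ∫ x, propagator n σ ψ x * weighted b g x = 0 := by
      rw [← integral_zero (Rn n) ℂ]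
      refine integral_congr_ae ?_
      filter_upwards [hw0] with x hx
      rw [← hx, mul_zero]
    rw [this, norm_zero, ← h0]
    simp
  -- The estimate is linear in `g`, so a Borel representative is normalised to the unit ball of
  -- `L^s`.
  · let g' : Rn n → ℂ := fun x => ((G⁻¹ : ℝ) : ℂ) * hg.mk g x
    have hg' : Measurable g' := measurable_const.mul hg.stronglyMeasurable_mk.measurable
    have h1 := lintegral_ofReal_norm_rpow_le_of_eLpNorm hs0 h0
      ((eLpNorm_congr_ae hg.ae_eq_mk).symm.le.trans hgG)
    obtain ⟨hT, hb⟩ := hCx g' hg' h1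
    have hG0 : (G : ℂ) ≠ 0 := by exact_mod_cast h0.ne'
    have heq : (fun x => (G : ℂ) * weighted b g' x) =ᵐ[volume] weighted b g := by
      filter_upwards [hg.ae_eq_mk] with x hx
      simp only [weighted, g', ← hx]
      push_cast
      field_simp
    have hT' : IsTemperedFun fun x => (G : ℂ) * weighted b g' x := by
      obtain ⟨T, hT⟩ := hT
      refine ⟨(G : ℂ) • T, hT.1.const_mul _, fun ψ => ?_, fun ψ => ?_⟩
      · simp_rw [mul_left_comm]; exact (hT.2 ψ).const_mul _
      · simp_rw [mul_left_comm]
        rw [integral_const_mul, ← hT.3]; rfl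
    refine ⟨isTemperedFun_congr hT' heq, fun σ hσ ψ => ?_⟩
    have : ∫ x, propagator n σ ψ x * weighted b g x =
        (G : ℂ) * ∫ x, propagator n σ ψ x * weighted b g' x := by
      rw [← integral_const_mul]
      refine integral_congr_ae ?_
      filter_upwards [heq] with x hx
      rw [← hx]; ring
    rw [this, norm_mul, Complex.norm_real, Real.norm_of_nonneg hG]
    calc _ ≤ G * _ := mul_le_mul_of_nonneg_left (hb σ hσ ψ) hG
      _ = _ := by ring

/-! ### The weak estimate -/

theorem setLIntegral_Ioc_rpow {h m : ℝ} (hh : 0 < h) (hm : 0 < m) :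
    ∫⁻ t in Ioc 0 h, ENNReal.ofReal (t ^ (m - 1)) = ENNReal.ofReal (h ^ m / m) := by
  have h2 : IntervalIntegrable (fun t : ℝ => t ^ (m - 1)) volume 0 h :=
    intervalIntegral.intervalIntegrable_rpow' (by linarith)
  have h3 := (intervalIntegrable_iff_integrableOn_Ioc_of_le hh.le).1 h2
  rw [← ofReal_integral_eq_lintegral_ofReal h3, ← intervalIntegral.integral_of_le hh.le,
    integral_rpow (Or.inl (by linarith)), sub_add_cancel, Real.zero_rpow hm.ne', sub_zero]
  rw [EventuallyLE, ae_restrict_iff' measurableSet_Ioc]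
  exact Eventually.of_forall fun t ht => Real.rpow_nonneg ht.1.le _

theorem setLIntegral_Ioi_rpow_neg {h m : ℝ} (hh : 0 < h) (hm : 1 < m) :
    ∫⁻ t in Ioi h, ENNReal.ofReal (t ^ (-m)) = ENNReal.ofReal (h ^ (1 - m) / (m - 1)) := by
  have h3 := integrableOn_Ioi_rpow_of_lt (a := -m) (by linarith) hh
  rw [← ofReal_integral_eq_lintegral_ofReal h3, integral_Ioi_rpow_of_lt (by linarith) hh]
  · congr 1
    rw [neg_div, ← div_neg]
    congr 2 <;> ring
  · rw [EventuallyLE, ae_restrict_iff' measurableSet_Ioi]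
    exact Eventually.of_forall fun t ht => Real.rpow_nonneg (hh.trans ht).le _

/-- With the next lemma, this places weak `L^ρ`, `1 < ρ < 2`, inside `L¹ + L²` with explicit
constants: the tail integral of the distribution function above `h` converges because `ρ > 1`, and
the one near zero, for the square, because `ρ < 2`. -/
theorem setLIntegral_lt_norm_le {n : ℕ} {F : Rn n → ℂ} (hF : Measurable F) {A ρ : ℝ} (hA : 0 < A)
    (hρ : 1 < ρ) (hw : ∀ h : ℝ, 0 < h → volume {x | h < ‖F x‖} ≤ ENNReal.ofReal ((A / h) ^ ρ))
    {h : ℝ} (hh : 0 < h) : ∫⁻ x in {x | h < ‖F x‖}, ‖F x‖ₑ ≤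
      ENNReal.ofReal (ρ / (ρ - 1) * (A ^ ρ * h ^ (1 - ρ))) := by
  have hρ1 : 0 < ρ - 1 := by linarith
  have hS : MeasurableSet {x | h < ‖F x‖} := measurableSet_lt measurable_const hF.norm
  have e := lintegral_rpow_eq_lintegral_meas_lt_mul (volume.restrict {x | h < ‖F x‖})
    (f := fun x => ‖F x‖) (Eventually.of_forall fun x => norm_nonneg _)
    hF.norm.aemeasurable one_pos
  simp only [Real.rpow_one, sub_self, Real.rpow_zero, ENNReal.ofReal_one, one_mul, mul_one,
    ofReal_norm] at e
  rw [e, ← Ioc_union_Ioi_eq_Ioi hh.le]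
  refine (lintegral_union_le _ _ _).trans ?_
  have h1 : ∫⁻ t in Ioc 0 h, volume.restrict {x | h < ‖F x‖} {x | t < ‖F x‖} ≤
      ENNReal.ofReal ((A / h) ^ ρ * h) := by
    calc _ ≤ ∫⁻ _ in Ioc 0 h, ENNReal.ofReal ((A / h) ^ ρ) := by
          refine lintegral_mono fun t => ?_
          rw [Measure.restrict_apply' hS]
          exact (measure_mono inter_subset_right).trans (hw h hh)
      _ = _ := by
          rw [lintegral_const, Measure.restrict_apply_univ, Real.volume_Ioc, sub_zero,
            ENNReal.ofReal_mul (by positivity)]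
  have h2 : ∫⁻ t in Ioi h, volume.restrict {x | h < ‖F x‖} {x | t < ‖F x‖} ≤
      ENNReal.ofReal (A ^ ρ * (h ^ (1 - ρ) / (ρ - 1))) := by
    calc _ ≤ ∫⁻ t in Ioi h, ENNReal.ofReal (A ^ ρ) * ENNReal.ofReal (t ^ (-ρ)) := by
          refine setLIntegral_mono' measurableSet_Ioi fun t ht => ?_
          have ht0 : 0 < t := hh.trans ht
          rw [Measure.restrict_apply' hS, ← ENNReal.ofReal_mul (by positivity),
            Real.rpow_neg ht0.le, ← div_eq_mul_inv, ← Real.div_rpow hA.le ht0.le]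
          exact (measure_mono inter_subset_left).trans (hw t ht0)
      _ = _ := by
          rw [lintegral_const_mul _ (by fun_prop), setLIntegral_Ioi_rpow_neg hh hρ,
            ← ENNReal.ofReal_mul (by positivity)]
  refine (add_le_add h1 h2).trans ?_
  rw [← ENNReal.ofReal_add (by positivity) (by positivity)]
  refine ENNReal.ofReal_le_ofReal (le_of_eq ?_)
  rw [Real.div_rpow hA.le hh.le, Real.rpow_sub hh, Real.rpow_one]
  field_simp
  ring

theorem setLIntegral_not_lt_norm_le {n : ℕ} {F : Rn n → ℂ} (hF : Measurable F) {A ρ : ℝ}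
    (hA : 0 < A) (hρ : ρ < 2)
    (hw : ∀ h : ℝ, 0 < h → volume {x | h < ‖F x‖} ≤ ENNReal.ofReal ((A / h) ^ ρ))
    {h : ℝ} (hh : 0 < h) : ∫⁻ x in {x | h < ‖F x‖}ᶜ, ‖F x‖ₑ ^ (2 : ℝ) ≤
      ENNReal.ofReal (2 / (2 - ρ) * (A ^ ρ * h ^ (2 - ρ))) := by
  have hρ1 : 0 < 2 - ρ := by linarith
  have hS : MeasurableSet {x | h < ‖F x‖}ᶜ := (measurableSet_lt measurable_const hF.norm).compl
  have e := lintegral_rpow_eq_lintegral_meas_lt_mul (volume.restrict {x | h < ‖F x‖}ᶜ)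
    (f := fun x => ‖F x‖) (Eventually.of_forall fun x => norm_nonneg _)
    hF.norm.aemeasurable two_pos
  simp_rw [← ENNReal.ofReal_rpow_of_nonneg (norm_nonneg _) two_pos.le, ofReal_norm] at e
  rw [e, ← Ioc_union_Ioi_eq_Ioi hh.le]
  have h2 : ∫⁻ t in Ioi h, volume.restrict {x | h < ‖F x‖}ᶜ {x | t < ‖F x‖} *
      ENNReal.ofReal (t ^ ((2 : ℝ) - 1)) = 0 := by
    rw [setLIntegral_congr_fun (g := fun _ => 0) measurableSet_Ioi]
    · simp
    · intro t ht
      have : {x | t < ‖F x‖} ∩ {x | h < ‖F x‖}ᶜ = ∅ := by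
        ext x
        simp only [mem_inter_iff, mem_ofPred_eq, mem_compl_iff, mem_empty_iff_false, iff_false,
          not_and, not_not]
        exact fun hx => (show h < t from ht).trans hx
      simp only
      rw [Measure.restrict_apply' hS, this, measure_empty, zero_mul]
  have h1 : ∫⁻ t in Ioc 0 h, volume.restrict {x | h < ‖F x‖}ᶜ {x | t < ‖F x‖} *
      ENNReal.ofReal (t ^ ((2 : ℝ) - 1)) ≤ ENNReal.ofReal (A ^ ρ * (h ^ (2 - ρ) / (2 - ρ))) := by
    calc _ ≤ ∫⁻ t in Ioc 0 h, ENNReal.ofReal (A ^ ρ) * ENNReal.ofReal (t ^ ((2 - ρ) - 1)) := by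
          refine setLIntegral_mono' measurableSet_Ioc fun t ht => ?_
          have ht0 : 0 < t := ht.1
          calc _ ≤ ENNReal.ofReal ((A / t) ^ ρ) * ENNReal.ofReal (t ^ ((2 : ℝ) - 1)) := by
                gcongr
                rw [Measure.restrict_apply' hS]
                exact (measure_mono inter_subset_left).trans (hw t ht0)
            _ = _ := by
                rw [← ENNReal.ofReal_mul (by positivity), ← ENNReal.ofReal_mul (by positivity),
                  Real.div_rpow hA.le ht0.le, show 2 - ρ - 1 = (2 - 1) - ρ by ring,
                  Real.rpow_sub ht0 (2 - 1)]
                congr 1; ring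
      _ = _ := by
          rw [lintegral_const_mul _ (by fun_prop), setLIntegral_Ioc_rpow hh hρ1,
            ← ENNReal.ofReal_mul (by positivity)]
  calc _ ≤ ENNReal.ofReal 2 * (ENNReal.ofReal (A ^ ρ * (h ^ (2 - ρ) / (2 - ρ))) + 0) := by
        refine mul_le_mul' le_rfl ((lintegral_union_le _ _ _).trans ?_)
        rw [h2]
        exact add_le_add h1 le_rfl
    _ = _ := by
        rw [add_zero, ← ENNReal.ofReal_mul two_pos.le]
        congr 1; ring

theorem schwartz_eq_zero_of_integral {n : ℕ} {ψ : 𝓢(Rn n, ℂ)} {p : ℝ} (hp : 0 < p)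
    (h : ∫ x, ‖ψ x‖ ^ p = 0) : ψ = 0 := by
  have := (integral_eq_zero_iff_of_nonneg (fun x => by positivity)
    (integrable_norm_rpow_schwartz ψ hp)).1 h
  have h3 := (Continuous.ae_eq_iff_eq volume (ψ.continuous.norm.rpow_const fun _ => Or.inr hp.le)
    continuous_const).1 this
  ext x
  have h4 : ‖ψ x‖ ^ p = 0 := congrFun h3 x
  exact norm_eq_zero.1 ((Real.rpow_eq_zero (norm_nonneg _) hp.ne').1 h4)

/-- The dispersive estimate on weak `L^{r'}`, in dual form. -/
theorem exists_weak_estimate (n : ℕ) {r r' : ℝ} (hr : 2 < r) (hr' : r.HolderConjugate r') :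
    ∃ C : ℝ, 0 < C ∧ ∀ (F : Rn n → ℂ) (A : ℝ), AEStronglyMeasurable F volume → 0 < A →
      (∀ h : ℝ, 0 < h → volume {x | h < ‖F x‖} ≤ ENNReal.ofReal ((A / h) ^ r')) →
      ∀ σ : ℝ, 0 < σ → ∀ ψ : 𝓢(Rn n, ℂ),
        ‖∫ x, propagator n σ ψ x * F x‖ ≤
          C * A * σ ^ (-((n : ℝ) / 2 * (1 - 2 / r))) *
            ((∫ x, ‖ψ x‖) ^ (1 - 2 / r) * (∫ x, ‖ψ x‖ ^ (2 : ℝ)) ^ (1 / r)) := by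
  have hr0 : 0 < r := by linarith
  have hr'1 : 1 < r' := hr'.symm.lt
  have hinv : 1 / r + 1 / r' = 1 := by
    rw [one_div, one_div]; exact hr'.inv_add_inv_eq_one
  have hr'0 : 0 < r' := by linarith
  have hr'2 : r' < 2 := by
    have h1 : 1 / r < 1 / 2 := one_div_lt_one_div_of_lt two_pos hr
    have h2 : 1 / 2 < 1 / r' := by linarith
    exact (one_div_lt_one_div two_pos hr'0).1 h2
  let c₁ := r' / (r' - 1)
  let c₂ := (2 / (2 - r')) ^ (1 / (2 : ℝ))
  have hc₁ : 0 < c₁ := div_pos hr'0 (by linarith)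
  have hc₂ : 0 < c₂ := Real.rpow_pos_of_pos (div_pos two_pos (by linarith)) _
  refine ⟨(c₁ + c₂) * (4 * Real.pi) ^ (-((n : ℝ) / 2 * (1 - 2 / r))), by positivity,
    fun F' A hF' hA hw' σ hσ ψ => ?_⟩
  let F := hF'.mk F'
  have hF : Measurable F := hF'.stronglyMeasurable_mk.measurable
  have hFF : F' =ᵐ[volume] F := hF'.ae_eq_mk
  have hw : ∀ h : ℝ, 0 < h → volume {x | h < ‖F x‖} ≤ ENNReal.ofReal ((A / h) ^ r') := by
    intro h hh
    refine le_trans (measure_mono_ae ?_) (hw' h hh)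
    filter_upwards [hFF] with x hx hx'
    show h < ‖F' x‖
    rw [hx]; exact hx'
  have hint : ∫ x, propagator n σ ψ x * F' x = ∫ x, propagator n σ ψ x * F x := by
    refine integral_congr_ae ?_
    filter_upwards [hFF] with x hx
    rw [hx]
  rw [hint]
  by_cases hψ : ψ = 0
  · rw [hψ]
    simp only [map_zero, zero_apply, zero_mul, integral_zero, norm_zero]
    positivity
  set N₁ := ∫ x, ‖ψ x‖
  set S₂ := ∫ x, ‖ψ x‖ ^ (2 : ℝ)
  have hN₁ : 0 < N₁ := by
    refine lt_of_le_of_ne (integral_nonneg fun x => norm_nonneg _) fun h0 => hψ ?_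
    exact schwartz_eq_zero_of_integral one_pos (by simp only [Real.rpow_one]; exact h0.symm)
  have hS₂ : 0 < S₂ := by
    refine lt_of_le_of_ne (integral_nonneg fun x => by positivity) fun h0 => hψ ?_
    exact schwartz_eq_zero_of_integral two_pos h0.symm
  set D := (4 * Real.pi * σ) ^ (-((n : ℝ) / 2))
  have hD : 0 < D := by positivity
  set N₂ := S₂ ^ (1 / (2 : ℝ))
  have hN₂ : 0 < N₂ := by positivity
  -- The height `h` of the cut balances the `L¹` and `L²` contributions, both becoming multiples of
  -- `A X^{1-2/r} N₂`. The result is a product of powers of the `L¹` and `L²` norms of `ψ`, which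
  -- for an indicator function of `E` is `|E|^{1-1/r}`, as a weak `L^r` bound requires.
  let X := D * N₁ / N₂
  have hX : 0 < X := by positivity
  let h := A * X ^ (2 / r')
  have hh : 0 < h := by positivity
  have hsplit : SplitBound F {x | h < ‖F x‖} (c₁ * (A ^ r' * h ^ (1 - r')))
      (c₂ * (A ^ (r' / 2) * h ^ (1 - r' / 2))) := by
    refine ⟨hF.aestronglyMeasurable, measurableSet_lt measurable_const hF.norm, by positivity,
      by positivity, setLIntegral_lt_norm_le hF hA hr'1 hw hh,
      (setLIntegral_not_lt_norm_le hF hA hr'2 hw hh).trans (le_of_eq ?_)⟩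
    congr 1
    have q1 : c₂ ^ (2 : ℝ) = 2 / (2 - r') := by
      simp only [c₂]
      rw [← Real.rpow_mul (div_pos two_pos (by linarith)).le, one_div_mul_cancel two_ne_zero,
        Real.rpow_one]
    have q2 : (A ^ (r' / 2)) ^ (2 : ℝ) = A ^ r' := by
      rw [← Real.rpow_mul hA.le, div_mul_cancel₀ _ two_ne_zero]
    have q3 : (h ^ (1 - r' / 2)) ^ (2 : ℝ) = h ^ (2 - r') := by
      rw [← Real.rpow_mul hh.le]; congr 1; ring
    rw [Real.mul_rpow hc₂.le (by positivity),
      Real.mul_rpow (x := A ^ (r' / 2)) (by positivity) (by positivity), q1, q2, q3]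
  have hb := hsplit.norm_integral_le hσ ψ
  change _ ≤ D * _ * N₁ + _ * N₂ at hb
  refine hb.trans (le_of_eq ?_)
  have hθ : 2 / r' - 1 = 1 - 2 / r := by
    have : 2 * (1 / r + 1 / r') = 2 := by rw [hinv]; ring
    linear_combination this
  have e1 : A ^ r' * h ^ (1 - r') * X = A * X ^ (1 - 2 / r) := by
    simp only [h]
    rw [Real.mul_rpow hA.le (by positivity), ← Real.rpow_mul hX.le]
    calc _ = (A ^ r' * A ^ (1 - r')) * (X ^ (2 / r' * (1 - r')) * X ^ (1 : ℝ)) := by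
          rw [Real.rpow_one]; ring
      _ = _ := by
          rw [← Real.rpow_add hA, ← Real.rpow_add hX, ← hθ]
          congr 2
          · rw [show r' + (1 - r') = 1 by ring, Real.rpow_one]
          · field_simp; ring
  have e2 : A ^ (r' / 2) * h ^ (1 - r' / 2) = A * X ^ (1 - 2 / r) := by
    simp only [h]
    rw [Real.mul_rpow hA.le (by positivity), ← Real.rpow_mul hX.le, ← mul_assoc, ← Real.rpow_add hA,
      ← hθ]
    congr 2
    · rw [show r' / 2 + (1 - r' / 2) = 1 by ring, Real.rpow_one]
    · field_simp
  have e3 : D * N₁ = X * N₂ := by simp only [X]; field_simp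
  have e4 : X ^ (1 - 2 / r) * N₂ = (4 * Real.pi) ^ (-((n : ℝ) / 2 * (1 - 2 / r))) *
      σ ^ (-((n : ℝ) / 2 * (1 - 2 / r))) * (N₁ ^ (1 - 2 / r) * S₂ ^ (1 / r)) := by
    simp only [X]
    rw [Real.div_rpow (by positivity) hN₂.le, Real.mul_rpow hD.le hN₁.le,
      ← Real.mul_rpow (by positivity) hσ.le, ← Real.rpow_mul (by positivity)]
    have e5 : N₂ ^ (1 - 2 / r) * S₂ ^ (1 / r) = N₂ := by
      simp only [N₂]
      rw [← Real.rpow_mul hS₂.le, ← Real.rpow_add hS₂]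
      congr 1; field_simp; ring
    rw [div_mul_eq_mul_div, div_eq_iff (by positivity), neg_mul]
    linear_combination (-((4 * Real.pi * σ) ^ (-((n : ℝ) / 2 * (1 - 2 / r))) * N₁ ^ (1 - 2 / r))) * e5
  calc _ = c₁ * (A ^ r' * h ^ (1 - r') * X) * N₂ + c₂ * (A ^ (r' / 2) * h ^ (1 - r' / 2)) * N₂ := by
        linear_combination (c₁ * (A ^ r' * h ^ (1 - r'))) * e3
    _ = (c₁ + c₂) * A * (X ^ (1 - 2 / r) * N₂) := by rw [e1, e2]; ring
    _ = _ := by rw [e4]; ring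

/-! ### Lorentz quasi-norms -/

theorem antitone_decRearrangement {n : ℕ} (f : Rn n → ℂ) : Antitone (decRearrangement f) :=
  fun _ _ hst => sInf_le_sInf fun _ hl => le_trans hl (ENNReal.ofReal_le_ofReal hst)

theorem setOf_ofReal_lt_enorm {n : ℕ} (f : Rn n → ℂ) {l : ℝ} (hl : 0 ≤ l) :
    {x | ENNReal.ofReal l < ‖f x‖ₑ} = {x | l < ‖f x‖} := by
  ext x
  show ENNReal.ofReal l < ‖f x‖ₑ ↔ l < ‖f x‖
  rw [← ofReal_norm, ENNReal.ofReal_lt_ofReal_iff_of_nonneg hl]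

theorem le_decRearrangement {n : ℕ} {f : Rn n → ℂ} {l t : ℝ} (hl : 0 ≤ l)
    (h : ENNReal.ofReal t < volume {x | l < ‖f x‖}) : ENNReal.ofReal l ≤ decRearrangement f t := by
  refine le_sInf fun l' hl' => ?_
  by_contra hlt
  push Not at hlt
  rw [← setOf_ofReal_lt_enorm f hl] at h
  exact absurd (h.trans_le ((measure_mono fun x hx => hlt.trans hx).trans hl')) (lt_irrefl _)

theorem decRearrangement_le {n : ℕ} {f : Rn n → ℂ} {l t : ℝ} (hl : 0 ≤ l)
    (h : volume {x | l < ‖f x‖} ≤ ENNReal.ofReal t) : decRearrangement f t ≤ ENNReal.ofReal l := by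
  refine sInf_le ?_
  rw [← setOf_ofReal_lt_enorm f hl] at h
  exact h

/-- The rearrangement is at least `l` on `(0, t]`, and the normalising factor `q/r` makes `(q/r) ∫₀ᵗ
s^{q/r-1} ds` equal to `t^{q/r}`, so no constant is lost. -/
theorem mul_rpow_le_lorentzNorm {n : ℕ} {f : Rn n → ℂ} {l t r : ℝ} {q : ℝ≥0∞} (hl : 0 ≤ l)
    (ht : 0 < t) (hr : 0 < r) (hq : 0 < q) (h : ENNReal.ofReal t < volume {x | l < ‖f x‖}) :
    ENNReal.ofReal (l * t ^ (1 / r)) ≤ lorentzNorm r q f := by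
  have h1 := le_decRearrangement hl h
  unfold lorentzNorm
  split_ifs with hqt
  · refine le_trans ?_ (le_iSup _ (⟨t, ht⟩ : Ioi (0 : ℝ)))
    rw [mul_comm, ENNReal.ofReal_mul (by positivity)]
    gcongr
  · set m := q.toReal
    have hm : 0 < m := ENNReal.toReal_pos hq.ne' hqt
    rw [one_div m, ENNReal.le_rpow_inv_iff hm]
    calc ENNReal.ofReal (l * t ^ (1 / r)) ^ m
        = ENNReal.ofReal (m / r) * (ENNReal.ofReal (l ^ m) * ENNReal.ofReal (t ^ (m / r) / (m / r))) := by
          rw [ENNReal.ofReal_rpow_of_nonneg (by positivity) hm.le,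
            Real.mul_rpow hl (by positivity), ← Real.rpow_mul ht.le,
            ← ENNReal.ofReal_mul (by positivity), ← ENNReal.ofReal_mul (by positivity)]
          congr 1
          rw [one_div_mul_eq_div]
          field_simp
      _ ≤ _ := by
          refine mul_le_mul' le_rfl ?_
          rw [← setLIntegral_Ioc_rpow ht (by positivity : 0 < m / r),
            ← lintegral_const_mul _ (by fun_prop)]
          refine le_trans (setLIntegral_mono' measurableSet_Ioc fun s hs => ?_)
            (lintegral_mono_set Ioc_subset_Ioi_self)
          have hs0 : 0 < s := hs.1
          calc _ = (ENNReal.ofReal (s ^ (1 / r)) * ENNReal.ofReal l) ^ m *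
                ENNReal.ofReal (1 / s) := by
                rw [← ENNReal.ofReal_mul (p := s ^ (1 / r)) (by positivity),
                  ENNReal.ofReal_rpow_of_nonneg (by positivity) hm.le,
                  ← ENNReal.ofReal_mul (by positivity), ← ENNReal.ofReal_mul (by positivity),
                  Real.mul_rpow (by positivity) hl, ← Real.rpow_mul hs0.le, Real.rpow_sub hs0,
                  Real.rpow_one, one_div_mul_eq_div]
                congr 1; ring
            _ ≤ _ := by
                gcongr
                exact h1.trans (antitone_decRearrangement f hs.2)

/-- The Lorentz space `L^{r,q}` is contained in weak `L^r`. -/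
theorem measure_lt_norm_le_of_lorentzNorm {n : ℕ} {f : Rn n → ℂ} {M r : ℝ} {q : ℝ≥0∞} (hM : 0 ≤ M)
    (hr : 0 < r) (hq : 0 < q) (h : lorentzNorm r q f ≤ ENNReal.ofReal M) {l : ℝ} (hl : 0 < l) :
    volume {x | l < ‖f x‖} ≤ ENNReal.ofReal ((M / l) ^ r) := by
  by_contra hlt
  push Not at hlt
  obtain ⟨t', ht'1, ht'2⟩ := exists_between hlt
  have hfin : t' ≠ ∞ := ht'2.ne_top
  set t := t'.toReal
  have ht't : t' = ENNReal.ofReal t := (ENNReal.ofReal_toReal hfin).symm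
  rw [ht't] at ht'1 ht'2
  have hT : (M / l) ^ r < t := by
    rwa [ENNReal.ofReal_lt_ofReal_iff_of_nonneg (by positivity)] at ht'1
  have ht0 : 0 < t := lt_of_le_of_lt (by positivity) hT
  have h1 := (mul_rpow_le_lorentzNorm hl.le ht0 hr hq ht'2).trans h
  rw [ENNReal.ofReal_le_ofReal_iff hM] at h1
  have h2 := Real.rpow_lt_rpow (by positivity) hT (by positivity : 0 < 1 / r)
  rw [← Real.rpow_mul (by positivity), mul_one_div_cancel hr.ne', Real.rpow_one,
    div_lt_iff₀ hl] at h2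
  linarith

/-- For decreasing `F` with primitive `Φ`, `t F(t) ≤ Φ(t)`; hence `m t^{m-1} F^m ≤ m Φ^{m-1} F`, the
derivative of `Φ^m` off the countable set of jumps of `F`. This sharp inequality is why the
embedding of `L^r` into `L^{r,q}` has constant one. -/
theorem integral_mul_rpow_le_of_antitone {F : ℝ → ℝ} (hF : Antitone F) (hF0 : ∀ t, 0 ≤ F t) {m : ℝ}
    (hm : 1 < m) {T : ℝ} (hT : 0 ≤ T) :
    ∫ t in (0 : ℝ)..T, m * (t ^ (m - 1) * F t ^ m) ≤ (∫ t in (0 : ℝ)..T, F t) ^ m := by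
  have hFi : ∀ a b, IntervalIntegrable F volume a b := fun a b => hF.intervalIntegrable
  let Φ : ℝ → ℝ := fun t => ∫ s in (0 : ℝ)..t, F s
  have hΦc : Continuous Φ := intervalIntegral.continuous_primitive hFi 0
  have hΦ : ∀ t, 0 ≤ t → t * F t ≤ Φ t := by
    intro t ht
    have h1 := intervalIntegral.integral_mono_on (μ := volume) ht
      (intervalIntegrable_const (c := F t)) (hFi 0 t) (fun s hs => hF hs.2)
    rwa [intervalIntegral.integral_const, sub_zero, smul_eq_mul] at h1
  have hΦ0 : ∀ t, 0 ≤ t → 0 ≤ Φ t := fun t ht => (mul_nonneg ht (hF0 t)).trans (hΦ t ht)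
  have hmc : Continuous fun t => m * Φ t ^ (m - 1) :=
    continuous_const.mul (hΦc.rpow_const fun _ => Or.inr (by linarith))
  have hI : IntervalIntegrable (fun t => m * Φ t ^ (m - 1) * F t) volume 0 T :=
    (hFi 0 T).continuousOn_mul hmc.continuousOn
  have hftc := integral_eq_of_hasDerivAt_off_countable_of_le (fun t => Φ t ^ m)
    (fun t => m * Φ t ^ (m - 1) * F t) hT hF.countable_not_continuousAt
    (hΦc.rpow_const fun _ => Or.inr (by linarith)).continuousOn (fun t ht => by
      have hc : ContinuousAt F t := by
        by_contra hc
        exact ht.2 hc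
      have h1 : HasDerivAt Φ (F t) t := intervalIntegral.integral_hasDerivAt_right (hFi 0 t)
        (hF.measurable.stronglyMeasurable.stronglyMeasurableAtFilter) hc
      have := h1.rpow_const (p := m) (Or.inr hm.le)
      convert! this using 1
      ring) hI
  have hΦ00 : Φ 0 = 0 := intervalIntegral.integral_same
  simp only [hΦ00, Real.zero_rpow (by linarith : m ≠ 0), sub_zero] at hftc
  change _ ≤ Φ T ^ m
  rw [← hftc]
  have hFm : Antitone fun t => F t ^ m := fun s t hst =>
    Real.rpow_le_rpow (hF0 t) (hF hst) (by linarith)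
  refine intervalIntegral.integral_mono_on hT ?_ hI fun t ht => ?_
  · refine IntervalIntegrable.const_mul ?_ _
    refine IntervalIntegrable.continuousOn_mul hFm.intervalIntegrable ?_
    exact (continuous_id.rpow_const fun _ => Or.inr (by linarith)).continuousOn
  · have h1 : t ^ (m - 1) * F t ^ m = (t * F t) ^ (m - 1) * F t := by
      rw [Real.mul_rpow ht.1 (hF0 t), mul_assoc]
      congr 1
      conv_rhs => rw [← Real.rpow_one (F t), Real.rpow_one (F t)]
      rcases (hF0 t).eq_or_lt with h | h
      · rw [← h, mul_zero, Real.zero_rpow (by linarith)]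
      · nth_rewrite 3 [← Real.rpow_one (F t)]
        rw [← Real.rpow_add h, sub_add_cancel]
    rw [h1, mul_assoc]
    refine mul_le_mul_of_nonneg_left ?_ (by linarith)
    refine mul_le_mul_of_nonneg_right ?_ (hF0 t)
    exact Real.rpow_le_rpow (mul_nonneg ht.1 (hF0 t)) (hΦ t ht.1) (by linarith)

theorem measure_lt_norm_le_of_eLpNorm {n : ℕ} {f : Rn n → ℂ} {N r : ℝ}
    (hf : AEStronglyMeasurable f volume) (hr : 0 < r) (hN : 0 ≤ N)
    (h : eLpNorm f (ENNReal.ofReal r) volume ≤ ENNReal.ofReal N) {l : ℝ} (hl : 0 < l) :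
    volume {x | l < ‖f x‖} ≤ ENNReal.ofReal ((N / l) ^ r) := by
  have h1 := meas_ge_le_mul_pow_eLpNorm_enorm (μ := (volume : Measure (Rn n))) (f := f)
    (p := ENNReal.ofReal r) (by simpa using hr)
    ENNReal.ofReal_ne_top hf (ε := ENNReal.ofReal l) (by simpa using hl) (by simp)
  rw [ENNReal.toReal_ofReal hr.le] at h1
  calc _ ≤ volume {x | ENNReal.ofReal l ≤ ‖f x‖ₑ} := by
        rw [← setOf_ofReal_lt_enorm f hl.le]
        exact measure_mono fun x hx => (show ENNReal.ofReal l < ‖f x‖ₑ from hx).le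
    _ ≤ _ := h1
    _ ≤ (ENNReal.ofReal l)⁻¹ ^ r * ENNReal.ofReal N ^ r := by gcongr
    _ = _ := by
        rw [← ENNReal.mul_rpow_of_nonneg _ _ hr.le, ← ENNReal.ofReal_inv_of_pos hl,
          ← ENNReal.ofReal_mul (by positivity), ENNReal.ofReal_rpow_of_nonneg (by positivity) hr.le,
          inv_mul_eq_div]

theorem decRearrangement_le_of_eLpNorm {n : ℕ} {f : Rn n → ℂ} {N r : ℝ}
    (hf : AEStronglyMeasurable f volume) (hr : 0 < r) (hN : 0 < N)
    (h : eLpNorm f (ENNReal.ofReal r) volume ≤ ENNReal.ofReal N) {t : ℝ} (ht : 0 < t) :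
    decRearrangement f t ≤ ENNReal.ofReal (N * t ^ (-(1 / r))) := by
  refine decRearrangement_le (by positivity)
    ((measure_lt_norm_le_of_eLpNorm hf hr hN.le h (by positivity)).trans (le_of_eq ?_))
  congr 1
  rw [Real.rpow_neg ht.le, ← div_eq_mul_inv, div_div_cancel₀ hN.ne', ← Real.rpow_mul ht.le,
    one_div_mul_cancel hr.ne', Real.rpow_one]

/-- The rearrangement exceeds `l` on a set of measure at most that of the set where `|f| > l`; the
layer-cake formula applies on both sides. -/
theorem setLIntegral_decRearrangement_le {n : ℕ} {f : Rn n → ℂ} {N r : ℝ}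
    (hf : AEStronglyMeasurable f volume) (hr : 0 < r) (hN : 0 < N)
    (h : eLpNorm f (ENNReal.ofReal r) volume ≤ ENNReal.ofReal N) :
    ∫⁻ t in Ioi (0 : ℝ), ENNReal.ofReal ((decRearrangement f t).toReal ^ r) ≤
      ENNReal.ofReal (N ^ r) := by
  have h2 := (eLpNorm_ofReal_le_iff hr hN.le).1 h
  refine le_trans ?_ h2
  rw [lintegral_rpow_eq_lintegral_meas_lt_mul volume (Eventually.of_forall fun x => norm_nonneg _)
      hf.norm.aemeasurable hr, lintegral_rpow_eq_lintegral_meas_lt_mul _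
      (Eventually.of_forall fun t => ENNReal.toReal_nonneg)
      (antitone_decRearrangement f).measurable.ennreal_toReal.aemeasurable hr]
  refine mul_le_mul' le_rfl (setLIntegral_mono' measurableSet_Ioi fun l hl => ?_)
  refine mul_le_mul' ?_ le_rfl
  have hl0 : 0 < l := hl
  have hfin : volume {x | l < ‖f x‖} ≠ ∞ :=
    ((measure_lt_norm_le_of_eLpNorm hf hr hN.le h hl0).trans_lt ENNReal.ofReal_lt_top).ne
  rw [Measure.restrict_apply' measurableSet_Ioi]
  calc _ ≤ volume (Ioc 0 (volume {x | l < ‖f x‖}).toReal) := by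
        refine measure_mono fun t ht => ⟨ht.2, ?_⟩
        by_contra hlt
        push Not at hlt
        have h3 : decRearrangement f t ≤ ENNReal.ofReal l := decRearrangement_le hl0.le (by
          rw [← ENNReal.ofReal_toReal hfin]
          exact ENNReal.ofReal_le_ofReal hlt.le)
        have h4 := ENNReal.toReal_mono ENNReal.ofReal_ne_top h3
        rw [ENNReal.toReal_ofReal hl0.le] at h4
        exact absurd (show l < (decRearrangement f t).toReal from ht.1) (not_lt.2 h4)
    _ = _ := by rw [Real.volume_Ioc, sub_zero, ENNReal.ofReal_toReal hfin]

/-- `L^r` embeds into `L^{r,q}` with constant one. -/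
theorem lorentzNorm_le_of_eLpNorm {n : ℕ} {f : Rn n → ℂ} {N r : ℝ} {q : ℝ≥0∞}
    (hf : AEStronglyMeasurable f volume) (hr : 0 < r) (hN : 0 < N) (hq : ENNReal.ofReal r < q)
    (h : eLpNorm f (ENNReal.ofReal r) volume ≤ ENNReal.ofReal N) :
    lorentzNorm r q f ≤ ENNReal.ofReal N := by
  have hdec : ∀ t : ℝ, 0 < t → decRearrangement f t ≤ ENNReal.ofReal (N * t ^ (-(1 / r))) :=
    fun t ht => decRearrangement_le_of_eLpNorm hf hr hN h ht
  unfold lorentzNorm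
  split_ifs with hqt
  · refine iSup_le fun t => ?_
    have ht : (0 : ℝ) < t := t.2
    refine (mul_le_mul' le_rfl (hdec t ht)).trans ?_
    rw [← ENNReal.ofReal_mul (by positivity), mul_left_comm, ← Real.rpow_add ht, add_neg_cancel,
      Real.rpow_zero, mul_one]
  · have hQ : r < q.toReal := by rwa [← ENNReal.ofReal_lt_iff_lt_toReal hr.le hqt]
    set Q := q.toReal
    have hQ0 : 0 < Q := hr.trans hQ
    -- With `G = (f*)^r` the Lorentz integral becomes `∫ m t^{m-1} G^m`, the form of
    -- `integral_mul_rpow_le_of_antitone`; `m > 1` is the hypothesis `q > r`.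
    let m := Q / r
    have hm : 1 < m := (one_lt_div hr).2 hQ
    have hfin : ∀ t : ℝ, 0 < t → decRearrangement f t ≠ ∞ := fun t ht =>
      ((hdec t ht).trans_lt ENNReal.ofReal_lt_top).ne
    let G : ℝ → ℝ := fun t => (decRearrangement f t).toReal ^ r
    have hGm : Measurable G :=
      (antitone_decRearrangement f).measurable.ennreal_toReal.pow_const r
    rw [one_div Q, ENNReal.rpow_inv_le_iff hQ0]
    have hint : ∀ t ∈ Ioi (0 : ℝ), ENNReal.ofReal m *
        ((ENNReal.ofReal (t ^ (1 / r)) * decRearrangement f t) ^ Q * ENNReal.ofReal (1 / t)) =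
        ENNReal.ofReal (m * (t ^ (m - 1) * G t ^ m)) := by
      intro t ht
      have ht0 : 0 < t := ht
      have h0 : 0 ≤ (decRearrangement f t).toReal := ENNReal.toReal_nonneg
      rw [← ENNReal.ofReal_toReal (hfin t ht0), ← ENNReal.ofReal_mul (by positivity),
        ENNReal.ofReal_rpow_of_nonneg (by positivity) hQ0.le, ← ENNReal.ofReal_mul (by positivity),
        ← ENNReal.ofReal_mul (by positivity)]
      congr 2
      simp only [G]
      rw [Real.mul_rpow (by positivity) h0, ← Real.rpow_mul ht0.le, ← Real.rpow_mul h0,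
        Real.rpow_sub ht0, Real.rpow_one, one_div_mul_eq_div, mul_div_cancel₀ _ hr.ne']
      simp only [m]
      ring
    rw [← lintegral_const_mul' _ _ ENNReal.ofReal_ne_top, setLIntegral_congr_fun measurableSet_Ioi hint]
    have hk : ∀ k : ℕ, ∫⁻ t in Ioc (1 / ((k : ℝ) + 1)) (k + 1),
        ENNReal.ofReal (m * (t ^ (m - 1) * G t ^ m)) ≤ ENNReal.ofReal N ^ Q := by
      intro k
      set ε := 1 / ((k : ℝ) + 1)
      have hε : 0 < ε := by positivity
      set T := (k : ℝ) + 1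
      have hT : 0 ≤ T := by positivity
      -- The rearrangement may be infinite for `t ≤ 0`, where `toReal` would destroy monotonicity.
      -- Freezing it below `ε` gives a decreasing real function on the whole line.
      let F : ℝ → ℝ := fun t => G (max t ε)
      have hF0 : ∀ t, 0 ≤ F t := fun t => Real.rpow_nonneg ENNReal.toReal_nonneg _
      have hF : Antitone F := fun s t hst => by
        refine Real.rpow_le_rpow ENNReal.toReal_nonneg ?_ hr.le
        exact ENNReal.toReal_mono (hfin _ (hε.trans_le (le_max_right _ _)))
          (antitone_decRearrangement f (max_le_max_right ε hst))
      have h1 := integral_mul_rpow_le_of_antitone hF hF0 hm hT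
      have hFm : Antitone fun t => F t ^ m := fun s t hst =>
        Real.rpow_le_rpow (hF0 t) (hF hst) (by linarith)
      have hI : IntervalIntegrable (fun t => m * (t ^ (m - 1) * F t ^ m)) volume 0 T := by
        refine IntervalIntegrable.const_mul ?_ _
        refine IntervalIntegrable.continuousOn_mul hFm.intervalIntegrable ?_
        exact (continuous_id.rpow_const fun _ => Or.inr (by linarith)).continuousOn
      have hFI : ∫ t in (0 : ℝ)..T, F t ≤ N ^ r := by
        rw [intervalIntegral.integral_of_le hT]
        have hFi := (intervalIntegrable_iff_integrableOn_Ioc_of_le hT).1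
          (hF.intervalIntegrable (a := 0) (b := T) (μ := volume))
        rw [← ENNReal.ofReal_le_ofReal_iff (by positivity),
          ofReal_integral_eq_lintegral_ofReal hFi (Eventually.of_forall hF0)]
        refine le_trans ?_ (setLIntegral_decRearrangement_le hf hr hN h)
        refine le_trans (setLIntegral_mono' measurableSet_Ioc fun t ht => ?_)
          (lintegral_mono_set Ioc_subset_Ioi_self)
        refine ENNReal.ofReal_le_ofReal (Real.rpow_le_rpow ENNReal.toReal_nonneg ?_ hr.le)
        exact ENNReal.toReal_mono (hfin t ht.1) (antitone_decRearrangement f (le_max_left t ε))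
      calc _ ≤ ∫⁻ t in Ioc 0 T, ENNReal.ofReal (m * (t ^ (m - 1) * F t ^ m)) := by
            refine le_trans (setLIntegral_mono' measurableSet_Ioc fun t ht => ?_)
              (lintegral_mono_set (Ioc_subset_Ioc_left hε.le))
            have : F t = G t := by
              show G (max t ε) = G t
              rw [max_eq_left ht.1.le]
            rw [this]
        _ = ENNReal.ofReal (∫ t in (0 : ℝ)..T, m * (t ^ (m - 1) * F t ^ m)) := by
            rw [intervalIntegral.integral_of_le hT]
            refine (ofReal_integral_eq_lintegral_ofReal
              ((intervalIntegrable_iff_integrableOn_Ioc_of_le hT).1 hI) ?_).symm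
            rw [EventuallyLE, ae_restrict_iff' measurableSet_Ioc]
            refine Eventually.of_forall fun t ht => ?_
            have := hF0 t
            have ht0 : 0 ≤ t := ht.1.le
            show 0 ≤ m * (t ^ (m - 1) * F t ^ m)
            positivity
        _ ≤ ENNReal.ofReal ((N ^ r) ^ m) := by
            refine ENNReal.ofReal_le_ofReal (h1.trans ?_)
            exact Real.rpow_le_rpow (intervalIntegral.integral_nonneg hT fun t _ => hF0 t) hFI
              (by linarith)
        _ = _ := by
            rw [ENNReal.ofReal_rpow_of_nonneg hN.le hQ0.le, ← Real.rpow_mul hN.le,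
              mul_div_cancel₀ _ hr.ne']
    have hmono : Monotone fun k : ℕ => Ioc (1 / ((k : ℝ) + 1)) ((k : ℝ) + 1) := by
      intro i j hij
      have hij' : (i : ℝ) ≤ j := by exact_mod_cast hij
      refine Ioc_subset_Ioc ?_ (by linarith)
      exact one_div_le_one_div_of_le (by positivity) (by linarith)
    have hU : Ioi (0 : ℝ) = ⋃ k : ℕ, Ioc (1 / ((k : ℝ) + 1)) ((k : ℝ) + 1) := by
      ext t
      simp only [mem_Ioi, mem_iUnion, mem_Ioc]
      constructor
      · intro ht
        obtain ⟨k, hk⟩ := exists_nat_gt (max t (1 / t))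
        have h1 := (le_max_left _ _).trans_lt hk
        have h2 := (le_max_right _ _).trans_lt hk
        refine ⟨k, ?_, by linarith⟩
        rw [div_lt_iff₀ (by positivity)]
        rw [div_lt_iff₀ ht] at h2
        nlinarith
      · rintro ⟨k, hk, -⟩
        exact lt_trans (by positivity) hk
    rw [hU, setLIntegral_iUnion_of_directed _ (directed_of_isDirected_le hmono)]
    exact iSup_le hk

theorem distLorentzNorm_le_of_represents {n : ℕ} {g : Rn n → ℂ} {T : 𝓢'(Rn n, ℂ)} {r N : ℝ}
    {q : ℝ≥0∞} (hr : 0 < r) (hN : 0 < N) (hq : ENNReal.ofReal r < q) (hg : Represents g T)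
    (h : eLpNorm g (ENNReal.ofReal r) volume ≤ ENNReal.ofReal N) :
    distLorentzNorm r q T ≤ ENNReal.ofReal N :=
  (iInf₂_le g hg).trans (lorentzNorm_le_of_eLpNorm hg.1 hr hN hq h)

/-! ### The nonlinearity -/

/-- Bernoulli's inequality for `(c/a)^{α+1}`. It covers all `α > 0` at once, without separating `α <
1`. -/
theorem rpow_sub_rpow_mul_le {a c α : ℝ} (hc : 0 ≤ c) (hca : c ≤ a) (hα : 0 < α) :
    (a ^ α - c ^ α) * c ≤ α * a ^ α * (a - c) := by
  rcases (hc.trans hca).eq_or_lt with h | h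
  · have : c = 0 := le_antisymm (h ▸ hca) hc
    rw [← h, this]; simp
  · have hy0 : 0 ≤ c / a := by positivity
    have h1 := one_add_mul_self_le_rpow_one_add (s := c / a - 1) (p := α + 1) (by linarith)
      (by linarith)
    rw [add_sub_cancel, Real.rpow_add_one' hy0 (by linarith), Real.div_rpow hc h.le] at h1
    have h2 : (1 + (α + 1) * (c / a - 1)) * (a ^ α * a) ≤ c ^ α / a ^ α * (c / a) * (a ^ α * a) :=
      mul_le_mul_of_nonneg_right h1 (by positivity)
    have e1 : (1 + (α + 1) * (c / a - 1)) * (a ^ α * a) = a ^ α * (a + (α + 1) * (c - a)) := by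
      field_simp
    have e2 : c ^ α / a ^ α * (c / a) * (a ^ α * a) = c ^ α * c := by field_simp
    rw [e1, e2] at h2
    linarith

/-- With `|w| ≤ |z|`, the difference is `|z|^α (z - w) + (|z|^α - |w|^α) w`, and the second term is
at most `α |z|^α |z - w|`. -/
theorem norm_rpow_mul_sub_le {α : ℝ} (hα : 0 < α) (z w : ℂ) :
    ‖((‖z‖ ^ α : ℝ) : ℂ) * z - ((‖w‖ ^ α : ℝ) : ℂ) * w‖ ≤
      (α + 1) * ((‖z‖ ^ α + ‖w‖ ^ α) * ‖z - w‖) := by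
  wlog h : ‖w‖ ≤ ‖z‖ generalizing z w with H
  · have := H w z (le_of_not_ge h)
    rwa [norm_sub_rev, norm_sub_rev w z, add_comm (‖w‖ ^ α)] at this
  have e : ((‖z‖ ^ α : ℝ) : ℂ) * z - ((‖w‖ ^ α : ℝ) : ℂ) * w =
      ((‖z‖ ^ α : ℝ) : ℂ) * (z - w) + ((‖z‖ ^ α - ‖w‖ ^ α : ℝ) : ℂ) * w := by
    push_cast; ring
  have hz : 0 ≤ ‖z‖ ^ α := by positivity
  have hw : 0 ≤ ‖w‖ ^ α := by positivity
  have hmono : ‖w‖ ^ α ≤ ‖z‖ ^ α := Real.rpow_le_rpow (norm_nonneg _) h hα.le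
  have h1 := rpow_sub_rpow_mul_le (norm_nonneg w) h hα
  have h2 : ‖z‖ - ‖w‖ ≤ ‖z - w‖ := norm_sub_norm_le z w
  rw [e]
  refine (norm_add_le _ _).trans ?_
  rw [norm_mul, norm_mul, Complex.norm_real, Complex.norm_real, Real.norm_of_nonneg hz,
    Real.norm_of_nonneg (by linarith)]
  have h3 : α * ‖z‖ ^ α * (‖z‖ - ‖w‖) ≤ α * ‖z‖ ^ α * ‖z - w‖ := by gcongr
  nlinarith [mul_nonneg (mul_nonneg (by linarith : (0:ℝ) ≤ α + 1) hw) (norm_nonneg (z - w))]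

/-- The function `|u|^α w`. -/
noncomputable def powMul {n : ℕ} (α : ℝ) (u w : Rn n → ℂ) (x : Rn n) : ℂ :=
  ((‖u x‖ ^ α : ℝ) : ℂ) * w x

theorem inlsNonlinearity_eq {n : ℕ} (b α : ℝ) (v : Rn n → ℂ) :
    inlsNonlinearity b α v = weighted b (powMul α v v) := by
  ext x
  simp only [inlsNonlinearity, weighted, powMul]
  push_cast; ring

theorem aestronglyMeasurable_powMul {n : ℕ} {α : ℝ} {u w : Rn n → ℂ}
    (hu : AEStronglyMeasurable u volume) (hw : AEStronglyMeasurable w volume) :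
    AEStronglyMeasurable (powMul α u w) volume := by
  have : AEMeasurable (fun x => ‖u x‖ ^ α) volume := hu.norm.aemeasurable.pow_const α
  exact (Complex.measurable_ofReal.comp_aemeasurable this).aestronglyMeasurable.mul hw

theorem eLpNorm_powMul_le {n : ℕ} {α r s A W : ℝ} (hα : 0 < α) (hs : 0 < s) (hsr : s * (α + 1) = r)
    {u w : Rn n → ℂ} (hu : AEStronglyMeasurable u volume) (hw : AEStronglyMeasurable w volume)
    (hA : 0 ≤ A) (hW : 0 ≤ W) (h1 : eLpNorm u (ENNReal.ofReal r) volume ≤ ENNReal.ofReal A)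
    (h2 : eLpNorm w (ENNReal.ofReal r) volume ≤ ENNReal.ofReal W) :
    eLpNorm (powMul α u w) (ENNReal.ofReal s) volume ≤ ENNReal.ofReal (A ^ α * W) := by
  have hr : 0 < r := by rw [← hsr]; positivity
  rw [eLpNorm_ofReal_le_iff hr hA] at h1
  rw [eLpNorm_ofReal_le_iff hr hW] at h2
  rw [eLpNorm_ofReal_le_iff hs (by positivity)]
  have e : ∀ x, ENNReal.ofReal (‖powMul α u w x‖ ^ s) =
      ENNReal.ofReal (‖u x‖ ^ r) ^ (α * s / r) * ENNReal.ofReal (‖w x‖ ^ r) ^ (s / r) := by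
    intro x
    rw [ENNReal.ofReal_rpow_of_nonneg (by positivity) (by positivity),
      ENNReal.ofReal_rpow_of_nonneg (by positivity) (by positivity),
      ← ENNReal.ofReal_mul (by positivity), ← Real.rpow_mul (norm_nonneg _),
      ← Real.rpow_mul (norm_nonneg _), powMul, norm_mul, Complex.norm_real,
      Real.norm_of_nonneg (by positivity), Real.mul_rpow (by positivity) (norm_nonneg _),
      ← Real.rpow_mul (norm_nonneg _), mul_div_cancel₀ _ hr.ne', mul_div_cancel₀ _ hr.ne']
  simp_rw [e]
  refine (ENNReal.lintegral_mul_norm_pow_le (hu.norm.aemeasurable.pow_const r).ennreal_ofReal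
    (hw.norm.aemeasurable.pow_const r).ennreal_ofReal (by positivity) (by positivity)
    (by rw [← hsr]; field_simp)).trans ?_
  calc _ ≤ ENNReal.ofReal (A ^ r) ^ (α * s / r) * ENNReal.ofReal (W ^ r) ^ (s / r) := by gcongr
    _ = _ := by
      rw [ENNReal.ofReal_rpow_of_nonneg (by positivity) (by positivity),
        ENNReal.ofReal_rpow_of_nonneg (by positivity) (by positivity),
        ← ENNReal.ofReal_mul (by positivity), ← Real.rpow_mul hA, ← Real.rpow_mul hW,
        mul_div_cancel₀ _ hr.ne', mul_div_cancel₀ _ hr.ne', Real.mul_rpow (by positivity) hW,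
        ← Real.rpow_mul hA]

theorem eLpNorm_powMul_sub_le {n : ℕ} {α r s A W : ℝ} (hα : 0 < α) (hs : 1 ≤ s)
    (hsr : s * (α + 1) = r) {u v : Rn n → ℂ} (hu : AEStronglyMeasurable u volume)
    (hv : AEStronglyMeasurable v volume) (hA : 0 ≤ A) (hW : 0 ≤ W)
    (h1 : eLpNorm u (ENNReal.ofReal r) volume ≤ ENNReal.ofReal A)
    (h2 : eLpNorm v (ENNReal.ofReal r) volume ≤ ENNReal.ofReal A)
    (h3 : eLpNorm (fun x => u x - v x) (ENNReal.ofReal r) volume ≤ ENNReal.ofReal W) :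
    eLpNorm (fun x => powMul α u u x - powMul α v v x) (ENNReal.ofReal s) volume ≤
      ENNReal.ofReal (2 * (α + 1) * (A ^ α * W)) := by
  have hs0 : 0 < s := by linarith
  have hw : AEStronglyMeasurable (fun x => u x - v x) volume := hu.sub hv
  have k1 := eLpNorm_powMul_le hα hs0 hsr hu hw hA hW h1 h3
  have k2 := eLpNorm_powMul_le hα hs0 hsr hv hw hA hW h2 h3
  have m1 := (aestronglyMeasurable_powMul (α := α) hu hw).norm
  have m2 := (aestronglyMeasurable_powMul (α := α) hv hw).norm
  rw [← eLpNorm_norm] at k1 k2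
  have hb : ∀ x, ‖powMul α u u x - powMul α v v x‖ ≤ (α + 1) *
      ‖‖powMul α u (fun x => u x - v x) x‖ + ‖powMul α v (fun x => u x - v x) x‖‖ := by
    intro x
    refine (norm_rpow_mul_sub_le hα (u x) (v x)).trans (le_of_eq ?_)
    rw [Real.norm_of_nonneg (by positivity)]
    simp only [powMul, norm_mul, Complex.norm_real]
    rw [Real.norm_of_nonneg (by positivity), Real.norm_of_nonneg (by positivity)]
    ring
  refine (eLpNorm_le_mul_eLpNorm_of_ae_le_mul (Eventually.of_forall hb) _).trans ?_
  calc _ ≤ ENNReal.ofReal (α + 1) * (ENNReal.ofReal (A ^ α * W) + ENNReal.ofReal (A ^ α * W)) := by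
        refine mul_le_mul' le_rfl ((eLpNorm_add_le m1 m2 ?_).trans (add_le_add k1 k2))
        rwa [ENNReal.one_le_ofReal]
    _ = _ := by
        rw [← ENNReal.ofReal_add (by positivity) (by positivity), ← ENNReal.ofReal_mul (by positivity)]
        congr 1; ring

theorem exists_volume_ball_eq (n : ℕ) : ∃ ω : ℝ, 0 ≤ ω ∧ ∀ R : ℝ, 0 < R →
    volume (Metric.ball (0 : Rn n) R) = ENNReal.ofReal (ω * R ^ n) := by
  refine ⟨(volume (Metric.ball (0 : Rn n) 1)).toReal, ENNReal.toReal_nonneg, fun R hR => ?_⟩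
  rw [Measure.addHaar_ball_of_pos _ _ hR, finrank_euclideanSpace_fin,
    ENNReal.ofReal_mul ENNReal.toReal_nonneg, ENNReal.ofReal_toReal measure_ball_lt_top.ne, mul_comm]

/-- The difference of two values of the nonlinearity lies in weak `L^{r'}`. -/
theorem exists_weak_nonlinearity_sub {n : ℕ} (hn : 1 ≤ n) {b α r r' : ℝ} (hb : 0 < b) (hα : 0 < α)
    (hr : 0 < r) (hr' : 0 < r') (hrel : b / n + (α + 1) / r = 1 / r') :
    ∃ K : ℝ, 0 < K ∧ ∀ (u v : Rn n → ℂ) (A W : ℝ), 0 < A → 0 < W →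
      (∀ h : ℝ, 0 < h → volume {x | h < ‖u x‖} ≤ ENNReal.ofReal ((A / h) ^ r)) →
      (∀ h : ℝ, 0 < h → volume {x | h < ‖v x‖} ≤ ENNReal.ofReal ((A / h) ^ r)) →
      (∀ h : ℝ, 0 < h → volume {x | h < ‖u x - v x‖} ≤ ENNReal.ofReal ((W / h) ^ r)) →
      ∀ h : ℝ, 0 < h →
        volume {x | h < ‖inlsNonlinearity b α u x - inlsNonlinearity b α v x‖} ≤
          ENNReal.ofReal ((K * (A ^ α * W) / h) ^ r') := by
  obtain ⟨ω, hω, hball⟩ := exists_volume_ball_eq n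
  have hn0 : (0 : ℝ) < n := by exact_mod_cast hn
  refine ⟨2 * (α + 1) * (ω + 3) ^ (1 / r'), by positivity, fun u v A W hA hW hu hv hw h hh => ?_⟩
  -- Hölder's inequality in weak spaces by a union of bad sets: a ball of volume `ω m` and three
  -- superlevel sets of measure at most `m`. Outside them the pointwise bounds multiply to exactly
  -- `h`, thanks to the relation between the exponents, so `h` is not exceeded there.
  let m := (2 * (α + 1) * (A ^ α * W) / h) ^ r'
  have hm : 0 < m := by positivity
  let R := m ^ (1 / (n : ℝ))
  have hR : 0 < R := by positivity
  have hlev : ∀ X : ℝ, 0 < X → (X / (X * m ^ (-(1 / r)))) ^ r = m := by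
    intro X hX
    rw [Real.rpow_neg hm.le, ← div_eq_mul_inv, div_div_cancel₀ hX.ne', ← Real.rpow_mul hm.le,
      one_div_mul_cancel hr.ne', Real.rpow_one]
  have hA' : 0 < A * m ^ (-(1 / r)) := by positivity
  have hW' : 0 < W * m ^ (-(1 / r)) := by positivity
  have hsub : {x | h < ‖inlsNonlinearity b α u x - inlsNonlinearity b α v x‖} ⊆
      Metric.ball (0 : Rn n) R ∪ ({x | A * m ^ (-(1 / r)) < ‖u x‖} ∪
        ({x | A * m ^ (-(1 / r)) < ‖v x‖} ∪ {x | W * m ^ (-(1 / r)) < ‖u x - v x‖})) := by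
    intro x hx
    by_contra hcon
    simp only [mem_union, not_or, mem_ball_zero_iff, not_lt] at hcon
    obtain ⟨c1, c2, c3, c4⟩ := hcon
    have c2' : ‖u x‖ ≤ A * m ^ (-(1 / r)) := not_lt.1 c2
    have c3' : ‖v x‖ ≤ A * m ^ (-(1 / r)) := not_lt.1 c3
    have c4' : ‖u x - v x‖ ≤ W * m ^ (-(1 / r)) := not_lt.1 c4
    have hx' : h < ‖inlsNonlinearity b α u x - inlsNonlinearity b α v x‖ := hx
    have e : inlsNonlinearity b α u x - inlsNonlinearity b α v x =
        ((‖x‖ ^ (-b) : ℝ) : ℂ) * (((‖u x‖ ^ α : ℝ) : ℂ) * u x - ((‖v x‖ ^ α : ℝ) : ℂ) * v x) := by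
      simp only [inlsNonlinearity]; push_cast; ring
    have hb1 : ‖x‖ ^ (-b) ≤ R ^ (-b) := Real.rpow_le_rpow_of_nonpos hR c1 (by linarith)
    have hb2 := norm_rpow_mul_sub_le hα (u x) (v x)
    rw [e, norm_mul, Complex.norm_real, Real.norm_of_nonneg (by positivity)] at hx'
    have hb3 : ‖x‖ ^ (-b) * ‖((‖u x‖ ^ α : ℝ) : ℂ) * u x - ((‖v x‖ ^ α : ℝ) : ℂ) * v x‖ ≤
        R ^ (-b) * ((α + 1) * (((A * m ^ (-(1 / r))) ^ α + (A * m ^ (-(1 / r))) ^ α) *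
          (W * m ^ (-(1 / r))))) := by
      refine mul_le_mul hb1 (hb2.trans ?_) (norm_nonneg _) (by positivity)
      gcongr
    refine absurd (hx'.trans_le hb3) (not_lt.2 (le_of_eq ?_))
    have e1 : R ^ (-b) * ((m ^ (-(1 / r))) ^ α * m ^ (-(1 / r))) = m ^ (-(1 / r')) := by
      simp only [R]
      rw [← Real.rpow_mul hm.le, ← Real.rpow_mul hm.le, ← Real.rpow_add hm, ← Real.rpow_add hm]
      congr 1
      rw [← hrel]; field_simp; ring
    have e2 : m ^ (-(1 / r')) = h / (2 * (α + 1) * (A ^ α * W)) := by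
      simp only [m]
      rw [← Real.rpow_mul (by positivity), mul_neg, mul_one_div_cancel hr'.ne', Real.rpow_neg_one,
        inv_div]
    rw [Real.mul_rpow hA.le (by positivity)]
    calc _ = 2 * (α + 1) * (A ^ α * W) * (R ^ (-b) * ((m ^ (-(1 / r))) ^ α * m ^ (-(1 / r)))) := by
          ring
      _ = h := by rw [e1, e2]; field_simp
  calc _ ≤ _ := measure_mono hsub
    _ ≤ volume (Metric.ball (0 : Rn n) R) + (volume {x | A * m ^ (-(1 / r)) < ‖u x‖} +
        (volume {x | A * m ^ (-(1 / r)) < ‖v x‖} +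
          volume {x | W * m ^ (-(1 / r)) < ‖u x - v x‖})) := by
        refine (measure_union_le _ _).trans (add_le_add le_rfl ?_)
        exact (measure_union_le _ _).trans (add_le_add le_rfl (measure_union_le _ _))
    _ ≤ ENNReal.ofReal (ω * m) + (ENNReal.ofReal m + (ENNReal.ofReal m + ENNReal.ofReal m)) := by
        refine add_le_add (le_of_eq ?_) (add_le_add ?_ (add_le_add ?_ ?_))
        · rw [hball R hR]
          congr 2
          simp only [R]
          rw [← Real.rpow_natCast, ← Real.rpow_mul hm.le, one_div_mul_cancel hn0.ne', Real.rpow_one]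
        · exact (hu _ hA').trans (le_of_eq (by rw [hlev A hA]))
        · exact (hv _ hA').trans (le_of_eq (by rw [hlev A hA]))
        · exact (hw _ hW').trans (le_of_eq (by rw [hlev W hW]))
    _ = ENNReal.ofReal ((ω + 3) * m) := by
        rw [← ENNReal.ofReal_add hm.le hm.le, ← ENNReal.ofReal_add hm.le (by positivity),
          ← ENNReal.ofReal_add (by positivity) (by positivity)]
        congr 1; ring
    _ = _ := by
        congr 1
        have : 2 * (α + 1) * (ω + 3) ^ (1 / r') * (A ^ α * W) / h =
            (ω + 3) ^ (1 / r') * (2 * (α + 1) * (A ^ α * W) / h) := by ring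
        rw [this, Real.mul_rpow (by positivity) (by positivity), ← Real.rpow_mul (by positivity),
          one_div_mul_cancel hr'.ne', Real.rpow_one]

/-! ### The weight of the Duhamel integral -/

/-- Convergence is read off from the modulus of the complex beta integrand. -/
theorem intervalIntegrable_duhamel_weight_one {e a : ℝ} (he : e < 1) (ha : a < 1) :
    IntervalIntegrable (fun τ : ℝ => τ ^ (-e) * (1 - τ) ^ (-a)) volume 0 1 := by
  have h := (Complex.betaIntegral_convergent (u := ((1 - e : ℝ) : ℂ)) (v := ((1 - a : ℝ) : ℂ))
    (by rw [Complex.ofReal_re]; linarith) (by rw [Complex.ofReal_re]; linarith)).norm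
  rw [intervalIntegrable_iff_integrableOn_Ioo_of_le zero_le_one] at h ⊢
  refine h.congr_fun (fun τ hτ => ?_) measurableSet_Ioo
  have h1 : 0 < τ := hτ.1
  have h2 : 0 < 1 - τ := by linarith [hτ.2]
  simp only
  rw [norm_mul, Complex.norm_cpow_eq_rpow_re_of_pos h1, ← Complex.ofReal_one, ← Complex.ofReal_sub,
    ← Complex.ofReal_sub, ← Complex.ofReal_sub, Complex.norm_cpow_eq_rpow_re_of_pos h2,
    Complex.ofReal_re, Complex.ofReal_re]
  congr 2 <;> ring

theorem duhamel_weight_comp {e a t τ : ℝ} (ht : 0 < t) (hτ : 0 ≤ τ) (hτ1 : τ ≤ 1) :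
    (t * τ) ^ (-e) * (t - t * τ) ^ (-a) = t ^ (-e - a) * (τ ^ (-e) * (1 - τ) ^ (-a)) := by
  rw [show t - t * τ = t * (1 - τ) by ring, Real.mul_rpow ht.le hτ,
    Real.mul_rpow ht.le (by linarith), sub_eq_add_neg (-e), Real.rpow_add ht]
  ring

theorem intervalIntegrable_duhamel_weight {e a t : ℝ} (he : e < 1) (ha : a < 1) (ht : 0 < t) :
    IntervalIntegrable (fun τ : ℝ => τ ^ (-e) * (t - τ) ^ (-a)) volume 0 t := by
  have h1 := (intervalIntegrable_duhamel_weight_one he ha).const_mul (t ^ (-e - a))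
  have h2 : IntervalIntegrable (fun τ : ℝ => (t * τ) ^ (-e) * (t - t * τ) ^ (-a)) volume 0 1 := by
    rw [intervalIntegrable_iff_integrableOn_Ioo_of_le zero_le_one] at h1 ⊢
    refine h1.congr_fun (fun τ hτ => ?_) measurableSet_Ioo
    exact (duhamel_weight_comp ht hτ.1.le hτ.2.le).symm
  have h3 := h2.comp_mul_left (c := t⁻¹)
  simp only [zero_mul, div_inv_eq_mul, one_mul, ← mul_assoc, mul_inv_cancel₀ ht.ne'] at h3
  exact h3

theorem integral_duhamel_weight {e a t : ℝ} (ht : 0 < t) :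
    ∫ τ in (0 : ℝ)..t, τ ^ (-e) * (t - τ) ^ (-a) =
      t ^ (1 - e - a) * ∫ τ in (0 : ℝ)..1, τ ^ (-e) * (1 - τ) ^ (-a) := by
  have h := intervalIntegral.mul_integral_comp_mul_left (a := 0) (b := 1)
    (f := fun τ => τ ^ (-e) * (t - τ) ^ (-a)) (c := t)
  rw [mul_zero, mul_one] at h
  rw [← h]
  have : ∫ τ in (0 : ℝ)..1, (t * τ) ^ (-e) * (t - t * τ) ^ (-a) =
      ∫ τ in (0 : ℝ)..1, t ^ (-e - a) * (τ ^ (-e) * (1 - τ) ^ (-a)) := by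
    refine intervalIntegral.integral_congr fun τ hτ => ?_
    rw [uIcc_of_le zero_le_one] at hτ
    exact duhamel_weight_comp ht hτ.1 hτ.2
  rw [this, intervalIntegral.integral_const_mul, ← mul_assoc]
  congr 1
  rw [show 1 - e - a = 1 + (-e - a) by ring, Real.rpow_add ht, Real.rpow_one]

/-! ### Self-similar Duhamel integrals -/

/-- The relations between the exponents: `r'` is dual to `r`, `s = r / (α + 1)`,
`a = n (1/2 - 1/r)` is the rate of the dispersive estimate and `β` that of the solution. -/
structure Exponents (n : ℕ) (b α r r' s a β : ℝ) : Prop where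
  one_le : 1 ≤ n
  b_pos : 0 < b
  α_pos : 0 < α
  two_lt : 2 < r
  conj : r.HolderConjugate r'
  one_lt_s : 1 < s
  s_mul : s * (α + 1) = r
  holder : 1 / s + b / n = 1 - 1 / r
  a_eq : a = n / 2 * (1 - 2 / r)
  a_add : a + β * α = 1
  β_pos : 0 < β
  β_mul_lt : β * (α + 1) < 1

namespace Exponents

variable {n : ℕ} {b α r r' s a β : ℝ}

theorem r_pos (h : Exponents n b α r r' s a β) : 0 < r := by linarith [h.two_lt]

theorem s_lt (h : Exponents n b α r r' s a β) : s < r := by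
  rw [← h.s_mul]; nlinarith [h.α_pos, h.one_lt_s]

theorem a_lt (h : Exponents n b α r r' s a β) : a < 1 := by
  have := mul_pos h.β_pos h.α_pos
  linarith [h.a_add]

/-- The Duhamel integral up to time `t` decays like `t^{-β}`, the rate of the solution itself. -/
theorem weight_exponent (h : Exponents n b α r r' s a β) : 1 - β * (α + 1) - a = -β := by
  linear_combination (-1 : ℝ) * h.a_add

end Exponents

theorem measurable_selfSimilarFun {n : ℕ} (p : ℂ) {U : Rn n → ℂ} (hU : Measurable U) :
    Measurable fun z : ℝ × Rn n => selfSimilarFun p U z.1 z.2 := by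
  unfold selfSimilarFun
  have h1 : Measurable fun z : ℝ × Rn n => ((√z.1 : ℝ) : ℂ) ^ (-p) := by fun_prop
  have h2 : Measurable fun z : ℝ × Rn n => (√z.1)⁻¹ • z.2 := by fun_prop
  exact h1.mul (hU.comp h2)

theorem selfSimilarFun_sub {n : ℕ} (p : ℂ) (U V : Rn n → ℂ) (t : ℝ) (x : Rn n) :
    selfSimilarFun p U t x - selfSimilarFun p V t x =
      selfSimilarFun p (fun y => U y - V y) t x := by
  simp only [selfSimilarFun]; ring

theorem eLpNorm_selfSimilarFun_le {n : ℕ} {p : ℂ} {U : Rn n → ℂ} {r β A : ℝ} (hr : 0 < r)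
    (hβ : β = p.re / 2 - n / (2 * r)) (hU : AEStronglyMeasurable U volume)
    (h : eLpNorm U (ENNReal.ofReal r) volume ≤ ENNReal.ofReal A) {t : ℝ} (ht : 0 < t) :
    eLpNorm (selfSimilarFun p U t) (ENNReal.ofReal r) volume ≤ ENNReal.ofReal (t ^ (-β) * A) := by
  rw [eLpNorm_selfSimilarFun p hr hU ht, ← hβ, ENNReal.ofReal_mul (by positivity)]
  gcongr

/-- The pairing of `e^{iσΔ}(|x|^{-b}|u|^α u)` with `ψ`. -/
noncomputable def nonlinearPairing {n : ℕ} (b α : ℝ) (u : Rn n → ℂ) (σ : ℝ) (ψ : 𝓢(Rn n, ℂ)) : ℂ :=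
  ∫ x, propagator n σ ψ x * inlsNonlinearity b α u x

theorem schrodingerGroup_nonlinearity_apply {n : ℕ} {b α : ℝ} {u : Rn n → ℂ}
    (h : IsTemperedFun (inlsNonlinearity b α u)) (σ : ℝ) (ψ : 𝓢(Rn n, ℂ)) :
    schrodingerGroup n σ (toDistribution (inlsNonlinearity b α u)) ψ = nonlinearPairing b α u σ ψ := by
  rw [schrodingerGroup_apply, toDistribution_apply h]; rfl

theorem aestronglyMeasurable_nonlinearPairing {n : ℕ} (b α : ℝ) (p : ℂ) {U : Rn n → ℂ}
    (hU : Measurable U) (t : ℝ) (ψ : 𝓢(Rn n, ℂ)) :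
    AEStronglyMeasurable (fun τ => nonlinearPairing b α (selfSimilarFun p U τ) (t - τ) ψ) volume := by
  have h1 := measurable_selfSimilarFun p hU
  have h2 : Measurable fun z : ℝ × Rn n => propagator n (t - z.1) ψ z.2 :=
    ((continuous_propagator ψ).comp
      (((continuous_const.sub continuous_fst).prodMk continuous_snd) :
        Continuous fun z : ℝ × Rn n => (t - z.1, z.2))).measurable
  have h3 : Measurable fun z : ℝ × Rn n => propagator n (t - z.1) ψ z.2 *
      inlsNonlinearity b α (selfSimilarFun p U z.1) z.2 := by
    refine h2.mul ?_
    unfold inlsNonlinearity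
    exact (by fun_prop : Measurable fun z : ℝ × Rn n =>
      ((‖z.2‖ ^ (-b) * ‖selfSimilarFun p U z.1 z.2‖ ^ α : ℝ) : ℂ)).mul h1
  exact (h3.aestronglyMeasurable (μ := volume.prod volume)).integral_prod_right'

/-- The bounds for the nonlinear term with a self-similar function. -/
theorem exists_nonlinearPairing_bound {n : ℕ} {b α r r' s a β : ℝ}
    (hE : Exponents n b α r r' s a β) :
    ∃ C : ℝ, 0 < C ∧ ∀ (p : ℂ), β = p.re / 2 - n / (2 * r) → ∀ (U V : Rn n → ℂ) (A W : ℝ),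
      Measurable U → Measurable V → 0 ≤ A → 0 ≤ W →
      eLpNorm U (ENNReal.ofReal r) volume ≤ ENNReal.ofReal A →
      eLpNorm V (ENNReal.ofReal r) volume ≤ ENNReal.ofReal A →
      eLpNorm (fun x => U x - V x) (ENNReal.ofReal r) volume ≤ ENNReal.ofReal W →
      ∀ τ : ℝ, 0 < τ →
        IsTemperedFun (inlsNonlinearity b α (selfSimilarFun p U τ)) ∧
        ∀ σ : ℝ, 0 < σ → ∀ ψ : 𝓢(Rn n, ℂ),
          ‖nonlinearPairing b α (selfSimilarFun p U τ) σ ψ‖ ≤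
            C * (A ^ α * A) * (τ ^ (-(β * (α + 1))) * σ ^ (-a)) * (∫ x, ‖ψ x‖ ^ r') ^ (1 / r') ∧
          ‖nonlinearPairing b α (selfSimilarFun p U τ) σ ψ -
              nonlinearPairing b α (selfSimilarFun p V τ) σ ψ‖ ≤
            C * (A ^ α * W) * (τ ^ (-(β * (α + 1))) * σ ^ (-a)) *
              (∫ x, ‖ψ x‖ ^ r') ^ (1 / r') := by
  have hα := hE.α_pos
  obtain ⟨C, hC, hCx⟩ := exists_strong_estimate hE.one_le hE.b_pos hE.one_lt_s hE.s_lt hE.two_lt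
    hE.holder hE.conj
  rw [← hE.a_eq] at hCx
  refine ⟨2 * (α + 1) * C, by positivity, fun p hp U V A W hU hV hA hW hUA hVA hUV τ hτ => ?_⟩
  have hs0 : 0 < s := by linarith [hE.one_lt_s]
  have mU := aestronglyMeasurable_selfSimilarFun p hU.aestronglyMeasurable hτ
  have mV := aestronglyMeasurable_selfSimilarFun p hV.aestronglyMeasurable hτ
  have kU := eLpNorm_selfSimilarFun_le hE.r_pos hp hU.aestronglyMeasurable hUA hτ
  have kV := eLpNorm_selfSimilarFun_le hE.r_pos hp hV.aestronglyMeasurable hVA hτ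
  have kUV := eLpNorm_selfSimilarFun_le hE.r_pos hp (hU.sub hV).aestronglyMeasurable hUV hτ
  have hA' : 0 ≤ τ ^ (-β) * A := by positivity
  have hW' : 0 ≤ τ ^ (-β) * W := by positivity
  have hpow : ∀ X : ℝ, (τ ^ (-β) * A) ^ α * (τ ^ (-β) * X) =
      A ^ α * X * τ ^ (-(β * (α + 1))) := by
    intro X
    rw [Real.mul_rpow (by positivity) hA, ← Real.rpow_mul hτ.le,
      show -(β * (α + 1)) = -β * α + -β by ring, Real.rpow_add hτ]
    ring
  obtain ⟨hTU, hbU⟩ := hCx _ _ (aestronglyMeasurable_powMul (α := α) mU mU) (by positivity)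
    (eLpNorm_powMul_le hα hs0 hE.s_mul mU mU hA' hA' kU kU)
  obtain ⟨hTV, -⟩ := hCx _ _ (aestronglyMeasurable_powMul (α := α) mV mV) (by positivity)
    (eLpNorm_powMul_le hα hs0 hE.s_mul mV mV hA' hA' kV kV)
  obtain ⟨-, hbUV⟩ := hCx _ _ ((aestronglyMeasurable_powMul (α := α) mU mU).sub
    (aestronglyMeasurable_powMul (α := α) mV mV)) (by positivity)
    (eLpNorm_powMul_sub_le hα hE.one_lt_s.le hE.s_mul mU mV hA' hW' kU kV
      (by simp only [selfSimilarFun_sub]; exact kUV))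
  rw [← inlsNonlinearity_eq] at hTU hTV
  refine ⟨hTU, fun σ hσ ψ => ⟨?_, ?_⟩⟩
  · have h1 := hbU σ hσ ψ
    rw [← inlsNonlinearity_eq, hpow] at h1
    refine h1.trans ?_
    have h2 : 0 ≤ (∫ x, ‖ψ x‖ ^ r') ^ (1 / r') :=
      Real.rpow_nonneg (integral_nonneg fun x => by positivity) _
    have h3 : C ≤ 2 * (α + 1) * C := by nlinarith
    calc _ = C * (A ^ α * A) * (τ ^ (-(β * (α + 1))) * σ ^ (-a)) * (∫ x, ‖ψ x‖ ^ r') ^ (1 / r') := by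
          ring
      _ ≤ _ := by gcongr
  · have h1 := hbUV σ hσ ψ
    rw [hpow] at h1
    have h2 : nonlinearPairing b α (selfSimilarFun p U τ) σ ψ -
        nonlinearPairing b α (selfSimilarFun p V τ) σ ψ =
        ∫ x, propagator n σ ψ x * weighted b (fun x => powMul α (selfSimilarFun p U τ)
          (selfSimilarFun p U τ) x - powMul α (selfSimilarFun p V τ) (selfSimilarFun p V τ) x) x := by
      rw [nonlinearPairing, nonlinearPairing, ← integral_sub (hTU.represents.2 _)
        (hTV.represents.2 _)]
      refine integral_congr_ae (Eventually.of_forall fun x => ?_)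
      simp only [inlsNonlinearity_eq, weighted]
      ring
    rw [h2]
    refine h1.trans (le_of_eq (by ring))

/-- The Duhamel functional at time one of the self-similar function with profile `U`. -/
noncomputable def duhamelPairing {n : ℕ} (b α : ℝ) (p : ℂ) (U : Rn n → ℂ) (ψ : 𝓢(Rn n, ℂ)) : ℂ :=
  ∫ τ in (0 : ℝ)..1, nonlinearPairing b α (selfSimilarFun p U τ) (1 - τ) ψ

theorem intervalIntegrable_of_weight_bound {f : ℝ → ℂ} {e a t D : ℝ} (he : e < 1) (ha : a < 1)
    (ht : 0 < t) (hf : AEStronglyMeasurable f volume)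
    (h : ∀ τ ∈ Ioo 0 t, ‖f τ‖ ≤ D * (τ ^ (-e) * (t - τ) ^ (-a))) :
    IntervalIntegrable f volume 0 t := by
  have hw := (intervalIntegrable_duhamel_weight he ha ht).const_mul D
  rw [intervalIntegrable_iff_integrableOn_Ioo_of_le ht.le] at hw ⊢
  refine Integrable.mono' hw hf.restrict ?_
  rw [ae_restrict_iff' measurableSet_Ioo]
  exact Eventually.of_forall h

theorem norm_integral_le_of_weight_bound {f : ℝ → ℂ} {e a t D : ℝ} (he : e < 1) (ha : a < 1)
    (ht : 0 < t) (h : ∀ τ ∈ Ioo 0 t, ‖f τ‖ ≤ D * (τ ^ (-e) * (t - τ) ^ (-a))) :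
    ‖∫ τ in (0 : ℝ)..t, f τ‖ ≤
      D * (t ^ (1 - e - a) * ∫ τ in (0 : ℝ)..1, τ ^ (-e) * (1 - τ) ^ (-a)) := by
  have hw := (intervalIntegrable_duhamel_weight he ha ht).const_mul D
  rw [← integral_duhamel_weight ht, ← intervalIntegral.integral_const_mul]
  refine intervalIntegral.norm_integral_le_of_norm_le ht.le ?_ hw
  have : ∀ᵐ τ : ℝ, τ ≠ t := Measure.ae_ne volume t
  filter_upwards [this] with τ hne hτ
  exact h τ ⟨hτ.1, lt_of_le_of_ne hτ.2 hne⟩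

/-- The strong estimate, integrated against the Duhamel weight on `(0,1)`, bounds the functional in
the dual of `L^{r'}`. The constant is chosen before `p`, which makes the final smallness condition
uniform in `p`. -/
theorem exists_duhamel_profile {n : ℕ} {b α r r' s a β : ℝ} (hE : Exponents n b α r r' s a β) :
    ∃ C : ℝ, 0 < C ∧ ∀ (p : ℂ), β = p.re / 2 - n / (2 * r) →
      ∃ D : (Rn n → ℂ) → Rn n → ℂ, ∀ (U V : Rn n → ℂ) (A W : ℝ),
      Measurable U → Measurable V → 0 ≤ A → 0 ≤ W →
      eLpNorm U (ENNReal.ofReal r) volume ≤ ENNReal.ofReal A →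
      eLpNorm V (ENNReal.ofReal r) volume ≤ ENNReal.ofReal A →
      eLpNorm (fun x => U x - V x) (ENNReal.ofReal r) volume ≤ ENNReal.ofReal W →
      AEStronglyMeasurable (D U) volume ∧
      eLpNorm (D U) (ENNReal.ofReal r) volume ≤ ENNReal.ofReal (C * (A ^ α * A)) ∧
      eLpNorm (fun x => D U x - D V x) (ENNReal.ofReal r) volume ≤ ENNReal.ofReal (C * (A ^ α * W)) ∧
      (∀ ψ : 𝓢(Rn n, ℂ), Integrable fun x => ψ x * D U x) ∧
      ∀ ψ : 𝓢(Rn n, ℂ), duhamelPairing b α p U ψ = ∫ x, ψ x * D U x := by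
  obtain ⟨C, hC, hCx⟩ := exists_nonlinearPairing_bound hE
  have ha := hE.a_lt
  have he := hE.β_mul_lt
  set B := ∫ τ in (0 : ℝ)..1, τ ^ (-(β * (α + 1))) * (1 - τ) ^ (-a)
  have hB : 0 ≤ B := intervalIntegral.integral_nonneg zero_le_one fun τ hτ =>
    mul_nonneg (Real.rpow_nonneg hτ.1 _) (Real.rpow_nonneg (by linarith [hτ.2]) _)
  refine ⟨C * B + 1, by positivity, fun p hp => ?_⟩
  have hle : ∀ X : ℝ, 0 ≤ X → C * X * B ≤ (C * B + 1) * X := fun X hX => by nlinarith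
  have hint : ∀ (U : Rn n → ℂ) (A : ℝ), Measurable U → 0 ≤ A →
      eLpNorm U (ENNReal.ofReal r) volume ≤ ENNReal.ofReal A → ∀ ψ : 𝓢(Rn n, ℂ),
      IntervalIntegrable (fun τ => nonlinearPairing b α (selfSimilarFun p U τ) (1 - τ) ψ)
        volume 0 1 := by
    intro U A hU hA hUA ψ
    refine intervalIntegrable_of_weight_bound (D := C * (A ^ α * A) * (∫ x, ‖ψ x‖ ^ r') ^ (1 / r'))
      he ha one_pos (aestronglyMeasurable_nonlinearPairing b α p hU 1 ψ) fun τ hτ => ?_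
    have h := (hCx p hp U U A 0 hU hU hA le_rfl hUA hUA (by simp) τ hτ.1).2 (1 - τ)
      (by linarith [hτ.2]) ψ
    refine h.1.trans (le_of_eq (by ring))
  have hlin : ∀ (U : Rn n → ℂ) (A : ℝ), Measurable U → 0 ≤ A →
      eLpNorm U (ENNReal.ofReal r) volume ≤ ENNReal.ofReal A →
      ∃ Λ : 𝓢(Rn n, ℂ) →ₗ[ℂ] ℂ, ∀ ψ, Λ ψ = duhamelPairing b α p U ψ := by
    intro U A hU hA hUA
    have hT : ∀ τ : ℝ, 0 < τ → IsTemperedFun (inlsNonlinearity b α (selfSimilarFun p U τ)) :=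
      fun τ hτ => (hCx p hp U U A 0 hU hU hA le_rfl hUA hUA (by simp) τ hτ).1
    refine ⟨⟨⟨duhamelPairing b α p U, fun ψ χ => ?_⟩, fun c ψ => ?_⟩, fun ψ => rfl⟩
    · simp only [duhamelPairing]
      rw [← intervalIntegral.integral_add (hint U A hU hA hUA ψ) (hint U A hU hA hUA χ)]
      refine intervalIntegral.integral_congr_ae (Eventually.of_forall fun τ hτ => ?_)
      rw [uIoc_of_le zero_le_one] at hτ
      simp only [nonlinearPairing]
      rw [← integral_add ((hT τ hτ.1).represents.2 _) ((hT τ hτ.1).represents.2 _)]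
      simp only [map_add, add_apply, add_mul]
    · simp only [duhamelPairing, RingHom.id_apply, smul_eq_mul]
      rw [← intervalIntegral.integral_const_mul]
      refine intervalIntegral.integral_congr fun τ _ => ?_
      simp only [nonlinearPairing, map_smul, smul_apply, smul_eq_mul, mul_assoc]
      rw [integral_const_mul]
  have hbound : ∀ (U : Rn n → ℂ) (A : ℝ), Measurable U → 0 ≤ A →
      eLpNorm U (ENNReal.ofReal r) volume ≤ ENNReal.ofReal A → ∀ ψ : 𝓢(Rn n, ℂ),
      ‖duhamelPairing b α p U ψ‖ ≤ (C * B + 1) * (A ^ α * A) * (∫ x, ‖ψ x‖ ^ r') ^ (1 / r') := by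
    intro U A hU hA hUA ψ
    have h0 : 0 ≤ (∫ x, ‖ψ x‖ ^ r') ^ (1 / r') :=
      Real.rpow_nonneg (integral_nonneg fun x => by positivity) _
    have h := norm_integral_le_of_weight_bound
      (f := fun τ => nonlinearPairing b α (selfSimilarFun p U τ) (1 - τ) ψ)
      (D := C * (A ^ α * A) * (∫ x, ‖ψ x‖ ^ r') ^ (1 / r')) he ha one_pos fun τ hτ => by
        have h := (hCx p hp U U A 0 hU hU hA le_rfl hUA hUA (by simp) τ hτ.1).2 (1 - τ)
          (by linarith [hτ.2]) ψ
        refine h.1.trans (le_of_eq (by ring))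
    rw [Real.one_rpow, one_mul] at h
    refine h.trans ?_
    calc _ = C * (A ^ α * A) * B * (∫ x, ‖ψ x‖ ^ r') ^ (1 / r') := by ring
      _ ≤ _ := mul_le_mul_of_nonneg_right (hle _ (by positivity)) h0
  -- The function `w` is chosen from `U` alone, before the bound `A`, so that one map `D` serves all
  -- bounds; outside the admissible `U` its value is irrelevant.
  have hex : ∀ U : Rn n → ℂ, ∃ w : Rn n → ℂ, ∀ A : ℝ, Measurable U → 0 ≤ A →
      eLpNorm U (ENNReal.ofReal r) volume ≤ ENNReal.ofReal A →
      (MemLp w (ENNReal.ofReal r) volume ∧ (∀ ψ : 𝓢(Rn n, ℂ), Integrable fun x => ψ x * w x) ∧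
        ∀ ψ : 𝓢(Rn n, ℂ), duhamelPairing b α p U ψ = ∫ x, ψ x * w x) := by
    intro U
    by_cases hc : ∃ A : ℝ, Measurable U ∧ 0 ≤ A ∧
        eLpNorm U (ENNReal.ofReal r) volume ≤ ENNReal.ofReal A
    · obtain ⟨A, hU, hA, hUA⟩ := hc
      obtain ⟨Λ, hΛ⟩ := hlin U A hU hA hUA
      obtain ⟨w, hw1, -, hw2, hw3⟩ := exists_memLp_of_pairing hE.conj hE.two_lt.le Λ
        (B := (C * B + 1) * (A ^ α * A)) (by positivity) fun ψ => by
          rw [hΛ]; exact hbound U A hU hA hUA ψ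
      exact ⟨w, fun _ _ _ _ => ⟨hw1, hw2, fun ψ => by rw [← hΛ, hw3]⟩⟩
    · exact ⟨0, fun A hU hA hUA => absurd ⟨A, hU, hA, hUA⟩ hc⟩
  choose D hD using hex
  refine ⟨D, fun U V A W hU hV hA hW hUA hVA hUV => ?_⟩
  obtain ⟨mU, iU, eU⟩ := hD U A hU hA hUA
  obtain ⟨mV, iV, eV⟩ := hD V A hV hA hVA
  have rU : Represents (D U) _ := (isTemperedFun_of_memLp (by
    rw [ENNReal.one_le_ofReal]; linarith [hE.two_lt]) mU).represents
  have rV : Represents (D V) _ := (isTemperedFun_of_memLp (by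
    rw [ENNReal.one_le_ofReal]; linarith [hE.two_lt]) mV).represents
  have lU := rU.locallyIntegrable
  have lV := rV.locallyIntegrable
  refine ⟨mU.1, ?_, ?_, iU, eU⟩
  · refine eLpNorm_le_of_pairing lU (by positivity) hE.conj fun ψ => ?_
    rw [← eU]
    exact hbound U A hU hA hUA ψ
  · refine eLpNorm_le_of_pairing (lU.sub lV) (by positivity) hE.conj fun ψ => ?_
    have h0 : 0 ≤ (∫ x, ‖ψ x‖ ^ r') ^ (1 / r') :=
      Real.rpow_nonneg (integral_nonneg fun x => by positivity) _
    have e1 : ∫ x, ψ x * (D U x - D V x) = ∫ τ in (0 : ℝ)..1,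
        (nonlinearPairing b α (selfSimilarFun p U τ) (1 - τ) ψ -
          nonlinearPairing b α (selfSimilarFun p V τ) (1 - τ) ψ) := by
      simp_rw [mul_sub]
      rw [integral_sub (iU ψ) (iV ψ), ← eU, ← eV, intervalIntegral.integral_sub
        (hint U A hU hA hUA ψ) (hint V A hV hA hVA ψ)]
      rfl
    have h := norm_integral_le_of_weight_bound
      (f := fun τ => nonlinearPairing b α (selfSimilarFun p U τ) (1 - τ) ψ -
          nonlinearPairing b α (selfSimilarFun p V τ) (1 - τ) ψ)
      (D := C * (A ^ α * W) * (∫ x, ‖ψ x‖ ^ r') ^ (1 / r')) he ha one_pos fun τ hτ => by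
        have h := (hCx p hp U V A W hU hV hA hW hUA hVA hUV τ hτ.1).2 (1 - τ)
          (by linarith [hτ.2]) ψ
        refine h.2.trans (le_of_eq (by ring))
    rw [Real.one_rpow, one_mul] at h
    change ‖∫ x, ψ x * (D U x - D V x)‖ ≤ _
    rw [e1]
    refine h.trans ?_
    calc _ = C * (A ^ α * W) * B * (∫ x, ‖ψ x‖ ^ r') ^ (1 / r') := by ring
      _ ≤ _ := mul_le_mul_of_nonneg_right (hle _ (by positivity)) h0

/-! ### Existence -/

theorem selfSimilarFun_sq_mul {n : ℕ} (p : ℂ) (U : Rn n → ℂ) {c τ : ℝ} (hc : 0 < c) (hτ : 0 < τ)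
    (x : Rn n) : selfSimilarFun p U (c ^ 2 * τ) x =
      (c : ℂ) ^ (-p) * selfSimilarFun p U τ (c⁻¹ • x) := by
  have hc0 : (c : ℂ) ≠ 0 := by exact_mod_cast hc.ne'
  rw [selfSimilarFun_smul p U hc hτ, smul_smul, mul_inv_cancel₀ hc.ne', one_smul, ← mul_assoc,
    ← Complex.cpow_add _ _ hc0, neg_add_cancel, Complex.cpow_zero, one_mul]

/-- The condition `α Re p = 2 - b` makes the nonlinearity scale like the solution with an extra
factor `c^{-2}`, which the time element of the Duhamel integral absorbs. -/
theorem inlsNonlinearity_selfSimilarFun {n : ℕ} {b α : ℝ} {p : ℂ} (hp : α * p.re = 2 - b)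
    (U : Rn n → ℂ) {c τ : ℝ} (hc : 0 < c) (hτ : 0 < τ) (x : Rn n) :
    inlsNonlinearity b α (selfSimilarFun p U (c ^ 2 * τ)) x =
      (c : ℂ) ^ (-p) * (((c ^ 2)⁻¹ : ℝ) : ℂ) *
        inlsNonlinearity b α (selfSimilarFun p U τ) (c⁻¹ • x) := by
  set y := c⁻¹ • x
  have hx : x = c • y := by rw [smul_smul, mul_inv_cancel₀ hc.ne', one_smul]
  have h1 : ‖x‖ ^ (-b) = c ^ (-b) * ‖y‖ ^ (-b) := by
    rw [hx, norm_smul, Real.norm_of_nonneg hc.le, Real.mul_rpow hc.le (norm_nonneg _)]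
  have h2 : c ^ (-b) * (c ^ (-p.re)) ^ α = (c ^ 2)⁻¹ := by
    rw [← Real.rpow_mul hc.le, ← Real.rpow_add hc, ← Real.rpow_natCast, ← Real.rpow_neg hc.le]
    congr 1
    push_cast
    linear_combination -hp
  simp only [inlsNonlinearity]
  rw [selfSimilarFun_sq_mul p U hc hτ, norm_mul, Complex.norm_cpow_eq_rpow_re_of_pos hc,
    Complex.neg_re, Real.mul_rpow (by positivity) (norm_nonneg _), h1, ← h2]
  push_cast
  ring

theorem nonlinearPairing_selfSimilarFun {n : ℕ} {b α : ℝ} {p : ℂ} (hp : α * p.re = 2 - b)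
    (U : Rn n → ℂ) {c τ : ℝ} (hc : 0 < c) (hτ : 0 < τ) (σ : ℝ) (ψ : 𝓢(Rn n, ℂ)) :
    nonlinearPairing b α (selfSimilarFun p U (c ^ 2 * τ)) (c ^ 2 * σ) ψ =
      (c : ℂ) ^ (-p) * (((c ^ 2)⁻¹ : ℝ) : ℂ) * (((c ^ n : ℝ) : ℂ) *
        nonlinearPairing b α (selfSimilarFun p U τ) σ (dilate c hc.ne' ψ)) := by
  simp only [nonlinearPairing]
  rw [← integral_propagator_mul_comp_smul σ hc, ← integral_const_mul]
  refine integral_congr_ae (Eventually.of_forall fun x => ?_)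
  simp only
  rw [inlsNonlinearity_selfSimilarFun hp U hc hτ]
  ring

/-- The substitution `τ ↦ tτ` shows that the Duhamel equation at time one implies the equation at
every time. -/
theorem integral_nonlinearPairing_selfSimilarFun {n : ℕ} {b α : ℝ} {p : ℂ} (hp : α * p.re = 2 - b)
    (U : Rn n → ℂ) {t : ℝ} (ht : 0 < t) (ψ : 𝓢(Rn n, ℂ)) :
    ∫ τ in (0 : ℝ)..t, nonlinearPairing b α (selfSimilarFun p U τ) (t - τ) ψ =
      ((√t : ℝ) : ℂ) ^ (-p) * ((√t ^ n : ℝ) : ℂ) *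
        duhamelPairing b α p U (dilate (√t) (Real.sqrt_pos.2 ht).ne' ψ) := by
  have hc : 0 < √t := Real.sqrt_pos.2 ht
  have h := intervalIntegral.smul_integral_comp_mul_left (a := 0) (b := 1)
    (f := fun τ => nonlinearPairing b α (selfSimilarFun p U τ) (t - τ) ψ) (c := t)
  rw [mul_zero, mul_one] at h
  rw [← h, duhamelPairing, Complex.real_smul, ← intervalIntegral.integral_const_mul,
    ← intervalIntegral.integral_const_mul]
  refine intervalIntegral.integral_congr_ae (Eventually.of_forall fun τ hτ => ?_)
  rw [uIoc_of_le zero_le_one] at hτ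
  have h1 := nonlinearPairing_selfSimilarFun hp U hc hτ.1 (1 - τ) ψ
  rw [Real.sq_sqrt ht.le] at h1
  rw [show t - t * τ = t * (1 - τ) by ring, h1]
  have ht0 : (t : ℂ) ≠ 0 := by exact_mod_cast ht.ne'
  push_cast
  field_simp

/-- Banach's fixed point theorem on the closed ball of radius `M` in `L^r`. The condition `C M^α ≤
1/2` does double duty: `M/2 + C M^{α+1} ≤ M` keeps the ball invariant, and `C M^α` is the
contraction factor. -/
theorem exists_profile {n : ℕ} {b α r r' s a β : ℝ} (hE : Exponents n b α r r' s a β) :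
    ∃ K : ℝ, 0 < K ∧ ∀ M : ℝ, 0 < M → K * M ^ α ≤ 1 / 2 → ∀ (p : ℂ),
      β = p.re / 2 - n / (2 * r) → ∀ (γ : ℝ), |γ| = 1 → ∀ g : Rn n → ℂ,
      AEStronglyMeasurable g volume →
      eLpNorm g (ENNReal.ofReal r) volume ≤ ENNReal.ofReal (M / 2) →
      ∃ U : Rn n → ℂ, Measurable U ∧
        eLpNorm U (ENNReal.ofReal r) volume ≤ ENNReal.ofReal M ∧
        ∀ ψ : 𝓢(Rn n, ℂ), ∫ x, ψ x * U x =
          (∫ x, ψ x * g x) + Complex.I * γ * duhamelPairing b α p U ψ := by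
  obtain ⟨C, hC, hCx⟩ := exists_duhamel_profile hE
  refine ⟨C, hC, fun M hM hMC p hp γ hγ g hg hgM => ?_⟩
  obtain ⟨D, hD⟩ := hCx p hp
  have h1r : 1 ≤ ENNReal.ofReal r := by rw [ENNReal.one_le_ofReal]; linarith [hE.two_lt]
  have : Fact (1 ≤ ENNReal.ofReal r) := ⟨h1r⟩
  have hnorm : ∀ z : ℂ, ‖Complex.I * (γ : ℂ) * z‖ = ‖z‖ := fun z => by
    rw [norm_mul, norm_mul, Complex.norm_I, Complex.norm_real, Real.norm_eq_abs, hγ, one_mul, one_mul]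
  let Ψ : (Rn n → ℂ) → Rn n → ℂ := fun U x => g x + Complex.I * γ * D U x
  have hΨ : ∀ U : Rn n → ℂ, Measurable U →
      eLpNorm U (ENNReal.ofReal r) volume ≤ ENNReal.ofReal M →
      MemLp (Ψ U) (ENNReal.ofReal r) volume ∧
        eLpNorm (Ψ U) (ENNReal.ofReal r) volume ≤ ENNReal.ofReal M := by
    intro U hU hUM
    obtain ⟨k1, k2, -⟩ := hD U U M 0 hU hU hM.le le_rfl hUM hUM (by simp)
    have k3 : AEStronglyMeasurable (fun x => Complex.I * γ * D U x) volume := k1.const_mul _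
    have k4 : eLpNorm (Ψ U) (ENNReal.ofReal r) volume ≤ ENNReal.ofReal M := by
      refine (eLpNorm_add_le hg k3 h1r).trans ?_
      rw [eLpNorm_congr_norm_ae (f := fun x => Complex.I * γ * D U x) (g := D U)
        (Eventually.of_forall fun x => hnorm _)]
      refine (add_le_add hgM k2).trans ?_
      rw [← ENNReal.ofReal_add (by positivity) (by positivity)]
      refine ENNReal.ofReal_le_ofReal ?_
      nlinarith
    exact ⟨⟨hg.add k3, k4.trans_lt ENNReal.ofReal_lt_top⟩, k4⟩
  let X := Lp ℂ (ENNReal.ofReal r) (volume : Measure (Rn n))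
  let S : Set X := {f | eLpNorm f (ENNReal.ofReal r) volume ≤ ENNReal.ofReal M}
  have hS : S = Metric.closedBall 0 M := by
    ext f
    show eLpNorm f (ENNReal.ofReal r) volume ≤ ENNReal.ofReal M ↔ f ∈ Metric.closedBall 0 M
    rw [mem_closedBall_zero_iff, ← Lp.enorm_def, ← ofReal_norm, ENNReal.ofReal_le_ofReal_iff hM.le]
  have hmeas : ∀ f : X, Measurable (f : Rn n → ℂ) := fun f => (Lp.stronglyMeasurable f).measurable
  open Classical in
  -- The value zero outside the first case is never met on the ball, where `Ψ f` is always in `L^r`.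
  let Φ : X → X := fun f => if h : MemLp (Ψ f) (ENNReal.ofReal r) volume then h.toLp else 0
  have hΦ : ∀ f ∈ S, ∃ h : MemLp (Ψ f) (ENNReal.ofReal r) volume, Φ f = h.toLp := fun f hf =>
    ⟨(hΨ f (hmeas f) hf).1, dif_pos _⟩
  have hmaps : MapsTo Φ S S := by
    intro f hf
    obtain ⟨h, he⟩ := hΦ f hf
    show eLpNorm (Φ f) (ENNReal.ofReal r) volume ≤ ENNReal.ofReal M
    rw [he, eLpNorm_congr_ae h.coeFn_toLp]
    exact (hΨ f (hmeas f) hf).2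
  have hcontr : ContractingWith (1 / 2) (hmaps.restrict Φ S S) := by
    refine ⟨by rw [div_lt_one two_pos]; exact one_lt_two, fun f f' => ?_⟩
    obtain ⟨f, hf⟩ := f
    obtain ⟨f', hf'⟩ := f'
    show edist (Φ f) (Φ f') ≤ ((1 / 2 : NNReal) : ℝ≥0∞) * edist f f'
    obtain ⟨h, he⟩ := hΦ f hf
    obtain ⟨h', he'⟩ := hΦ f' hf'
    have hne : edist f f' ≠ ∞ := edist_ne_top _ _
    have hW : eLpNorm (fun x => f x - f' x) (ENNReal.ofReal r) volume ≤
        ENNReal.ofReal (edist f f').toReal := by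
      rw [ENNReal.ofReal_toReal hne, Lp.edist_def]
      rfl
    obtain ⟨-, -, k3, -⟩ := hD f f' M (edist f f').toReal (hmeas f) (hmeas f') hM.le
      ENNReal.toReal_nonneg hf hf' hW
    rw [he, he', Lp.edist_toLp_toLp]
    have e1 : eLpNorm (Ψ f - Ψ f') (ENNReal.ofReal r) volume =
        eLpNorm (fun x => D f x - D f' x) (ENNReal.ofReal r) volume := by
      refine eLpNorm_congr_norm_ae (Eventually.of_forall fun x => ?_)
      have : (Ψ f - Ψ f') x = Complex.I * γ * (D f x - D f' x) := by
        simp only [Ψ, Pi.sub_apply]; ring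
      rw [this, hnorm]
    rw [e1]
    refine k3.trans ?_
    rw [← mul_assoc, ENNReal.ofReal_mul (by positivity), ENNReal.ofReal_toReal hne]
    gcongr
    refine (ENNReal.ofReal_le_ofReal hMC).trans (le_of_eq ?_)
    rw [ENNReal.ofReal_div_of_pos two_pos]
    simp
  have hcomplete : IsComplete S := by
    rw [hS]; exact Metric.isClosed_closedBall.isComplete
  have h0 : (0 : X) ∈ S := by rw [hS]; exact Metric.mem_closedBall_self hM.le
  obtain ⟨f, hf, hfix, -⟩ := hcontr.exists_fixedPoint' hcomplete hmaps h0 (edist_ne_top _ _)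
  obtain ⟨h, he⟩ := hΦ f hf
  have hfe : (f : Rn n → ℂ) =ᵐ[volume] Ψ f := by
    have h1 := h.coeFn_toLp
    rw [← he, hfix] at h1
    exact h1
  obtain ⟨-, -, -, k4, k5⟩ := hD f f M 0 (hmeas f) (hmeas f) hM.le le_rfl hf hf (by simp)
  have hgT : IsTemperedFun g := isTemperedFun_of_memLp h1r ⟨hg, hgM.trans_lt ENNReal.ofReal_lt_top⟩
  refine ⟨f, hmeas f, hf, fun ψ => ?_⟩
  rw [k5, ← integral_const_mul, ← integral_add (hgT.represents.2 ψ) ((k4 ψ).const_mul _)]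
  refine integral_congr_ae ?_
  filter_upwards [hfe] with x hx
  rw [hx]
  simp only [Ψ]
  ring

/-- The formula `t^{-p/2} U(x/√t)` has no meaning at `t = 0`, so `φ` is inserted there. Both the
linear and the nonlinear term at time `t` reduce by dilation to time one, where they are related by
the profile equation. -/
theorem isGlobalSolution_selfSimilarFun {n : ℕ} {b α r r' s a β γ M : ℝ} {p : ℂ}
    {φ g U : Rn n → ℂ} (hE : Exponents n b α r r' s a β) (hp : β = p.re / 2 - n / (2 * r))
    (hpα : α * p.re = 2 - b) (hφ : IsTemperedFun φ)
    (hg : ∀ t : ℝ, 0 < t →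
      Represents (selfSimilarFun p g t) (schrodingerGroup n t (toDistribution φ)))
    (hM : 0 ≤ M) (hU : Measurable U)
    (hUM : eLpNorm U (ENNReal.ofReal r) volume ≤ ENNReal.ofReal M)
    (hUe : ∀ ψ : 𝓢(Rn n, ℂ), ∫ x, ψ x * U x =
          (∫ x, ψ x * g x) + Complex.I * γ * duhamelPairing b α p U ψ) :
    IsGlobalSolution b α γ φ (fun t => if 0 < t then selfSimilarFun p U t else φ) := by
  obtain ⟨C, hC, hCx⟩ := exists_nonlinearPairing_bound hE
  have hu : ∀ t : ℝ, 0 < t → (if 0 < t then selfSimilarFun p U t else φ) = selfSimilarFun p U t :=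
    fun t ht => if_pos ht
  have hN := fun τ hτ => hCx p hp U U M 0 hU hU hM le_rfl hUM hUM (by simp) τ hτ
  have h1r : 1 ≤ ENNReal.ofReal r := by rw [ENNReal.one_le_ofReal]; linarith [hE.two_lt]
  have hT : ∀ t : ℝ, 0 < t → IsTemperedFun (selfSimilarFun p U t) := fun t ht =>
    isTemperedFun_of_memLp h1r ⟨aestronglyMeasurable_selfSimilarFun p hU.aestronglyMeasurable ht,
      (eLpNorm_selfSimilarFun_le hE.r_pos hp hU.aestronglyMeasurable hUM ht).trans_lt
        ENNReal.ofReal_lt_top⟩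
  have heq : ∀ t : ℝ, 0 < t → ∀ ψ : 𝓢(Rn n, ℂ), ∀ τ ∈ Ioc 0 t,
      nonlinearPairing b α (selfSimilarFun p U τ) (t - τ) ψ =
        schrodingerGroup n (t - τ) (toDistribution (inlsNonlinearity b α
          ((fun t => if 0 < t then selfSimilarFun p U t else φ) τ))) ψ := by
    intro t ht ψ τ hτ
    simp only [hu τ hτ.1]
    rw [schrodingerGroup_nonlinearity_apply (hN τ hτ.1).1]
  refine ⟨?_, ?_, hφ, fun t ht => ?_, fun t ht => ?_, fun t ht ψ => ?_, fun t ht ψ => ?_⟩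
  · refine (measurable_selfSimilarFun p hU).aestronglyMeasurable.congr ?_
    rw [EventuallyEq, ae_restrict_iff' (measurableSet_Ioi.prod MeasurableSet.univ)]
    refine Eventually.of_forall fun z hz => ?_
    have hz1 : 0 < z.1 := hz.1
    simp only [hu z.1 hz1]
  · simp
  · simp only [hu t ht]; exact hT t ht
  · simp only [hu t ht]; exact (hN t ht).1
  · have h := intervalIntegrable_of_weight_bound
      (f := fun τ => nonlinearPairing b α (selfSimilarFun p U τ) (t - τ) ψ)
      (D := C * (M ^ α * M) * (∫ x, ‖ψ x‖ ^ r') ^ (1 / r')) hE.β_mul_lt hE.a_lt ht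
      (aestronglyMeasurable_nonlinearPairing b α p hU t ψ) fun τ hτ => by
        refine (((hN τ hτ.1).2 (t - τ) (by linarith [hτ.2]) ψ).1).trans (le_of_eq (by ring))
    rw [intervalIntegrable_iff_integrableOn_Ioc_of_le ht.le] at h ⊢
    exact h.congr_fun (heq t ht ψ) measurableSet_Ioc
  · have e1 : ∫ τ in (0 : ℝ)..t, schrodingerGroup n (t - τ) (toDistribution (inlsNonlinearity b α
          ((fun t => if 0 < t then selfSimilarFun p U t else φ) τ))) ψ =
        ∫ τ in (0 : ℝ)..t, nonlinearPairing b α (selfSimilarFun p U τ) (t - τ) ψ := by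
      refine intervalIntegral.integral_congr_ae (Eventually.of_forall fun τ hτ => ?_)
      rw [uIoc_of_le ht.le] at hτ
      exact (heq t ht ψ τ hτ).symm
    rw [e1, integral_nonlinearPairing_selfSimilarFun hpα U ht]
    simp only [hu t ht]
    rw [toDistribution_apply (hT t ht), integral_mul_selfSimilarFun p U ht, hUe, (hg t ht).3,
      integral_mul_selfSimilarFun p g ht]
    ring

/-! ### Uniqueness -/

/-- `u(t)` is bounded by `A t^{-β}` in weak `L^r`. -/
def WeakDecay {n : ℕ} (r β A : ℝ) (u : ℝ → Rn n → ℂ) : Prop :=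
  ∀ t : ℝ, 0 < t → ∀ h : ℝ, 0 < h →
    volume {x | h < ‖u t x‖} ≤ ENNReal.ofReal ((t ^ (-β) * A / h) ^ r)

/-- One factor two comes from halving the level, the other from the union of two sets, since `2 ≤
2^r`. -/
theorem WeakDecay.sub {n : ℕ} {r β A : ℝ} {u v : ℝ → Rn n → ℂ} (hr : 1 ≤ r) (hA : 0 < A)
    (hu : WeakDecay r β A u) (hv : WeakDecay r β A v) :
    WeakDecay r β (4 * A) fun t x => u t x - v t x := by
  intro t ht h hh
  have hsub : {x | h < ‖u t x - v t x‖} ⊆ {x | h / 2 < ‖u t x‖} ∪ {x | h / 2 < ‖v t x‖} := by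
    intro x hx
    by_contra hcon
    simp only [mem_union, not_or] at hcon
    have h1 : ‖u t x‖ ≤ h / 2 := not_lt.1 hcon.1
    have h2 : ‖v t x‖ ≤ h / 2 := not_lt.1 hcon.2
    have h3 : h < ‖u t x - v t x‖ := hx
    linarith [norm_sub_le (u t x) (v t x)]
  refine (measure_mono hsub).trans ((measure_union_le _ _).trans
    ((add_le_add (hu t ht _ (half_pos hh)) (hv t ht _ (half_pos hh))).trans ?_))
  rw [← ENNReal.ofReal_add (by positivity) (by positivity)]
  refine ENNReal.ofReal_le_ofReal ?_
  have e : t ^ (-β) * (4 * A) / h = 2 * (t ^ (-β) * A / (h / 2)) := by field_simp; ring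
  rw [e, Real.mul_rpow two_pos.le (by positivity), ← two_mul]
  refine mul_le_mul_of_nonneg_right ?_ (by positivity)
  have := Real.rpow_le_rpow_of_exponent_le one_le_two hr
  rwa [Real.rpow_one] at this

/-- The contraction estimate in weak spaces: weak Hölder for the nonlinearity, the weak dispersive
estimate, and the Duhamel weight. The smallness condition involves `M` but not `W`, so the
improvement can be iterated. -/
theorem exists_weakDecay_half {n : ℕ} {b α r r' s a β : ℝ} (hE : Exponents n b α r r' s a β) :
    ∃ K : ℝ, 0 < K ∧ ∀ M : ℝ, 0 < M → K * M ^ α ≤ 1 / 2 → ∀ (γ : ℝ), |γ| = 1 →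
      ∀ (φ : Rn n → ℂ) (u v : ℝ → Rn n → ℂ), IsGlobalSolution b α γ φ u →
      IsGlobalSolution b α γ φ v → WeakDecay r β M u → WeakDecay r β M v →
      ∀ W : ℝ, 0 < W → WeakDecay r β W (fun t x => u t x - v t x) →
        WeakDecay r β (W / 2) fun t x => u t x - v t x := by
  have hα := hE.α_pos
  have hr0 := hE.r_pos
  have hinv : 1 / r' = 1 - 1 / r := by
    have := hE.conj.inv_add_inv_eq_one
    rw [one_div, one_div]; linarith
  have hrel : b / n + (α + 1) / r = 1 / r' := by
    have h1 : (α + 1) / r = 1 / s := by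
      have := hE.one_lt_s
      rw [← hE.s_mul]; field_simp
    rw [hinv, h1, ← hE.holder]; ring
  obtain ⟨C, hC, hCx⟩ := exists_weak_estimate n hE.two_lt hE.conj
  rw [← hE.a_eq] at hCx
  obtain ⟨K₁, hK₁, hK₁x⟩ := exists_weak_nonlinearity_sub hE.one_le hE.b_pos hα hr0
    hE.conj.symm.pos hrel
  set B := ∫ τ in (0 : ℝ)..1, τ ^ (-(β * (α + 1))) * (1 - τ) ^ (-a)
  have hB : 0 ≤ B := intervalIntegral.integral_nonneg zero_le_one fun τ hτ =>
    mul_nonneg (Real.rpow_nonneg hτ.1 _) (Real.rpow_nonneg (by linarith [hτ.2]) _)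
  refine ⟨C * K₁ * B + 1, by positivity,
    fun M hM hMK γ hγ φ u v hu hv hub hvb W hW hw t ht l hl => ?_⟩
  have hRu := (hu.tempered t ht).represents
  have hRv := (hv.tempered t ht).represents
  have hD : 0 ≤ C * K₁ * M ^ α * W := by positivity
  have key : ∀ ψ : 𝓢(Rn n, ℂ), ‖∫ x, ψ x * (u t x - v t x)‖ ≤
      t ^ (-β) * (W / 2) * ((∫ x, ‖ψ x‖) ^ (1 - 2 / r) * (∫ x, ‖ψ x‖ ^ (2 : ℝ)) ^ (1 / r)) := by
    intro ψ
    set Q := (∫ x, ‖ψ x‖) ^ (1 - 2 / r) * (∫ x, ‖ψ x‖ ^ (2 : ℝ)) ^ (1 / r)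
    have hQ : 0 ≤ Q := mul_nonneg (Real.rpow_nonneg (integral_nonneg fun x => norm_nonneg _) _)
      (Real.rpow_nonneg (integral_nonneg fun x => by positivity) _)
    have e1 : ∫ x, ψ x * (u t x - v t x) = Complex.I * γ * ∫ τ in (0 : ℝ)..t,
        (schrodingerGroup n (t - τ) (toDistribution (inlsNonlinearity b α (u τ))) ψ -
          schrodingerGroup n (t - τ) (toDistribution (inlsNonlinearity b α (v τ))) ψ) := by
      simp_rw [mul_sub]
      rw [integral_sub (hRu.2 ψ) (hRv.2 ψ), ← hRu.3, ← hRv.3, hu.duhamel t ht, hv.duhamel t ht,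
        intervalIntegral.integral_sub (hu.integrable t ht ψ) (hv.integrable t ht ψ)]
      ring
    rw [e1, norm_mul, norm_mul, Complex.norm_I, Complex.norm_real, Real.norm_eq_abs, hγ, one_mul,
      one_mul]
    refine (norm_integral_le_of_weight_bound (D := C * K₁ * M ^ α * W * Q) hE.β_mul_lt hE.a_lt ht
      fun τ hτ => ?_).trans ?_
    · have hτ0 : 0 < τ := hτ.1
      have hσ : 0 < t - τ := by linarith [hτ.2]
      have hNu := hu.tempered_nonlinearity τ hτ0
      have hNv := hv.tempered_nonlinearity τ hτ0
      have hb := hCx (fun x => inlsNonlinearity b α (u τ) x - inlsNonlinearity b α (v τ) x)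
        (K₁ * ((τ ^ (-β) * M) ^ α * (τ ^ (-β) * W)))
        (hNu.represents.1.sub hNv.represents.1) (by positivity)
        (hK₁x (u τ) (v τ) (τ ^ (-β) * M) (τ ^ (-β) * W) (by positivity) (by positivity)
          (hub τ hτ0) (hvb τ hτ0) (hw τ hτ0)) (t - τ) hσ ψ
      rw [schrodingerGroup_nonlinearity_apply hNu, schrodingerGroup_nonlinearity_apply hNv,
        nonlinearPairing, nonlinearPairing, ← integral_sub (hNu.represents.2 _)
        (hNv.represents.2 _)]
      simp_rw [← mul_sub]
      refine hb.trans (le_of_eq ?_)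
      rw [Real.mul_rpow (by positivity) hM.le, ← Real.rpow_mul hτ0.le,
        show -(β * (α + 1)) = -β * α + -β by ring, Real.rpow_add hτ0]
      ring
    · rw [hE.weight_exponent]
      change C * K₁ * M ^ α * W * Q * (t ^ (-β) * B) ≤ _
      have h1 : C * K₁ * B * M ^ α ≤ 1 / 2 := by
        refine le_trans ?_ hMK
        gcongr
        linarith
      calc _ = C * K₁ * B * M ^ α * (t ^ (-β) * W * Q) := by ring
        _ ≤ 1 / 2 * (t ^ (-β) * W * Q) := by gcongr
        _ = _ := by ring
  have h2r : 2 / r ≤ 1 := (div_le_one hr0).2 hE.two_lt.le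
  exact measure_lt_norm_le_of_pairing (hRu.locallyIntegrable.sub hRv.locallyIntegrable)
    (by positivity) (by linarith) (by positivity) two_pos hr0 (by ring) key hl

/-- The bounds on the measure of each superlevel set tend to zero with `A / 2^k`. -/
theorem ae_eq_of_weakDecay {n : ℕ} {r β A : ℝ} {w : ℝ → Rn n → ℂ} (hr : 0 < r)
    (h : ∀ k : ℕ, WeakDecay r β (A / 2 ^ k) w) {t : ℝ} (ht : 0 < t) : ∀ᵐ x, w t x = 0 := by
  have h0 : ∀ l : ℝ, 0 < l → volume {x | l < ‖w t x‖} = 0 := by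
    intro l hl
    refine le_antisymm (ge_of_tendsto' (x := atTop) (f := fun k : ℕ =>
      ENNReal.ofReal ((t ^ (-β) * (A / 2 ^ k) / l) ^ r)) ?_ fun k => h k t ht l hl) zero_le
    have h1 : Tendsto (fun k : ℕ => A / 2 ^ k) atTop (𝓝 0) :=
      tendsto_const_nhds.div_atTop (tendsto_pow_atTop_atTop_of_one_lt one_lt_two)
    have h2 : Tendsto (fun k : ℕ => t ^ (-β) * (A / 2 ^ k) / l) atTop (𝓝 (t ^ (-β) * 0 / l)) :=
      (h1.const_mul _).div_const _
    have h3 := ENNReal.tendsto_ofReal (h2.rpow_const (p := r) (Or.inr hr.le))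
    simpa [Real.zero_rpow hr.ne'] using h3
  have h1 : ∀ k : ℕ, ∀ᵐ x, ‖w t x‖ ≤ 1 / ((k : ℝ) + 1) := fun k => by
    have := h0 (1 / ((k : ℝ) + 1)) (by positivity)
    rw [ae_iff]
    simpa only [not_le] using this
  filter_upwards [ae_all_iff.2 h1] with x hx
  refine norm_le_zero_iff.1 (ge_of_tendsto' tendsto_one_div_add_atTop_nhds_zero_nat hx)

/-- The triangle inequality gives the initial bound `4M` for the difference, and each pass through
the Duhamel formula halves it. -/
theorem exists_uniqueness {n : ℕ} {b α r r' s a β : ℝ} (hE : Exponents n b α r r' s a β) :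
    ∃ K : ℝ, 0 < K ∧ ∀ M : ℝ, 0 < M → K * M ^ α ≤ 1 / 2 → ∀ (γ : ℝ), |γ| = 1 →
      ∀ (φ : Rn n → ℂ) (u v : ℝ → Rn n → ℂ), IsGlobalSolution b α γ φ u →
      IsGlobalSolution b α γ φ v → WeakDecay r β M u → WeakDecay r β M v →
      ∀ t : ℝ, 0 ≤ t → v t =ᵐ[volume] u t := by
  obtain ⟨K, hK, hKx⟩ := exists_weakDecay_half hE
  refine ⟨K, hK, fun M hM hMK γ hγ φ u v hu hv hub hvb t ht => ?_⟩
  rcases ht.eq_or_lt with h0 | h0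
  · rw [← h0]
    exact hv.initial.trans hu.initial.symm
  · have hk : ∀ k : ℕ, WeakDecay r β (4 * M / 2 ^ k) fun t x => u t x - v t x := by
      intro k
      induction k with
      | zero =>
        rw [pow_zero, div_one]
        exact hub.sub (by linarith [hE.two_lt]) hM hvb
      | succ k ih =>
        have := hKx M hM hMK γ hγ φ u v hu hv hub hvb _ (by positivity) ih
        rwa [div_div, ← pow_succ] at this
    filter_upwards [ae_eq_of_weakDecay hE.r_pos hk h0] with x hx
    exact (sub_eq_zero.1 hx).symm

theorem weakDecay_of_lorentzNorm {n : ℕ} {r β M : ℝ} {q : ℝ≥0∞} {u : ℝ → Rn n → ℂ} (hr : 0 < r)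
    (hM : 0 ≤ M) (hq : 0 < q)
    (h : ∀ t : ℝ, 0 < t → ENNReal.ofReal (t ^ β) * lorentzNorm r q (u t) ≤ ENNReal.ofReal M) :
    WeakDecay r β M u := by
  intro t ht l hl
  refine measure_lt_norm_le_of_lorentzNorm (by positivity) hr hq ?_ hl
  have h1 : ENNReal.ofReal (t ^ (-β)) * ENNReal.ofReal (t ^ β) = 1 := by
    rw [← ENNReal.ofReal_mul (by positivity), ← Real.rpow_add ht, neg_add_cancel, Real.rpow_zero,
      ENNReal.ofReal_one]
  calc _ = ENNReal.ofReal (t ^ (-β)) * (ENNReal.ofReal (t ^ β) * lorentzNorm r q (u t)) := by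
        rw [← mul_assoc, h1, one_mul]
    _ ≤ ENNReal.ofReal (t ^ (-β)) * ENNReal.ofReal M := mul_le_mul' le_rfl (h t ht)
    _ = _ := by rw [← ENNReal.ofReal_mul (by positivity)]

/-! ### The exponents of the equation -/

/-- The polynomial factors as `(α - α₀)(nα + nα₀ + n - 2 + 2b)`. The part `nα₀ + n - 2 + 2b` is
positive, because its product with `α₀` is `4 - 2b`. -/
theorem quadratic_pos_of_root_lt {n b α α₀ : ℝ} (hn : 0 < n) (hb2 : b < 2) (hα₀ : 0 < α₀)
    (hroot : n * α₀ ^ 2 + (n - 2 + 2 * b) * α₀ - 4 + 2 * b = 0) (hα : α₀ < α) :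
    0 < n * α ^ 2 + (n - 2 + 2 * b) * α - 4 + 2 * b := by
  have h1 : 0 < n * α₀ + (n - 2 + 2 * b) := by
    refine pos_of_mul_pos_right (b := n * α₀ + (n - 2 + 2 * b)) (a := α₀) ?_ hα₀.le
    nlinarith
  have h2 : 0 < (α - α₀) * (n * α + (n * α₀ + (n - 2 + 2 * b))) :=
    mul_pos (by linarith) (by have := mul_pos hn (hα₀.trans hα); linarith)
  nlinarith

/-- Two inequalities carry the hypotheses. Positivity of `4 - 2b - α(n-2)`, from the upper bound on
`α` or from `n ≤ 2`, gives `β > 0` and `Re p > n/r`. Positivity of the quadratic, from `α > α₀`,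
gives `β(α+1) < 1` and `Re p < n/r'`. -/
theorem exponents_of_admissible {n : ℕ} {b α α₀ : ℝ} (hb : 0 < b) (hb2 : b < 2) (hbn : b < n)
    (hα₀ : 0 < α₀) (hroot : (n : ℝ) * α₀ ^ 2 + ((n : ℝ) - 2 + 2 * b) * α₀ - 4 + 2 * b = 0)
    (hα : α₀ < α) (hα_upper : 3 ≤ n → α < (4 - 2 * b) / ((n : ℝ) - 2)) :
    ∃ r' s a : ℝ, Exponents n b α (lebesgueExponent n b α) r' s a (decayExponent n b α) ∧
      ∀ p : ℂ, p.re = (2 - b) / α → α * p.re = 2 - b ∧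
        decayExponent n b α = p.re / 2 - n / (2 * lebesgueExponent n b α) ∧
        n / lebesgueExponent n b α < p.re ∧ p.re < n / r' := by
  have hα0 : 0 < α := hα₀.trans hα
  have hn0 : (0 : ℝ) < n := hb.trans hbn
  have hn1 : 1 ≤ n := by exact_mod_cast hn0
  have hquad := quadratic_pos_of_root_lt hn0 hb2 hα₀ hroot hα
  have hnb : 0 < (n : ℝ) - b := by linarith
  have hα2 : 0 < α + 2 := by linarith
  have hα1 : 0 < α + 1 := by linarith
  have hnum : 0 < 4 - 2 * b - α * ((n : ℝ) - 2) := by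
    by_cases h3 : 3 ≤ n
    · have h3' : (3 : ℝ) ≤ n := by exact_mod_cast h3
      have := hα_upper h3
      rw [lt_div_iff₀ (by linarith)] at this
      linarith
    · have h2 : (n : ℝ) ≤ 2 := by exact_mod_cast (by omega : n ≤ 2)
      nlinarith
  have hD : 0 < (n : ℝ) * (α + 1) + b := by positivity
  set r := lebesgueExponent n b α with hr
  set β := decayExponent n b α with hβ
  have hr0 : 0 < r := by rw [hr, lebesgueExponent]; positivity
  have hβ0 : 0 < β := by rw [hβ, decayExponent]; positivity
  have hr2 : 2 < r := by
    rw [hr, lebesgueExponent, lt_div_iff₀ hnb]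
    nlinarith [mul_pos hn0 hα0]
  have hinvr : 1 / r = (n - b) / (n * (α + 2)) := by
    rw [hr, lebesgueExponent, one_div_div]
  have hnr : n / r = (n - b) / (α + 2) := by
    rw [hr, lebesgueExponent]; field_simp
  refine ⟨n * (α + 2) / (n * (α + 1) + b), r / (α + 1), n / 2 * (1 - 2 / r),
    ⟨hn1, hb, hα0, hr2, ?_, ?_, ?_, ?_, rfl, ?_, hβ0, ?_⟩, fun p hp => ⟨?_, ?_, ?_, ?_⟩⟩
  · rw [Real.holderConjugate_iff]
    refine ⟨by linarith, ?_⟩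
    rw [← one_div, hinvr, inv_div]
    field_simp
    ring
  · rw [lt_div_iff₀ hα1, one_mul, hr, lebesgueExponent, lt_div_iff₀ hnb]
    nlinarith [mul_pos hb hα1]
  · field_simp
  · rw [one_div_div, div_eq_mul_one_div, hinvr]
    field_simp
    ring
  · rw [show 2 / r = 2 * (1 / r) by ring, hinvr, hβ, decayExponent]
    field_simp
    ring
  · rw [hβ, decayExponent, div_mul_eq_mul_div, div_lt_one (by positivity)]
    nlinarith
  · rw [hp]; field_simp
  · rw [hp, show n / (2 * r) = n / r / 2 by field_simp, hnr, hβ, decayExponent]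
    field_simp
    ring
  · rw [hnr, hp, div_lt_div_iff₀ hα2 hα0]
    nlinarith
  · rw [hp, div_div_eq_mul_div, lt_div_iff₀ (by positivity), div_mul_eq_mul_div,
      div_lt_iff₀ hα0]
    nlinarith [mul_pos hn0 hquad]

/-! ### Assembly of the theorem. -/

theorem selfSimilarFun_one {n : ℕ} (p : ℂ) (U : Rn n → ℂ) : selfSimilarFun p U 1 = U := by
  ext x
  simp [selfSimilarFun]

theorem exists_pos_forall_mul_rpow_le {X α : ℝ} (hX : 0 < X) (hα : 0 < α) :
    ∃ M₀ : ℝ, 0 < M₀ ∧ ∀ M : ℝ, 0 < M → M ≤ M₀ → X * M ^ α ≤ 1 / 2 := by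
  refine ⟨(1 / (2 * X)) ^ (1 / α), by positivity, fun M hM hM0 => ?_⟩
  have h := Real.rpow_le_rpow hM.le hM0 hα.le
  rw [← Real.rpow_mul (by positivity), one_div_mul_cancel hα.ne', Real.rpow_one] at h
  calc X * M ^ α ≤ X * (1 / (2 * X)) := by gcongr
    _ = 1 / 2 := by field_simp

theorem ofReal_rpow_mul_le {t β N : ℝ} {L : ℝ≥0∞} (ht : 0 < t)
    (h : L ≤ ENNReal.ofReal (t ^ (-β) * N)) : ENNReal.ofReal (t ^ β) * L ≤ ENNReal.ofReal N := by
  calc _ ≤ ENNReal.ofReal (t ^ β) * ENNReal.ofReal (t ^ (-β) * N) := mul_le_mul' le_rfl h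
    _ = _ := by
      rw [← ENNReal.ofReal_mul (by positivity), ← mul_assoc, ← Real.rpow_add ht, add_neg_cancel,
        Real.rpow_zero, one_mul]

theorem isSelfSimilar_selfSimilarFun {n : ℕ} {p : ℂ} {φ : Rn n → ℂ} (U : Rn n → ℂ)
    (hhom : ∀ c : ℝ, 0 < c → ∀ x, φ (c • x) = (c : ℂ) ^ (-p) * φ x) :
    IsSelfSimilar p fun t => if 0 < t then selfSimilarFun p U t else φ := by
  intro l hl t ht
  refine Eventually.of_forall fun x => ?_
  rcases ht.eq_or_lt with h0 | h0
  · have hl0 : (l : ℂ) ≠ 0 := by exact_mod_cast hl.ne'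
    simp only [← h0, mul_zero, lt_irrefl, if_false]
    rw [hhom l hl, ← mul_assoc, ← Complex.cpow_add _ _ hl0, add_neg_cancel, Complex.cpow_zero,
      one_mul]
  · have h1 : 0 < l ^ 2 * t := by positivity
    simp only [if_pos h0, if_pos h1]
    exact selfSimilarFun_smul p U hl h0 x

end SelfSimilar

open SelfSimilar

theorem theorem1p2 (n : ℕ) (b α α₀ γ : ℝ) (q : ℝ≥0∞)
    (hb : 0 < b) (hb2 : b < 2) (hbn : b < n)
    (hγ : γ = 1 ∨ γ = -1)
    (hα₀ : 0 < α₀) (hα₀_root : (n : ℝ) * α₀ ^ 2 + ((n : ℝ) - 2 + 2 * b) * α₀ - 4 + 2 * b = 0)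
    (hα : α₀ < α) (hα_upper : 3 ≤ n → α < (4 - 2 * b) / ((n : ℝ) - 2))
    (hq : ENNReal.ofReal (lebesgueExponent n b α) < q) :
    -- the linear evolution of homogeneous data
    (∀ (p : ℂ) (φ : Rn n → ℂ), p.re = (2 - b) / α → φ ∈ homogeneousData n p →
      IsTemperedFun φ ∧
      distLpNorm (ENNReal.ofReal (lebesgueExponent n b α))
        (schrodingerGroup n 1 (toDistribution φ)) < ∞ ∧
      ∀ t : ℝ, 0 < t →
        ENNReal.ofReal (t ^ decayExponent n b α) *
          distLpNorm (ENNReal.ofReal (lebesgueExponent n b α))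
            (schrodingerGroup n t (toDistribution φ)) =
        distLpNorm (ENNReal.ofReal (lebesgueExponent n b α))
          (schrodingerGroup n 1 (toDistribution φ))) ∧
    -- self-similar solutions for small homogeneous data
    ∃ c M₀ : ℝ, 0 < c ∧ 0 < M₀ ∧ ∀ M : ℝ, 0 < M → M ≤ M₀ →
      c * M + wellPosednessConst n b α γ * M ^ (α + 1) ≤ M ∧
      ∀ (p : ℂ) (φ : Rn n → ℂ), p.re = (2 - b) / α → φ ∈ homogeneousData n p →
        distLpNorm (ENNReal.ofReal (lebesgueExponent n b α))
          (schrodingerGroup n 1 (toDistribution φ)) ≤ ENNReal.ofReal (c * M) →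
        (∀ t : ℝ, 0 < t → ENNReal.ofReal (t ^ decayExponent n b α) *
          distLorentzNorm (lebesgueExponent n b α) q
            (schrodingerGroup n t (toDistribution φ)) ≤ ENNReal.ofReal (c * M)) ∧
        ∃ u : ℝ → Rn n → ℂ,
          IsGlobalSolution b α γ φ u ∧
          (∀ t : ℝ, 0 < t → ENNReal.ofReal (t ^ decayExponent n b α) *
            lorentzNorm (lebesgueExponent n b α) q (u t) ≤ ENNReal.ofReal M) ∧
          IsSelfSimilar p u ∧
          ∀ v : ℝ → Rn n → ℂ, IsGlobalSolution b α γ φ v →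
            (∀ t : ℝ, 0 < t → ENNReal.ofReal (t ^ decayExponent n b α) *
              lorentzNorm (lebesgueExponent n b α) q (v t) ≤ ENNReal.ofReal M) →
            ∀ t : ℝ, 0 ≤ t → v t =ᵐ[volume] u t := by
  obtain ⟨r', s, a, hE, hpE⟩ :=
    exponents_of_admissible hb hb2 hbn hα₀ hα₀_root hα hα_upper
  set r := lebesgueExponent n b α
  set β := decayExponent n b α
  have hr0 := hE.r_pos
  have hα0 := hE.α_pos
  have hγ1 : |γ| = 1 := by rcases hγ with h | h <;> simp [h]
  refine ⟨fun p φ hp hφ => ?_, ?_⟩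
  · obtain ⟨-, hpβ, hp1, hp2⟩ := hpE p hp
    obtain ⟨-, hφT, -, g, hg, hrep⟩ :=
      exists_linear_evolution hE.one_le hE.conj hE.two_lt.le hp1 hp2 hφ
    have h1 : distLpNorm (ENNReal.ofReal r) (schrodingerGroup n 1 (toDistribution φ)) =
        eLpNorm g (ENNReal.ofReal r) volume := by
      rw [distLpNorm_eq _ (hrep 1 one_pos), selfSimilarFun_one]
    refine ⟨hφT, h1 ▸ hg.2, fun t ht => ?_⟩
    rw [h1, distLpNorm_eq _ (hrep t ht), eLpNorm_selfSimilarFun p hr0 hg.1 ht, ← hpβ, ← mul_assoc,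
      ← ENNReal.ofReal_mul (by positivity), ← Real.rpow_add ht, add_neg_cancel, Real.rpow_zero,
      ENNReal.ofReal_one, one_mul]
  · obtain ⟨K₁, hK₁, hprofile⟩ := exists_profile hE
    obtain ⟨K₂, hK₂, hunique⟩ := exists_uniqueness hE
    -- One threshold serves the fixed point, uniqueness and the inequality with `K` simultaneously.
    -- It is fixed before `p` and `φ`.
    obtain ⟨M₀, hM₀, hM₀x⟩ := exists_pos_forall_mul_rpow_le
      (X := K₁ + K₂ + |wellPosednessConst n b α γ|) (by positivity) hα0
    -- With `c = 1/2` the linear part takes half of the ball of radius `M` and the Duhamel term the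
    -- other half.
    refine ⟨1 / 2, M₀, by norm_num, hM₀, fun M hM hMM₀ => ?_⟩
    have hsmall := hM₀x M hM hMM₀
    have hMα : 0 ≤ M ^ α := by positivity
    have hw := abs_nonneg (wellPosednessConst n b α γ)
    have hsmall₁ : K₁ * M ^ α ≤ 1 / 2 :=
      (mul_le_mul_of_nonneg_right (by linarith) hMα).trans hsmall
    have hsmall₂ : K₂ * M ^ α ≤ 1 / 2 :=
      (mul_le_mul_of_nonneg_right (by linarith) hMα).trans hsmall
    have hsmall₃ : wellPosednessConst n b α γ * M ^ α ≤ 1 / 2 :=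
      (mul_le_mul_of_nonneg_right
        (by linarith [le_abs_self (wellPosednessConst n b α γ)]) hMα).trans hsmall
    refine ⟨?_, fun p φ hp hφ hφM => ?_⟩
    · rw [Real.rpow_add_one hM.ne', ← mul_assoc]
      nlinarith
    obtain ⟨hpα, hpβ, hp1, hp2⟩ := hpE p hp
    obtain ⟨-, hφT, hhom, g, hg, hrep⟩ :=
      exists_linear_evolution hE.one_le hE.conj hE.two_lt.le hp1 hp2 hφ
    rw [distLpNorm_eq _ (hrep 1 one_pos), selfSimilarFun_one, one_div_mul_eq_div] at hφM
    obtain ⟨U, hU, hUM, hUe⟩ := hprofile M hM hsmall₁ p hpβ γ hγ1 g hg.1 hφM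
    have hsol := isGlobalSolution_selfSimilarFun hE hpβ hpα hφT hrep hM.le hU hUM hUe
    have hbound : ∀ t : ℝ, 0 < t → ENNReal.ofReal (t ^ β) *
        lorentzNorm r q (if 0 < t then selfSimilarFun p U t else φ) ≤ ENNReal.ofReal M := by
      intro t ht
      rw [if_pos ht]
      exact ofReal_rpow_mul_le ht (lorentzNorm_le_of_eLpNorm
        (aestronglyMeasurable_selfSimilarFun p hU.aestronglyMeasurable ht) hr0 (by positivity) hq
        (eLpNorm_selfSimilarFun_le hr0 hpβ hU.aestronglyMeasurable hUM ht))
    have hq0 : 0 < q := lt_of_le_of_lt zero_le hq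
    refine ⟨fun t ht => ?_, _, hsol, hbound, isSelfSimilar_selfSimilarFun U hhom,
      fun v hv hvM => hunique M hM hsmall₂ γ hγ1 φ _ v hsol hv
        (weakDecay_of_lorentzNorm hr0 hM.le hq0 hbound)
        (weakDecay_of_lorentzNorm hr0 hM.le hq0 hvM)⟩
    rw [one_div_mul_eq_div]
    exact ofReal_rpow_mul_le ht (distLorentzNorm_le_of_represents hr0 (by positivity) hq (hrep t ht)
      (eLpNorm_selfSimilarFun_le hr0 hpβ hg.1 hφM ht))
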